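/- **Setting.** There are $M$ sub-networks; sub-network $i$ has $n_i$ agents, a fixed set $\mathcal E_i$ of directed links making it strongly connected, and a designated agent $i_0$; $N=\sum_i n_i$. Let $d_j^i$ be the out-degree of agent $j$ in $\mathcal E_i$, $D^*$ the largest (directed) diameter of a sub-network, and $\beta_i=1/\max_j(d_j^i+1)^2$. In every round $t\ge1$ a link may fail to deliver its packet, unknown to the sender, but each link delivers (is operational) at least once in any $B$ consecutive rounds. Put $\Gamma=BD^*$ and assume $\Gamma\ge 1$; let $\gamma=1-\frac1{4M^2}(\min_i\beta_i)^{2D^*B}$. **Observations.** $\mathcal W\subset\mathbb R^d$ is compact and convex with diameter $R_0$, and $w^*\in\mathcal W$. Agent $j$ of sub-network $i$ observes $y_j^i[t]=H_j^iw^*+\xi_j^i[t]$, $t\ge0$, where the noises $\xi_j^i[t]$ are integrable, have mean zero, are independent over $i,j,t$, and satisfy $\|(H_j^i)^\top\xi_j^i[t]\|\le B_0$ almost surely. $K=\sum_{i,j}(H_j^i)^\top H_j^i$ is positive definite with smallest eigenvalue $\lambda_{\min}$, and $L_0=2R_0\|K\|+B_0$ (spectral norm). **Algorithm.** $\varphi:\mathbb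 R^d\to[0,\infty)$ is $1$-strongly convex for the Euclidean norm, $\varphi(w^*)\le R^2$, and $(\eta[t])_{t\ge0}$ is positive and non-increasing. Start with $z_j^i=0$, $m_j^i=1$, all $\sigma,\tilde\sigma,\rho,\tilde\rho$ zero and arbitrary $w_j^i[0]\in\mathcal W$. Round $t\ge 1$ is the following. (1) $\sigma_j^{i+}=\sigma_j^i[t-1]+\frac{z_j^i[t-1]}{d_j^i+1}$; for each link $(j',j)\in\mathcal E_i$, $\rho_{j'j}^i[t]=\sigma_{j'}^{i+}$ if the link is operational in round $t$ and $\rho_{j'j}^i[t]=\rho_{j'j}^i[t-1]$ otherwise; $z_j^{i+}=\frac{z_j^i[t-1]}{d_j^i+1}+\sum_{j':(j',j)\in\mathcal E_i}(\rho_{j'j}^i[t]-\rho_{j'j}^i[t-1])$; $\sigma_j^i[t]=\sigma_j^{i+}+\frac{z_j^{i+}}{d_j^i+1}$ and $z_j^i[t]=\frac{z_j^{i+}}{d_j^i+1}$. The masses $m,\tilde\sigma,\tilde\rho$ are updated by the same formulas. (2) Add $(H_j^i)^\top(H_j^iw_j^i[t-1]-y_j^i[t-1])$ to $z_j^i[t]$.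 (3) $w_j^i[t]=\arg\min_{w\in\mathcal W}\{\langle z_j^i[t]/m_j^i[t],w\rangle+\varphi(w)/\eta[t-1]\}$. (4) If $\Gamma\mid t$, every designated agent replaces $z_{i_0}^i[t]$ by $\frac12z_{i_0}^i[t]+\frac1{2M}\sum_{k=1}^Mz_{k_0}^k[t]$, and its mass likewise. **Theorem.** Let $\hat w_j^i[t]=\frac1t\sum_{r=1}^tw_j^i[r]$. For every $t\ge2\Gamma$ and $\delta\in(0,1)$, with probability at least $1-\delta$, for all agents, $$\|\hat w_j^i[t]-w^*\|^2\le\frac1{\lambda_{\min}}\Big(\frac{NL_0^2}{2t}\sum_{r=1}^t\eta[r-1]+\frac{NR^2}{t\,\eta[t]}+\frac{4M^2L_0^2\,\gamma^{\frac1{2\Gamma}}}{\big(1-\gamma^{\frac1{2\Gamma}}\big)(\min_i\beta_i)^{2D^*B}}\cdot\frac1t\sum_{r=1}^t\eta[r-1]+4NL_0R_0\sqrt{\frac{\log(1/\delta)}t}\Big).$$ -/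

import Mathlib

open MeasureTheory ProbabilityTheory

noncomputable section

namespace HierEst

/-! ### Directed graphs: distance and diameter -/

/-- `HasWalk G k u v`: there is a directed walk with exactly `k` links from `u` to `v`. -/
def HasWalk {V : Type} (G : Digraph V) : ℕ → V → V → Prop
  | 0, u, v => u = v
  | k + 1, u, v => ∃ x, G.Adj u x ∧ HasWalk G k x v

/-- Directed distance: the least number of links of a directed walk from `u` to `v`. -/
def ddist {V : Type} (G : Digraph V) (u v : V) : ℕ := sInf {k | HasWalk G k u v}

/-- Diameter: the largest directed distance. -/
def ddiam {V : Type} [Fintype V] (G : Digraph V) : ℕ :=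
  Finset.univ.sup fun q : V × V => ddist G q.1 q.2

/-- Every vertex can be reached from every vertex along directed links. -/
def StronglyConnected {V : Type} (G : Digraph V) : Prop := ∀ u v, ∃ k, HasWalk G k u v

/-! ### Hierarchical networks -/

/-- A hierarchical system: `M` sub-networks, the `i`-th with agents `Fin (n i)`, directed link set
`link i` (an adjacency `link i j' j` is a link from `j'` to `j`), and designated agent `lead i`,
the one that talks to the parameter server. -/
structure Network where
  M : ℕ
  n : Fin M → ℕ
  link : ∀ i, Digraph (Fin (n i))
  lead : ∀ i, Fin (n i)

/-- A pattern of links: for each sub-network the links that are operational in a given round. -/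
abbrev Network.Pattern (S : Network) := ∀ i, Digraph (Fin (S.n i))

/-- Agents of the whole system. -/
abbrev Network.Agent (S : Network) := Σ i : Fin S.M, Fin (S.n i)

namespace Network

variable (S : Network)

/-- Total number of agents. -/
def N : ℕ := ∑ i, S.n i

open Classical in
/-- Out-degree of an agent in its sub-network. -/
def deg (a : S.Agent) : ℕ := (Finset.univ.filter fun k => (S.link a.1).Adj a.2 k).card

/-- Largest diameter of a sub-network. -/
def Dstar : ℕ := Finset.univ.sup fun i => ddiam (S.link i)

/-- `β i = 1 / max_j (d_j + 1)^2`, the maximum over the agents of sub-network `i`. -/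
def β (i : Fin S.M) : ℝ :=
  1 / ((Finset.univ.sup fun j : Fin (S.n i) => (S.deg ⟨i, j⟩ + 1) ^ 2 : ℕ) : ℝ)

/-- `(min_i β i) ^ (2 D* B)`. -/
def βpow (B : ℕ) : ℝ := (⨅ i, S.β i) ^ (2 * S.Dstar * B)

/-- `γ = 1 - (min_i β i) ^ (2 D* B) / (4 M^2)`. -/
def γ (B : ℕ) : ℝ := 1 - 1 / (4 * (S.M : ℝ) ^ 2) * S.βpow B

/-- `op t` is the set of links that deliver their packet in round `t` (rounds are numbered from
`1`). Only links of the network can be operational, and each link is operational at least once in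
any `B` consecutive rounds. -/
def Reliable (B : ℕ) (op : ℕ → S.Pattern) : Prop :=
  (∀ t i u v, (op t i).Adj u v → (S.link i).Adj u v) ∧
  ∀ i u v, (S.link i).Adj u v → ∀ t : ℕ, ∃ s, t < s ∧ s ≤ t + B ∧ (op s i).Adj u v

end Network

/-! ### Hierarchical push-sum -/

/-- Variables of push-sum with quantities in `X` (`X = ℝ^d` for values, `X = ℝ` for masses):
the current quantity `val` of each agent, the cumulative quantity `sent` that it has broadcast
(`σ`), and the cumulative quantity `recv i j' j` that `j` has received from `j'` (`ρ`). -/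
@[ext] structure PushSum (S : Network) (X : Type) where
  val : S.Agent → X
  sent : S.Agent → X
  recv : ∀ i, Fin (S.n i) → Fin (S.n i) → X

section PushSum

variable {S : Network} {X : Type} [AddCommGroup X] [Module ℝ X]

/-- Start with the quantities `v`, nothing sent and nothing received. -/
def PushSum.init (v : S.Agent → X) : PushSum S X := ⟨v, 0, 0⟩

/-- `σ⁺`: cumulative broadcast after the first half of a round. -/
def sentPlus (s : PushSum S X) (a : S.Agent) : X :=
  s.sent a + (1 / ((S.deg a : ℝ) + 1)) • s.val a

open Classical in
/-- New `ρ`: overwritten by `σ⁺` of the sender if the packet arrives, unchanged otherwise. -/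
def recvNew (P : S.Pattern) (s : PushSum S X) (i : Fin S.M) (j' j : Fin (S.n i)) : X :=
  if (P i).Adj j' j then sentPlus s ⟨i, j'⟩ else s.recv i j' j

open Classical in
/-- `z⁺` (or `m⁺`): own share plus everything newly received over incoming links. -/
def valPlus (P : S.Pattern) (s : PushSum S X) (a : S.Agent) : X :=
  (1 / ((S.deg a : ℝ) + 1)) • s.val a +
    ∑ j' ∈ Finset.univ.filter (fun j' => (S.link a.1).Adj j' a.2),
      (recvNew P s a.1 j' a.2 - s.recv a.1 j' a.2)

/-- One round of robust push-sum inside the sub-networks; `P` is the operational pattern. -/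
def localStep (P : S.Pattern) (s : PushSum S X) : PushSum S X where
  val a := (1 / ((S.deg a : ℝ) + 1)) • valPlus P s a
  sent a := sentPlus s a + (1 / ((S.deg a : ℝ) + 1)) • valPlus P s a
  recv := recvNew P s

/-- Fusion through the parameter server: each designated agent keeps half of its quantity and gets
the average over the sub-networks of the other halves. -/
def fuse (v : S.Agent → X) (a : S.Agent) : X :=
  if a.2 = S.lead a.1 then
    (1 / 2 : ℝ) • v a + (1 / (2 * (S.M : ℝ))) • ∑ k, v ⟨k, S.lead k⟩
  else v a

/-- Fusion takes place in the rounds that are multiples of `Γ`. -/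
def fuseAt (Γ t : ℕ) (v : S.Agent → X) : S.Agent → X := if t % Γ = 0 then fuse v else v

end PushSum

/-! ### Linear observations and dual averaging -/

/-- `ℝ^d` with the Euclidean norm. -/
abbrev Vec (d : ℕ) := EuclideanSpace ℝ (Fin d)

/-- A matrix acting on Euclidean vectors. -/
def app {p d : ℕ} (H : Matrix (Fin p) (Fin d) ℝ) (w : Vec d) : Vec p := Matrix.toEuclideanLin H w

/-- Minimiser over `W` of `⟪z, w⟫ + φ w / η`. -/
def dualProx {d : ℕ} (W : Set (Vec d)) (φ : Vec d → ℝ) (z : Vec d) (η : ℝ) : Vec d :=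
  Classical.epsilon fun w => w ∈ W ∧ IsMinOn (fun u => inner ℝ z u + (1 / η) * φ u) W w

/-- State of the estimation algorithm: values `z`, masses `m`, local estimates `w`. -/
structure EstState (S : Network) (d : ℕ) where
  value : PushSum S (Vec d)
  mass : PushSum S ℝ
  est : S.Agent → Vec d

section Algorithm

variable (S : Network) {d : ℕ} {p : S.Agent → ℕ} (H : ∀ a, Matrix (Fin (p a)) (Fin d) ℝ)
  (op : ℕ → S.Pattern) (Γ : ℕ) (W : Set (Vec d)) (φ : Vec d → ℝ) (η : ℕ → ℝ)

/-- Stochastic gradient `Hᵀ (H w - y)` of agent `a`. -/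
def stochGrad (a : S.Agent) (w : Vec d) (y : Vec (p a)) : Vec d :=
  app (H a).transpose (app (H a) w - y)

/-- Value variables of round `t` after the push-sum update and the addition of the stochastic
gradients, which use the estimates and observations `y` of round `t - 1`. -/
def newValue (t : ℕ) (s : EstState S d) (y : ∀ a, Vec (p a)) (a : S.Agent) : Vec d :=
  (localStep (op t) s.value).val a + stochGrad S H a (s.est a) (y a)

/-- Round `t ≥ 1`: push-sum inside the sub-networks, addition of the stochastic gradient, new
estimate by dual averaging with step size `η (t - 1)`, and fusion if `Γ` divides `t`. -/
def round (t : ℕ) (s : EstState S d) (y : ∀ a, Vec (p a)) : EstState S d where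
  value := { localStep (op t) s.value with val := fuseAt Γ t (newValue S H op t s y) }
  mass := { localStep (op t) s.mass with val := fuseAt Γ t (localStep (op t) s.mass).val }
  est a := dualProx W φ (((localStep (op t) s.mass).val a)⁻¹ • newValue S H op t s y a) (η (t - 1))

/-- The run of the algorithm on the observations `y t a`, from zero values, unit masses and initial
estimates `w0`. -/
def run (w0 : S.Agent → Vec d) (y : ℕ → ∀ a, Vec (p a)) : ℕ → EstState S d
  | 0 => ⟨PushSum.init 0, PushSum.init 1, w0⟩
  | t + 1 => round S H op Γ W φ η (t + 1) (run w0 y t) (y t)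

/-- Running average `(1/t) ∑_{r=1}^t w_a[r]` of the local estimates of agent `a`. -/
def runningAvg (w0 : S.Agent → Vec d) (y : ℕ → ∀ a, Vec (p a)) (a : S.Agent) (t : ℕ) : Vec d :=
  (1 / (t : ℝ)) • ∑ r ∈ Finset.Icc 1 t, (run S H op Γ W φ η w0 y r).est a

/-- `K = ∑ Hᵀ H`, the sum over all agents. -/
def obsGram : Matrix (Fin d) (Fin d) ℝ := ∑ a, (H a).transpose * H a

/-- Operator norm of a matrix between Euclidean spaces. -/
def opNorm (A : Matrix (Fin d) (Fin d) ℝ) : ℝ := ‖Matrix.toEuclideanCLM (n := Fin d) (𝕜 := ℝ) A‖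

/-- `L₀ = 2 R₀ ‖K‖ + B₀` with `R₀` the diameter of `W`. -/
def gradBound (B₀ : ℝ) : ℝ := 2 * Metric.diam W * opNorm (obsGram S H) + B₀

end Algorithm

/-- Smallest eigenvalue of a Hermitian real matrix. -/
def lambdaMin {d : ℕ} {A : Matrix (Fin d) (Fin d) ℝ} (hA : A.IsHermitian) : ℝ :=
  ⨅ i, hA.eigenvalues i

end HierEst

end

open MeasureTheory ProbabilityTheory

noncomputable section

namespace HierEst

/-! ### Weightings of agents and links, dual to push-sum states -/

/-! Push-sum with fusion is linear in the injected gradients, so it is studied through its adjoint.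
A `Weighting` is a functional that reads both what the agents hold and what is in transit on the
links; lost packets then need no separate treatment. Going back through a local round turns a
weighting into its `pull`, and fusion is self-adjoint (`pair_pull`, `sum_fuse_smul`). The backward
sequence that ends with the functional reading agent `a` in round `t` gives the coefficient of every
past gradient in `z`, and its pairing with the unit initial masses gives `m`.

Each backward step is an averaging: it fixes constants, so the smallest coefficient never decreases
and the largest never increases. Strong connectivity and delivery within `B` rounds give every
coefficient a definite part of those of the designated agents, and fusion couples the sub-networks.
Hence the spread contracts by a fixed factor every `2 * Γ` rounds (`Routed.contraction`). Dividing
by `m` needs lower bounds on masses: at one of any two consecutive fusions the designated agents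
hold a definite share of the total (`Routed.leadMass_add_ge`). The outcome is
`Routed.sum_ratioDev_le`: the coefficients of `z / m` deviate from `1 / N` by a total amount, over
all rounds and agents, that does not depend on `t`.

The estimates are then compared with `center`, the dual averaging sequence driven by the averages of
the same gradients. The prox map is `η`-Lipschitz, so every agent stays within a multiple of the
step size of the center. The regret of the center, the quadratic form `K` and the convexity of the
squared norm give a pathwise bound (`lambdaMin_mul_runningAvg_le`) in which the noise enters only
through the sum of the products of gradient noise and center error. The center of round `r` depends
on earlier noise only, so this sum is controlled as in Azuma–Hoeffding
(`hasSubgaussianMGF_noiseSum`). It is the same for all agents, so no union bound is needed. Finally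
`budget` checks that the consensus constant of the theorem absorbs all constants collected on the
way. -/

/-- The fraction `1 / (deg + 1)` of its quantity that an agent keeps or sends over one link. -/
def share (S : Network) (a : S.Agent) : ℝ := 1 / ((S.deg a : ℝ) + 1)

open Classical in
/-- Out-neighbours of an agent. -/
def outNbrs (S : Network) (a : S.Agent) : Finset (Fin (S.n a.1)) :=
  Finset.univ.filter fun k => (S.link a.1).Adj a.2 k

/-- A linear functional on push-sum states: coefficients of the quantities of the agents and of the
quantities in transit on the links. -/
@[ext] structure Weighting (S : Network) where
  node : S.Agent → ℝ
  buf : ∀ i, Fin (S.n i) → Fin (S.n i) → ℝ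

namespace Weighting

variable {S : Network} {X : Type} [AddCommGroup X] [Module ℝ X]

/-- Coefficient of a quantity received by an agent in the middle of a round. -/
def mid (f : Weighting S) (a : S.Agent) : ℝ :=
  share S a * (f.node a + ∑ k ∈ outNbrs S a, f.buf a.1 a.2 k)

open Classical in
/-- Coefficient, before a round, of a quantity in transit. -/
def pullBuf (P : S.Pattern) (f : Weighting S) (i : Fin S.M) (u v : Fin (S.n i)) : ℝ :=
  if (P i).Adj u v then f.mid ⟨i, v⟩ else f.buf i u v

/-- The weighting before a local round that corresponds to the weighting `f` after it. -/
def pull (P : S.Pattern) (f : Weighting S) : Weighting S where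
  node a := share S a * (f.mid a + ∑ k ∈ outNbrs S a, pullBuf P f a.1 a.2 k)
  buf := pullBuf P f

/-- The weighting before fusion that corresponds to `f` after it. -/
def fuseW (Γ r : ℕ) (f : Weighting S) : Weighting S := { f with node := fuseAt Γ r f.node }

/-- Evaluation of a weighting at a push-sum state. -/
def pair (f : Weighting S) (s : PushSum S X) : X :=
  ∑ a, (f.node a • s.val a +
    ∑ k ∈ outNbrs S a, f.buf a.1 a.2 k • (s.sent a - s.recv a.1 a.2 k))

lemma sum_in_eq_sum_out {S : Network} {X : Type*} [AddCommMonoid X] (F : ∀ i, Fin (S.n i) → Fin (S.n i) → X) :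
    (open Classical in ∑ a : S.Agent,
      ∑ j' ∈ Finset.univ.filter (fun j' => (S.link a.1).Adj j' a.2), F a.1 j' a.2) =
    ∑ a : S.Agent, ∑ k ∈ outNbrs S a, F a.1 a.2 k := by
  classical
  rw [Fintype.sum_sigma, Fintype.sum_sigma]
  refine Finset.sum_congr rfl fun i _ => ?_
  simp only [outNbrs, Finset.sum_filter]
  exact Finset.sum_comm (s := (Finset.univ : Finset (Fin (S.n i))))
    (t := (Finset.univ : Finset (Fin (S.n i))))
    (f := fun v u => if (S.link i).Adj u v then F i u v else 0)

/-- `pull` is the adjoint of a local round. What is in transit after the first broadcast splits into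
the part received in this round, read with the coefficient `mid` of the receiver, and the part still
in transit, read with `buf`. One of the two vanishes, according to whether the link delivers. -/
lemma pair_pull (P : S.Pattern) (f : Weighting S) (s : PushSum S X) :
    (pull P f).pair s = f.pair (localStep P s) := by
  classical
  -- Receipts are indexed by the receiver in the algorithm and by the sender in a weighting.
  have key := sum_in_eq_sum_out (S := S) (X := X)
    (fun i u v => f.mid ⟨i, v⟩ • (recvNew P s i u v - s.recv i u v))
  have hL : (pull P f).pair s = ∑ a : S.Agent, (f.mid a • share S a • s.val a +
      ∑ k ∈ outNbrs S a, pullBuf P f a.1 a.2 k • (sentPlus s a - s.recv a.1 a.2 k)) := by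
    refine Finset.sum_congr rfl fun a _ => ?_
    have : ∀ k, pullBuf P f a.1 a.2 k • (sentPlus s a - s.recv a.1 a.2 k) =
        pullBuf P f a.1 a.2 k • (s.sent a - s.recv a.1 a.2 k) +
          pullBuf P f a.1 a.2 k • (share S a • s.val a) := by
      intro k; rw [sentPlus, share]; module
    simp only [this, Finset.sum_add_distrib, ← Finset.sum_smul, pull]
    module
  have hR : f.pair (localStep P s) = ∑ a : S.Agent, (f.mid a • valPlus P s a +
      ∑ k ∈ outNbrs S a, f.buf a.1 a.2 k • (sentPlus s a - recvNew P s a.1 a.2 k)) := by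
    refine Finset.sum_congr rfl fun a _ => ?_
    have : ∀ k, f.buf a.1 a.2 k • ((localStep P s).sent a - (localStep P s).recv a.1 a.2 k) =
        f.buf a.1 a.2 k • (sentPlus s a - recvNew P s a.1 a.2 k) +
          f.buf a.1 a.2 k • (share S a • valPlus P s a) := by
      intro k; simp only [localStep, share]; module
    simp only [this, Finset.sum_add_distrib, ← Finset.sum_smul]
    simp only [localStep, mid]
    change f.node a • share S a • _ + _ = _
    module
  have hx : ∀ a : S.Agent, f.mid a • valPlus P s a = f.mid a • share S a • s.val a +
      ∑ j' ∈ Finset.univ.filter (fun j' => (S.link a.1).Adj j' a.2),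
        f.mid ⟨a.1, a.2⟩ • (recvNew P s a.1 j' a.2 - s.recv a.1 j' a.2) := by
    intro a
    rw [valPlus, smul_add, Finset.smul_sum]; rfl
  have hb : ∀ (a : S.Agent) k, pullBuf P f a.1 a.2 k • (sentPlus s a - s.recv a.1 a.2 k) =
      f.mid ⟨a.1, k⟩ • (recvNew P s a.1 a.2 k - s.recv a.1 a.2 k) +
        f.buf a.1 a.2 k • (sentPlus s a - recvNew P s a.1 a.2 k) := by
    intro a k
    simp only [pullBuf, recvNew]
    split_ifs
    · simp
    · simp
  rw [hL, hR]
  simp only [hx, hb, Finset.sum_add_distrib]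
  rw [key]
  abel

end Weighting

/-! ### Fusion as a symmetric operator. -/

section Fusion

lemma sum_lead {S : Network} {X : Type*} [AddCommMonoid X] (F : S.Agent → X) :
    ∑ a : S.Agent, (if a.2 = S.lead a.1 then F a else 0) = ∑ i, F ⟨i, S.lead i⟩ := by
  rw [Fintype.sum_sigma]
  refine Finset.sum_congr rfl fun i _ => ?_
  rw [Finset.sum_ite_eq' Finset.univ (S.lead i) (fun j => F ⟨i, j⟩)]
  simp

variable {S : Network} {X : Type} [AddCommGroup X] [Module ℝ X]

lemma fuse_eq_add (v : S.Agent → X) (a : S.Agent) :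
    fuse v a = v a + (if a.2 = S.lead a.1 then
      (1 / (2 * (S.M : ℝ))) • ∑ k, v ⟨k, S.lead k⟩ - (1 / 2 : ℝ) • v a else 0) := by
  unfold fuse
  split_ifs
  · module
  · simp

/-- On the designated agents fusion is half the identity plus half the averaging matrix, and
elsewhere it is the identity; this matrix is symmetric. -/
lemma sum_fuse_smul (c : S.Agent → ℝ) (v : S.Agent → X) :
    ∑ a, fuse c a • v a = ∑ a, c a • fuse v a := by
  have h1 : ∀ a, fuse c a • v a = c a • v a + (if a.2 = S.lead a.1 then
      ((1 / (2 * (S.M : ℝ))) * ∑ k, c ⟨k, S.lead k⟩ - (1 / 2 : ℝ) * c a) • v a else 0) := by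
    intro a
    rw [fuse_eq_add]; split_ifs <;> simp [add_smul]
  have h2 : ∀ a, c a • fuse v a = c a • v a + (if a.2 = S.lead a.1 then
      c a • ((1 / (2 * (S.M : ℝ))) • ∑ k, v ⟨k, S.lead k⟩ - (1 / 2 : ℝ) • v a) else 0) := by
    intro a
    rw [fuse_eq_add]; split_ifs <;> simp [smul_add]
  simp only [h1, h2, Finset.sum_add_distrib]
  rw [sum_lead (fun a => ((1 / (2 * (S.M : ℝ))) * ∑ k, c ⟨k, S.lead k⟩ - (1 / 2 : ℝ) * c a) • v a),
    sum_lead (fun a => c a • ((1 / (2 * (S.M : ℝ))) • ∑ k, v ⟨k, S.lead k⟩ - (1 / 2 : ℝ) • v a))]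
  congr 1
  simp only [sub_smul, smul_sub, Finset.sum_sub_distrib, mul_smul, ← Finset.smul_sum,
    ← Finset.sum_smul]
  congr 1
  · rw [smul_comm]
  · rw [Finset.smul_sum]; exact Finset.sum_congr rfl fun i _ => smul_comm _ _ _

lemma sum_fuseAt_smul (Γ r : ℕ) (c : S.Agent → ℝ) (v : S.Agent → X) :
    ∑ a, fuseAt Γ r c a • v a = ∑ a, c a • fuseAt Γ r v a := by
  unfold fuseAt
  split_ifs
  · exact sum_fuse_smul c v
  · rfl

end Fusion

/-! ### Backward sequences and their duality with runs. -/

section Evolution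

variable {S : Network} {X : Type} [AddCommGroup X] [Module ℝ X]

open Weighting

lemma Weighting.pair_fuseW (Γ r : ℕ) (f : Weighting S) (s : PushSum S X) (v : S.Agent → X) :
    (fuseW Γ r f).pair { s with val := v } = f.pair { s with val := fuseAt Γ r v } := by
  simp only [pair, fuseW, Finset.sum_add_distrib, sum_fuseAt_smul]

/-- `U` is a sequence of weightings obtained from `U t` by going backwards in time through
the rounds `t, t - 1, …`; `U r` refers to the state of round `r` before fusion. -/
def IsBackward (op : ℕ → S.Pattern) (Γ t : ℕ) (U : ℕ → Weighting S) : Prop :=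
  ∀ r < t, U r = fuseW Γ r (pull (op (r + 1)) (U (r + 1)))

/-- The backward sequence that ends with `f` at time `t`. -/
def backward (op : ℕ → S.Pattern) (Γ t : ℕ) (f : Weighting S) (r : ℕ) : Weighting S :=
  if r < t then fuseW Γ r (pull (op (r + 1)) (backward op Γ t f (r + 1))) else f
termination_by t - r

lemma isBackward_backward (op : ℕ → S.Pattern) (Γ t : ℕ) (f : Weighting S) :
    IsBackward op Γ t (backward op Γ t f) := by
  intro r hr
  rw [backward, if_pos hr]

lemma backward_self (op : ℕ → S.Pattern) (Γ t : ℕ) (f : Weighting S) :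
    backward op Γ t f t = f := by
  rw [backward, if_neg (lt_irrefl t)]

/-- `st` is a run of push-sum with fusion in which the quantity `g r a` is injected at agent `a`
in round `r + 1`. -/
def IsRun (op : ℕ → S.Pattern) (Γ : ℕ) (g : ℕ → S.Agent → X) (st : ℕ → PushSum S X) : Prop :=
  ∀ r, st (r + 1) = { localStep (op (r + 1)) (st r) with
    val := fuseAt Γ (r + 1) fun a => (localStep (op (r + 1)) (st r)).val a + g r a }

variable {op : ℕ → S.Pattern} {Γ : ℕ} {g : ℕ → S.Agent → X} {st : ℕ → PushSum S X}

lemma pair_add_val (f : Weighting S) (s : PushSum S X) (v w : S.Agent → X) :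
    f.pair { s with val := fun a => v a + w a } =
      f.pair { s with val := v } + ∑ a, f.node a • w a := by
  simp only [pair, smul_add, Finset.sum_add_distrib]
  abel

lemma IsRun.pair_succ (h : IsRun op Γ g st) {t : ℕ} {U : ℕ → Weighting S}
    (hU : IsBackward op Γ t U) {r : ℕ} (hr : r + 1 < t) :
    (pull (op (r + 2)) (U (r + 2))).pair (st (r + 1)) =
      (pull (op (r + 1)) (U (r + 1))).pair (st r) + ∑ a, (U (r + 1)).node a • g r a := by
  rw [pair_pull (op (r + 1)), h r, ← Weighting.pair_fuseW, ← hU (r + 1) hr, pair_add_val]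

/-- The pairing of state and backward weighting changes only by injections; without injections it is
conserved. -/
lemma IsRun.pair_eq (h : IsRun op Γ g st) {t : ℕ} {U : ℕ → Weighting S}
    (hU : IsBackward op Γ t U) {r : ℕ} (hr : r < t) :
    (pull (op (r + 1)) (U (r + 1))).pair (st r) =
      (pull (op 1) (U 1)).pair (st 0) + ∑ q ∈ Finset.range r, ∑ a, (U (q + 1)).node a • g q a := by
  induction r with
  | zero => simp
  | succ r ih =>
    rw [h.pair_succ hU hr, ih (by omega), Finset.sum_range_succ]
    abel

/-- Value of a weighting of the quantities of round `t` before fusion. -/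
lemma IsRun.pair_final (h : IsRun op Γ g st) {t : ℕ} {U : ℕ → Weighting S}
    (hU : IsBackward op Γ (t + 1) U) :
    (U (t + 1)).pair { localStep (op (t + 1)) (st t) with
      val := fun a => (localStep (op (t + 1)) (st t)).val a + g t a } =
      (pull (op 1) (U 1)).pair (st 0) +
        ∑ q ∈ Finset.range (t + 1), ∑ a, (U (q + 1)).node a • g q a := by
  rw [pair_add_val, Finset.sum_range_succ, ← add_assoc, ← h.pair_eq hU (Nat.lt_succ_self t),
    ← pair_pull]

end Evolution

/-! ### Backward steps as averagings: invariance of constants and order bounds. -/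

section Bounds

variable {S : Network}

lemma share_pos (a : S.Agent) : 0 < share S a := by unfold share; positivity

lemma share_mul (a : S.Agent) : share S a * (1 + (outNbrs S a).card) = 1 := by
  have : (outNbrs S a).card = S.deg a := rfl
  rw [this, share]
  field_simp
  ring

namespace Weighting

/-- All coefficients of the agents and of the links are at least `q`. -/
def AtLeast (f : Weighting S) (q : ℝ) : Prop :=
  (∀ a, q ≤ f.node a) ∧ ∀ i u v, (S.link i).Adj u v → q ≤ f.buf i u v

/-- The weighting `c + k * f`. -/
def aff (c k : ℝ) (f : Weighting S) : Weighting S :=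
  ⟨fun a => c + k * f.node a, fun i u v => c + k * f.buf i u v⟩

lemma mem_outNbrs {a : S.Agent} {k : Fin (S.n a.1)} :
    k ∈ outNbrs S a ↔ (S.link a.1).Adj a.2 k := by
  simp [outNbrs]

/-- The weights used by an agent, one share for itself and one for each out-neighbour, add up to
`1`. -/
lemma share_mul_aff (c k x : ℝ) (a : S.Agent) (g : Fin (S.n a.1) → ℝ) :
    share S a * (c + k * x + ∑ v ∈ outNbrs S a, (c + k * g v)) =
      c + k * (share S a * (x + ∑ v ∈ outNbrs S a, g v)) := by
  rw [Finset.sum_add_distrib, Finset.sum_const, nsmul_eq_mul, ← Finset.mul_sum]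
  linear_combination c * share_mul a

lemma mid_aff (c k : ℝ) (f : Weighting S) (a : S.Agent) :
    (aff c k f).mid a = c + k * f.mid a :=
  share_mul_aff c k (f.node a) a _

lemma pullBuf_aff (P : S.Pattern) (c k : ℝ) (f : Weighting S) (i) (u v : Fin (S.n i)) :
    pullBuf P (aff c k f) i u v = c + k * pullBuf P f i u v := by
  unfold pullBuf
  split_ifs
  · exact mid_aff c k f _
  · rfl

lemma pull_aff (P : S.Pattern) (c k : ℝ) (f : Weighting S) :
    pull P (aff c k f) = aff c k (pull P f) := by
  ext a
  · simp only [pull, mid_aff, pullBuf_aff]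
    exact share_mul_aff c k (f.mid a) a _
  · exact pullBuf_aff ..

lemma fuseW_aff (hM : S.M ≠ 0) (Γ r : ℕ) (c k : ℝ) (f : Weighting S) :
    fuseW Γ r (aff c k f) = aff c k (fuseW Γ r f) := by
  have hM' : (S.M : ℝ) ≠ 0 := by exact_mod_cast hM
  ext a
  · simp only [fuseW, fuseAt, aff]
    split_ifs
    · unfold fuse
      split_ifs
      · simp only [smul_eq_mul, Finset.sum_add_distrib, Finset.sum_const, Finset.card_univ,
          Fintype.card_fin, nsmul_eq_mul, ← Finset.mul_sum]
        field_simp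
        ring
      · rfl
    · rfl
  · rfl

lemma share_mul_ge {q x : ℝ} {a : S.Agent} {g : Fin (S.n a.1) → ℝ} (hx : q ≤ x)
    (hg : ∀ v, (S.link a.1).Adj a.2 v → q ≤ g v) :
    q ≤ share S a * (x + ∑ v ∈ outNbrs S a, g v) := by
  have h1 : ((outNbrs S a).card : ℝ) * q ≤ ∑ v ∈ outNbrs S a, g v := by
    rw [← nsmul_eq_mul]
    exact Finset.card_nsmul_le_sum _ _ _ fun v hv => hg v (mem_outNbrs.1 hv)
  calc q = share S a * (q + (outNbrs S a).card * q) := by linear_combination -q * share_mul a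
    _ ≤ _ := mul_le_mul_of_nonneg_left (add_le_add hx h1) (share_pos a).le

lemma AtLeast.mid {f : Weighting S} {q : ℝ} (h : f.AtLeast q) (a : S.Agent) : q ≤ f.mid a :=
  share_mul_ge (h.1 a) fun v hv => h.2 _ _ v hv

lemma AtLeast.pullBuf {f : Weighting S} {q : ℝ} (h : f.AtLeast q) (P : S.Pattern) {i}
    {u v : Fin (S.n i)} (huv : (S.link i).Adj u v) : q ≤ pullBuf P f i u v := by
  unfold Weighting.pullBuf
  split_ifs
  · exact h.mid _
  · exact h.2 i u v huv

lemma AtLeast.pull {f : Weighting S} {q : ℝ} (h : f.AtLeast q) (P : S.Pattern) :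
    (pull P f).AtLeast q :=
  ⟨fun a => share_mul_ge (h.mid a) fun _ hv => h.pullBuf P hv, fun _ _ _ huv => h.pullBuf P huv⟩

lemma AtLeast.fuseW (hM : S.M ≠ 0) {f : Weighting S} {q : ℝ} (h : f.AtLeast q) (Γ r : ℕ) :
    (fuseW Γ r f).AtLeast q := by
  have hM' : (0 : ℝ) < S.M := by exact_mod_cast Nat.pos_of_ne_zero hM
  refine ⟨fun a => ?_, h.2⟩
  simp only [Weighting.fuseW, fuseAt]
  split_ifs
  · unfold fuse
    split_ifs
    · have h1 : (S.M : ℝ) * q ≤ ∑ k, f.node ⟨k, S.lead k⟩ := by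
        simpa using Finset.card_nsmul_le_sum (Finset.univ : Finset (Fin S.M))
          (fun k => f.node ⟨k, S.lead k⟩) q fun k _ => h.1 _
      simp only [smul_eq_mul]
      have h2 : 1 / (2 * (S.M : ℝ)) * (S.M * q) ≤
          1 / (2 * (S.M : ℝ)) * ∑ k, f.node ⟨k, S.lead k⟩ :=
        mul_le_mul_of_nonneg_left h1 (by positivity)
      have h3 : 1 / (2 * (S.M : ℝ)) * (S.M * q) = q / 2 := by field_simp
      linarith [h.1 a]
    · exact h.1 a
  · exact h.1 a

end Weighting

open Weighting

/-- Fraction of the quantities of the designated agents that takes part in the averaging of a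
fusion. -/
def fusedPart (S : Network) : ℝ := if S.M = 1 then 1 else 1 / 2

lemma fusedPart_pos (S : Network) : 0 < fusedPart S := by unfold fusedPart; split_ifs <;> norm_num

lemma fusedPart_le_one (S : Network) : fusedPart S ≤ 1 := by
  unfold fusedPart; split_ifs <;> norm_num

/-- For a single sub-network fusion is the identity, so nothing is lost; otherwise a designated
agent keeps at least half. -/
lemma fuse_ge_self {v : S.Agent → ℝ} (hv : ∀ a, 0 ≤ v a) (a : S.Agent) :
    fusedPart S * v a ≤ fuse v a := by
  have hs : 0 ≤ ∑ k, v ⟨k, S.lead k⟩ := Finset.sum_nonneg fun k _ => hv _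
  unfold fuse
  split_ifs with ha
  · unfold fusedPart
    split_ifs with hM
    · have : ∑ k, v ⟨k, S.lead k⟩ = v a := by
        have hsub : Subsingleton (Fin S.M) := by rw [hM]; infer_instance
        rw [Fintype.sum_subsingleton _ a.1, ← ha]
      rw [this, hM]
      simp only [smul_eq_mul]
      norm_num
      linarith
    · simp only [smul_eq_mul]
      have : 0 ≤ 1 / (2 * (S.M : ℝ)) * ∑ k, v ⟨k, S.lead k⟩ := by positivity
      linarith
  · nlinarith [fusedPart_le_one S, hv a]

lemma fuse_lead_ge {v : S.Agent → ℝ} (hv : ∀ a, 0 ≤ v a) (i : Fin S.M) :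
    fusedPart S / S.M * ∑ k, v ⟨k, S.lead k⟩ ≤ fuse v ⟨i, S.lead i⟩ := by
  have hs : 0 ≤ ∑ k, v ⟨k, S.lead k⟩ := Finset.sum_nonneg fun k _ => hv _
  unfold fuse
  rw [if_pos rfl]
  unfold fusedPart
  split_ifs with hM
  · have : ∑ k, v ⟨k, S.lead k⟩ = v ⟨i, S.lead i⟩ := by
      have hsub : Subsingleton (Fin S.M) := by rw [hM]; infer_instance
      rw [Fintype.sum_subsingleton _ i]
    have hMr : (S.M : ℝ) = 1 := by exact_mod_cast hM
    rw [this, hMr]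
    simp only [smul_eq_mul]
    norm_num
    linarith
  · simp only [smul_eq_mul]
    have h1 : 1 / 2 / (S.M : ℝ) = 1 / (2 * (S.M : ℝ)) := by rw [div_div]
    rw [h1]
    linarith [hv ⟨i, S.lead i⟩]

variable {op : ℕ → S.Pattern} {Γ t : ℕ} {U : ℕ → Weighting S}

lemma IsBackward.aff (hM : S.M ≠ 0) (h : IsBackward op Γ t U) (c k : ℝ) :
    IsBackward op Γ t fun r => aff c k (U r) := by
  intro r hr
  simp only
  rw [pull_aff, fuseW_aff hM, ← h r hr]

lemma IsBackward.mono (h : IsBackward op Γ t U) {s : ℕ} (hs : s ≤ t) : IsBackward op Γ s U :=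
  fun r hr => h r (hr.trans_le hs)

/-- Lower bounds travel backwards in time at no cost. Applied to `aff hi (-1)` of a sequence, the
same holds for upper bounds. -/
lemma IsBackward.atLeast (hM : S.M ≠ 0) (h : IsBackward op Γ t U) {q : ℝ} {s : ℕ} (hs : s ≤ t)
    (hq : (U s).AtLeast q) {r : ℕ} (hr : r ≤ s) : (U r).AtLeast q := by
  induction hr using Nat.decreasingInduction with
  | self => exact hq
  | of_succ k hk ih =>
    rw [h k (by omega)]
    exact (ih.pull _).fuseW hM _ _

/-- The weighting of the states after fusion in round `r`. -/
def post (op : ℕ → S.Pattern) (U : ℕ → Weighting S) (r : ℕ) : Weighting S :=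
  pull (op (r + 1)) (U (r + 1))

lemma IsBackward.atLeast_post (hM : S.M ≠ 0) (h : IsBackward op Γ t U) {q : ℝ} {s : ℕ}
    (hs : s < t) (hq : (post op U s).AtLeast q) {r : ℕ} (hr : r ≤ s) :
    (post op U r).AtLeast q := by
  rcases hr.eq_or_lt with rfl | hr
  · exact hq
  · refine (h.atLeast hM hs.le ?_ (Nat.succ_le_of_lt hr)).pull _
    rw [h s hs]
    exact hq.fuseW hM _ _

end Bounds

/-! ### Lower bounds for coefficients along routes through the unreliable network. -/

open Weighting

/-- Every link delivers at least once in `B` consecutive rounds, agents of a sub-network are joined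
by walks of at most `D` links, and agents keep at least the fraction `δ`. -/
structure Routed (S : Network) (op : ℕ → S.Pattern) (B D : ℕ) (δ : ℝ) : Prop where
  deliver : ∀ i u v, (S.link i).Adj u v → ∀ t : ℕ, ∃ s, t < s ∧ s ≤ t + B ∧ (op s i).Adj u v
  walk : ∀ i u v, ∃ h ≤ D, HasWalk (S.link i) h u v
  pos : 0 < δ
  le_half : δ ≤ 1 / 2
  le_share : ∀ a, δ ≤ share S a
  M_ne : S.M ≠ 0

/-- A backward sequence with nonnegative coefficients. -/
structure IsNonnegBackward {S : Network} (op : ℕ → S.Pattern) (Γ t : ℕ) (U : ℕ → Weighting S) :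
    Prop where
  back : IsBackward op Γ t U
  nonneg : ∀ r ≤ t, (U r).AtLeast 0

section Paths

variable {S : Network} {op : ℕ → S.Pattern} {B D : ℕ} {δ : ℝ} {Γ t : ℕ} {U : ℕ → Weighting S}

lemma Routed.le_one (h : Routed S op B D δ) : δ ≤ 1 := h.le_half.trans (by norm_num)

lemma IsNonnegBackward.post_nonneg (hU : IsNonnegBackward op Γ t U) {r : ℕ} (hr : r < t) :
    (post op U r).AtLeast 0 := (hU.nonneg (r + 1) hr).pull _

lemma IsNonnegBackward.of_final (h : Routed S op B D δ) (hU : IsBackward op Γ t U)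
    (h0 : (U t).AtLeast 0) : IsNonnegBackward op Γ t U :=
  ⟨hU, fun _ hr => hU.atLeast h.M_ne le_rfl h0 hr⟩

lemma le_share_mul_left (h : Routed S op B D δ) {x : ℝ} {a : S.Agent} {g : Fin (S.n a.1) → ℝ}
    (hx : 0 ≤ x) (hg : ∀ v, (S.link a.1).Adj a.2 v → 0 ≤ g v) :
    δ * x ≤ share S a * (x + ∑ v ∈ outNbrs S a, g v) := by
  have hs : 0 ≤ ∑ v ∈ outNbrs S a, g v := Finset.sum_nonneg fun v hv => hg v (mem_outNbrs.1 hv)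
  calc δ * x ≤ share S a * x := mul_le_mul_of_nonneg_right (h.le_share a) hx
    _ ≤ _ := mul_le_mul_of_nonneg_left (by linarith) (share_pos a).le

lemma le_share_mul_right (h : Routed S op B D δ) {x : ℝ} {a : S.Agent} {g : Fin (S.n a.1) → ℝ}
    (hx : 0 ≤ x) (hg : ∀ v, (S.link a.1).Adj a.2 v → 0 ≤ g v) {v : Fin (S.n a.1)}
    (hv : (S.link a.1).Adj a.2 v) :
    δ * g v ≤ share S a * (x + ∑ v ∈ outNbrs S a, g v) := by
  have hs : g v ≤ ∑ v ∈ outNbrs S a, g v :=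
    Finset.single_le_sum (f := g) (fun v hv => hg v (mem_outNbrs.1 hv)) (mem_outNbrs.2 hv)
  calc δ * g v ≤ share S a * g v := mul_le_mul_of_nonneg_right (h.le_share a) (hg v hv)
    _ ≤ _ := mul_le_mul_of_nonneg_left (by linarith) (share_pos a).le

lemma Routed.node_le_mid (h : Routed S op B D δ) {f : Weighting S} (hf : f.AtLeast 0)
    (a : S.Agent) : δ * f.node a ≤ f.mid a :=
  le_share_mul_left h (hf.1 a) fun v hv => hf.2 _ _ v hv

lemma Routed.buf_le_mid (h : Routed S op B D δ) {f : Weighting S} (hf : f.AtLeast 0)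
    (a : S.Agent) {v} (hv : (S.link a.1).Adj a.2 v) : δ * f.buf a.1 a.2 v ≤ f.mid a :=
  le_share_mul_right (g := fun v => f.buf a.1 a.2 v) h (hf.1 a) (fun v hv => hf.2 _ _ v hv) hv

lemma Routed.mid_le_post (h : Routed S op B D δ) (hU : IsNonnegBackward op Γ t U) {r : ℕ}
    (hr : r < t) (a : S.Agent) : δ * (U (r + 1)).mid a ≤ (post op U r).node a :=
  le_share_mul_left h ((hU.nonneg _ hr).mid a) fun _ hv => (hU.nonneg _ hr).pullBuf _ hv

lemma Routed.buf_le_post (h : Routed S op B D δ) (hU : IsNonnegBackward op Γ t U) {r : ℕ}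
    (hr : r < t) (a : S.Agent) {v} (hv : (S.link a.1).Adj a.2 v) :
    δ * (post op U r).buf a.1 a.2 v ≤ (post op U r).node a :=
  le_share_mul_right (g := fun v => (post op U r).buf a.1 a.2 v) h ((hU.nonneg _ hr).mid a)
    (fun _ hv => (hU.nonneg _ hr).pullBuf _ hv) hv

lemma IsBackward.eq_fuse_post (hU : IsBackward op Γ t U) {r : ℕ} (hr : r < t) :
    U r = fuseW Γ r (post op U r) := hU r hr

lemma IsBackward.buf_eq (hU : IsBackward op Γ t U) {r : ℕ} (hr : r < t) :
    (U r).buf = (post op U r).buf := by rw [hU.eq_fuse_post hr]; rfl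

lemma IsNonnegBackward.post_le_node (hU : IsNonnegBackward op Γ t U) {r : ℕ} (hr : r < t)
    (a : S.Agent) : fusedPart S * (post op U r).node a ≤ (U r).node a := by
  rw [hU.back.eq_fuse_post hr]
  simp only [fuseW, fuseAt]
  have h0 := (hU.post_nonneg hr).1
  split_ifs
  · exact fuse_ge_self h0 a
  · nlinarith [fusedPart_le_one S, h0 a]

lemma IsBackward.node_eq_post (hU : IsBackward op Γ t U) {r : ℕ} (hr : r < t) (hΓ : ¬ Γ ∣ r) :
    (U r).node = (post op U r).node := by
  rw [hU.eq_fuse_post hr]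
  simp only [fuseW, fuseAt]
  rw [if_neg fun h0 => hΓ (Nat.dvd_of_mod_eq_zero h0)]

/-- Keeping one's own share through the two halves of a round costs `δ ^ 2`; a possible fusion in
between costs `fusedPart S`. -/
lemma Routed.stay (h : Routed S op B D δ) (hU : IsNonnegBackward op Γ t U) {r : ℕ}
    (hr : r < t) (a : S.Agent) : fusedPart S * (δ ^ 2 * (U (r + 1)).mid a) ≤ (U r).mid a := by
  have h1 := h.node_le_mid (hU.nonneg r hr.le) a
  have h2 := hU.post_le_node hr a
  have h3 := h.mid_le_post hU hr a
  have := fusedPart_pos S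
  calc fusedPart S * (δ ^ 2 * (U (r + 1)).mid a)
      = δ * (fusedPart S * (δ * (U (r + 1)).mid a)) := by ring
    _ ≤ δ * (fusedPart S * (post op U r).node a) := by have := h.pos; gcongr
    _ ≤ δ * (U r).node a := by have := h.pos; gcongr
    _ ≤ _ := h1

lemma Routed.stay_of_not_dvd (h : Routed S op B D δ) (hU : IsNonnegBackward op Γ t U) {r : ℕ}
    (hr : r < t) (hΓ : ¬ Γ ∣ r) (a : S.Agent) : δ ^ 2 * (U (r + 1)).mid a ≤ (U r).mid a := by
  have h1 := h.node_le_mid (hU.nonneg r hr.le) a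
  rw [hU.back.node_eq_post hr hΓ] at h1
  have h3 := h.mid_le_post hU hr a
  calc δ ^ 2 * (U (r + 1)).mid a = δ * (δ * (U (r + 1)).mid a) := by ring
    _ ≤ δ * (post op U r).node a := by have := h.pos; gcongr
    _ ≤ _ := h1

/-- No multiple of `Γ` lies strictly inside the period, so no fusion factor is paid. -/
lemma Routed.wait_between (h : Routed S op B D δ) (hU : IsNonnegBackward op Γ t U) {j r T : ℕ}
    (hr : j * Γ < r) (hrT : r ≤ T) (hT : T ≤ (j + 1) * Γ) (hTt : T ≤ t) (a : S.Agent) :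
    δ ^ (2 * (T - r)) * (U T).mid a ≤ (U r).mid a := by
  induction T, hrT using Nat.le_induction with
  | base => simp
  | succ T hrT ih =>
    have h1 := ih (by omega) (by omega)
    have hnd : ¬ Γ ∣ T := by
      rintro ⟨k, rfl⟩
      have hΓ0 : 0 < Γ := by
        rcases Nat.eq_zero_or_pos Γ with h0 | h0
        · simp [h0] at hT
        · exact h0
      have h2 : j * Γ < k * Γ := by rw [Nat.mul_comm k]; omega
      have h3 : k * Γ < (j + 1) * Γ := by rw [Nat.mul_comm k]; omega
      have := Nat.lt_of_mul_lt_mul_right h2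
      have := Nat.lt_of_mul_lt_mul_right h3
      omega
    have h2 := h.stay_of_not_dvd hU (by omega) hnd a
    have he : 2 * (T + 1 - r) = 2 * (T - r) + 2 := by omega
    calc δ ^ (2 * (T + 1 - r)) * (U (T + 1)).mid a
        = δ ^ (2 * (T - r)) * (δ ^ 2 * (U (T + 1)).mid a) := by rw [he]; ring
      _ ≤ δ ^ (2 * (T - r)) * (U T).mid a := by have := h.pos; gcongr
      _ ≤ _ := h1

/-- Here `n` bounds the number of fusions that are crossed, each at the price of one factor
`fusedPart S`. -/
lemma Routed.wait (h : Routed S op B D δ) (hU : IsNonnegBackward op Γ t U) {j n r T : ℕ}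
    (hr : j * Γ < r) (hrT : r ≤ T) (hT : T ≤ (j + n + 1) * Γ) (hTt : T ≤ t) (a : S.Agent) :
    fusedPart S ^ n * (δ ^ (2 * (T - r)) * (U T).mid a) ≤ (U r).mid a := by
  have hθ := fusedPart_pos S
  have hθ1 := fusedPart_le_one S
  have hδ := h.pos
  induction n generalizing T with
  | zero => simpa using h.wait_between hU hr hrT hT hTt a
  | succ n ih =>
    rcases le_or_gt T ((j + n + 1) * Γ) with hc | hc
    · have h1 := ih hrT hc hTt
      have h0 : 0 ≤ δ ^ (2 * (T - r)) * (U T).mid a :=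
        mul_nonneg (by positivity) ((hU.nonneg T hTt).mid a)
      calc _ ≤ fusedPart S ^ n * (δ ^ (2 * (T - r)) * (U T).mid a) := by
            apply mul_le_mul_of_nonneg_right _ h0
            exact pow_le_pow_of_le_one hθ.le hθ1 (Nat.le_succ n)
        _ ≤ _ := h1
    · rcases le_or_gt r ((j + n + 1) * Γ) with hd | hd
      · have h1 := ih hd le_rfl (hc.le.trans hTt)
        have h2 := h.stay hU (r := (j + n + 1) * Γ) (by omega) a
        have h3 := h.wait_between hU (j := j + n + 1) (r := (j + n + 1) * Γ + 1) (by omega)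
          (T := T) (by omega) (by rwa [show j + n + 1 + 1 = j + (n + 1) + 1 by omega]) hTt a
        have he : 2 * (T - r) =
            2 * ((j + n + 1) * Γ - r) + 2 + 2 * (T - ((j + n + 1) * Γ + 1)) := by omega
        calc fusedPart S ^ (n + 1) * (δ ^ (2 * (T - r)) * (U T).mid a)
            = fusedPart S ^ n * (δ ^ (2 * ((j + n + 1) * Γ - r)) * (fusedPart S * (δ ^ 2 *
              (δ ^ (2 * (T - ((j + n + 1) * Γ + 1))) * (U T).mid a)))) := by rw [he]; ring
          _ ≤ fusedPart S ^ n * (δ ^ (2 * ((j + n + 1) * Γ - r)) * (fusedPart S * (δ ^ 2 *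
              (U ((j + n + 1) * Γ + 1)).mid a))) := by gcongr
          _ ≤ fusedPart S ^ n * (δ ^ (2 * ((j + n + 1) * Γ - r)) *
              (U ((j + n + 1) * Γ)).mid a) := by gcongr
          _ ≤ _ := h1
      · have h1 := h.wait_between hU (j := j + n + 1) hd hrT
          (by rwa [show j + n + 1 + 1 = j + (n + 1) + 1 by omega]) hTt a
        have h0 : 0 ≤ δ ^ (2 * (T - r)) * (U T).mid a :=
          mul_nonneg (by positivity) ((hU.nonneg T hTt).mid a)
        exact (mul_le_of_le_one_left h0 (pow_le_one₀ hθ.le hθ1)).trans h1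

/-- While a link fails, the coefficient of what is in transit on it is frozen; at the first delivery
it is the coefficient of the receiver in the middle of that round. -/
lemma IsBackward.buf_eq_mid_of_first (hU : IsBackward op Γ t U) {i} {u v : Fin (S.n i)} (m : ℕ) :
    ∀ r, (∀ s, r < s → s ≤ r + m → ¬ (op s i).Adj u v) → (op (r + m + 1) i).Adj u v →
      r + m + 1 ≤ t → (post op U r).buf i u v = (U (r + m + 1)).mid ⟨i, v⟩ := by
  induction m with
  | zero =>
    intro r _ h1 _
    exact if_pos h1
  | succ m ih =>
    intro r h0 h1 hr
    have h2 : (post op U r).buf i u v = (U (r + 1)).buf i u v :=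
      if_neg (h0 (r + 1) (by omega) (by omega))
    have he : r + (m + 1) + 1 = r + 1 + m + 1 := by omega
    rw [h2, hU.buf_eq (by omega), he]
    exact ih (r + 1) (fun s hs1 hs2 => h0 s (by omega) (by omega)) (he ▸ h1) (by omega)

/-- A quantity in transit after round `r` is received in some round `τ ≤ r + B`. -/
lemma Routed.exists_receive (h : Routed S op B D δ) {i} {u v : Fin (S.n i)}
    (huv : (S.link i).Adj u v) (r : ℕ) :
    ∃ τ, r < τ ∧ τ ≤ r + B ∧ ∀ {Γ t : ℕ} {U : ℕ → Weighting S}, IsBackward op Γ t U → τ ≤ t →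
      (post op U r).buf i u v = (U τ).mid ⟨i, v⟩ := by
  classical
  have hex : ∃ m, (op (r + m + 1) i).Adj u v := by
    obtain ⟨s, hs1, _, hs3⟩ := h.deliver i u v huv r
    exact ⟨s - r - 1, by rwa [show r + (s - r - 1) + 1 = s by omega]⟩
  refine ⟨r + Nat.find hex + 1, by omega, ?_, fun hU hτ => ?_⟩
  · obtain ⟨s, hs1, hs2, hs3⟩ := h.deliver i u v huv r
    have := Nat.find_min' hex (m := s - r - 1) (by rwa [show r + (s - r - 1) + 1 = s by omega])
    omega
  · refine hU.buf_eq_mid_of_first _ r (fun s hs1 hs2 hs3 => ?_) (Nat.find_spec hex) hτ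
    exact Nat.find_min hex (m := s - r - 1) (by omega)
      (by rwa [show r + (s - r - 1) + 1 = s by omega])

/-- Following a walk of `h` links. -/
lemma Routed.follow (h : Routed S op B D δ) {i} {l : ℕ} {u v : Fin (S.n i)}
    (hw : HasWalk (S.link i) l u v) (r : ℕ) :
    ∃ τ, r + l ≤ τ ∧ τ ≤ r + l * B ∧ ∀ {Γ t : ℕ} {U : ℕ → Weighting S},
      IsNonnegBackward op Γ t U → τ ≤ t → δ ^ l * (U τ).mid ⟨i, v⟩ ≤ (U r).mid ⟨i, u⟩ := by
  induction l generalizing u r with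
  | zero =>
    obtain rfl : u = v := hw
    exact ⟨r, by simp, by simp, fun _ _ => by simp⟩
  | succ l ih =>
    obtain ⟨x, hux, hxv⟩ := hw
    obtain ⟨τ, h1, h2, h3⟩ := h.exists_receive hux r
    obtain ⟨σ, h4, h5, h6⟩ := ih hxv τ
    refine ⟨σ, by omega, by linarith [Nat.succ_mul l B], fun {Γ t U} hU hσ => ?_⟩
    have h7 := h.buf_le_mid (hU.nonneg r (by omega)) ⟨i, u⟩ hux
    simp only at h7
    rw [hU.back.buf_eq (by omega), h3 hU.back (by omega)] at h7
    have hδ := h.pos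
    calc δ ^ (l + 1) * (U σ).mid ⟨i, v⟩ = δ * (δ ^ l * (U σ).mid ⟨i, v⟩) := by ring
      _ ≤ δ * (U τ).mid ⟨i, x⟩ := by gcongr; exact h6 hU hσ
      _ ≤ _ := h7

/-- From any agent to any agent of the same sub-network in a given time. -/
lemma Routed.travel (h : Routed S op B D δ) (hU : IsNonnegBackward op Γ t U) (hΓ : Γ = B * D)
    {j n r T : ℕ} (hr : j * Γ < r) (hrT : r + Γ ≤ T) (hT : T ≤ (j + n + 1) * Γ) (hTt : T ≤ t)
    {i} (u v : Fin (S.n i)) :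
    fusedPart S ^ n * (δ ^ (2 * (T - r)) * (U T).mid ⟨i, v⟩) ≤ (U r).mid ⟨i, u⟩ := by
  obtain ⟨l, hl, hw⟩ := h.walk i u v
  obtain ⟨τ, h1, h2, h3⟩ := h.follow hw r
  have h4 : l * B ≤ Γ := by rw [hΓ, Nat.mul_comm]; exact Nat.mul_le_mul_left B hl
  have h5 := h.wait hU (j := j) (n := n) (r := τ) (by omega) (by omega) hT hTt ⟨i, v⟩
  have h6 := h3 hU (by omega)
  have hδ := h.pos
  have h0 : 0 ≤ (U T).mid ⟨i, v⟩ := (hU.nonneg T hTt).mid _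
  have hθ := fusedPart_pos S
  calc fusedPart S ^ n * (δ ^ (2 * (T - r)) * (U T).mid ⟨i, v⟩)
      ≤ fusedPart S ^ n * (δ ^ (l + 2 * (T - τ)) * (U T).mid ⟨i, v⟩) := by
        gcongr _ * (?_ * _)
        -- The `l` hops take at least `l` rounds, and a hop costs `δ`, less than the `δ ^ 2` charged
        -- for a round of waiting.
        exact pow_le_pow_of_le_one hδ.le h.le_one (by omega)
    _ = δ ^ l * (fusedPart S ^ n * (δ ^ (2 * (T - τ)) * (U T).mid ⟨i, v⟩)) := by ring
    _ ≤ δ ^ l * (U τ).mid ⟨i, v⟩ := by gcongr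
    _ ≤ _ := h6

end Paths

open Weighting

/-! ### Contraction of the spread of the coefficients over two periods. -/

section Mixing

variable {S : Network} {op : ℕ → S.Pattern} {B D : ℕ} {δ : ℝ} {Γ t : ℕ} {U : ℕ → Weighting S}

/-- A route of at most `D` hops fits into one period because each hop takes at most `B` rounds; the
rest of the period is spent waiting at the target. No fusion is crossed. -/
lemma Routed.mid_le_post_period (h : Routed S op B D δ) (hU : IsNonnegBackward op Γ t U)
    (hΓ : Γ = B * D) (hΓ0 : 0 < Γ) {j : ℕ} (hj : (j + 1) * Γ ≤ t) {i} (u v : Fin (S.n i)) :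
    δ ^ (2 * Γ - 1) * (U ((j + 1) * Γ)).mid ⟨i, v⟩ ≤ (post op U (j * Γ)).node ⟨i, u⟩ := by
  have hδ := h.pos
  have hjs : (j + 1) * Γ = j * Γ + Γ := by ring
  have h0 : 0 ≤ (U ((j + 1) * Γ)).mid ⟨i, v⟩ := (hU.nonneg _ hj).mid _
  obtain ⟨l, hl, hw⟩ := h.walk i u v
  have h4 : l * B ≤ Γ := by rw [hΓ, Nat.mul_comm]; exact Nat.mul_le_mul_left B hl
  cases l with
  | zero =>
    obtain rfl : u = v := hw
    have h1 := h.mid_le_post hU (r := j * Γ) (by omega) ⟨i, u⟩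
    have h2 := h.wait_between hU (j := j) (r := j * Γ + 1) (T := (j + 1) * Γ) (by omega) (by omega)
      le_rfl hj ⟨i, u⟩
    have he : 2 * Γ - 1 = 2 * ((j + 1) * Γ - (j * Γ + 1)) + 1 := by omega
    calc _ = δ * (δ ^ (2 * ((j + 1) * Γ - (j * Γ + 1))) * (U ((j + 1) * Γ)).mid ⟨i, u⟩) := by
          rw [he]; ring
      _ ≤ δ * (U (j * Γ + 1)).mid ⟨i, u⟩ := by gcongr
      _ ≤ _ := h1
  | succ l =>
    obtain ⟨x, hux, hxv⟩ := hw
    obtain ⟨τ, h1, h2, h3⟩ := h.exists_receive hux (j * Γ)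
    obtain ⟨σ, h5, h6, h7⟩ := h.follow hxv τ
    have h8 : l * B + B ≤ Γ := by linarith [Nat.succ_mul l B]
    have h9 := h.wait_between hU (j := j) (r := σ) (T := (j + 1) * Γ) (by omega) (by omega)
      le_rfl hj ⟨i, v⟩
    have h10 := h.buf_le_post hU (r := j * Γ) (by omega) ⟨i, u⟩ hux
    simp only at h10
    rw [h3 hU.back (by omega)] at h10
    calc _ ≤ δ ^ (1 + l + 2 * ((j + 1) * Γ - σ)) * (U ((j + 1) * Γ)).mid ⟨i, v⟩ := by
          gcongr ?_ * _
          exact pow_le_pow_of_le_one hδ.le h.le_one (by omega)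
      _ = δ * (δ ^ l * (δ ^ (2 * ((j + 1) * Γ - σ)) * (U ((j + 1) * Γ)).mid ⟨i, v⟩)) := by ring
      _ ≤ δ * (δ ^ l * (U σ).mid ⟨i, v⟩) := by gcongr
      _ ≤ δ * (U τ).mid ⟨i, x⟩ := by gcongr; exact h7 hU (by omega)
      _ ≤ _ := h10

lemma Routed.node_le_post_period (h : Routed S op B D δ) (hU : IsNonnegBackward op Γ t U)
    (hΓ : Γ = B * D) (hΓ0 : 0 < Γ) {j : ℕ} (hj : (j + 1) * Γ ≤ t) {i} (u v : Fin (S.n i)) :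
    δ ^ (2 * Γ) * (U ((j + 1) * Γ)).node ⟨i, v⟩ ≤ (post op U (j * Γ)).node ⟨i, u⟩ := by
  refine le_trans ?_ (h.mid_le_post_period hU hΓ hΓ0 hj u v)
  have hδ := h.pos
  have he : 2 * Γ = 2 * Γ - 1 + 1 := by omega
  rw [he, pow_succ, mul_assoc, ← he]
  gcongr
  exact h.node_le_mid (hU.nonneg _ hj) _

lemma Routed.buf_le_post_period (h : Routed S op B D δ) (hU : IsNonnegBackward op Γ t U)
    (hΓ : Γ = B * D) (hΓ0 : 0 < Γ) {j : ℕ} (hj : (j + 1) * Γ ≤ t) {i} (u v w : Fin (S.n i))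
    (hvw : (S.link i).Adj v w) :
    δ ^ (2 * Γ) * (U ((j + 1) * Γ)).buf i v w ≤ (post op U (j * Γ)).node ⟨i, u⟩ := by
  refine le_trans ?_ (h.mid_le_post_period hU hΓ hΓ0 hj u v)
  have hδ := h.pos
  have he : 2 * Γ = 2 * Γ - 1 + 1 := by omega
  rw [he, pow_succ, mul_assoc, ← he]
  gcongr
  exact h.buf_le_mid (hU.nonneg _ hj) ⟨i, v⟩ hvw

/-- A bound over a window of `B` rounds also covers the links, since whatever is in transit is
received within the window. -/
lemma Routed.post_atLeast (h : Routed S op B D δ) (hU : IsBackward op Γ t U) (hB : 0 < B) {r : ℕ}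
    (hr : r + B ≤ t) {q : ℝ} (hq : ∀ τ, r < τ → τ ≤ r + B → ∀ a, q ≤ (U τ).mid a) :
    (post op U r).AtLeast q := by
  have hb : ∀ i (u v : Fin (S.n i)), (S.link i).Adj u v → q ≤ (post op U r).buf i u v := by
    intro i u v huv
    obtain ⟨τ, h1, h2, h3⟩ := h.exists_receive huv r
    rw [h3 hU (by omega)]
    exact hq τ h1 h2 _
  exact ⟨fun a => share_mul_ge (hq (r + 1) (by omega) (by omega) a) fun v hv => hb _ _ v hv, hb⟩

/-- After two periods every coefficient is controlled by those of the designated agents. -/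
lemma Routed.post_atLeast_lead (h : Routed S op B D δ) (hU : IsNonnegBackward op Γ t U)
    (hΓ : Γ = B * D) (hΓ0 : 0 < Γ) {k : ℕ} (hk : (k + 2) * Γ ≤ t) {q : ℝ} (hq0 : 0 ≤ q)
    (hq : ∀ i, q ≤ (U ((k + 2) * Γ)).node ⟨i, S.lead i⟩) :
    (post op U (k * Γ)).AtLeast (fusedPart S * δ ^ (2 * Γ + 2 * B - 1) * q) := by
  have hδ := h.pos
  have hB : 0 < B := Nat.pos_of_ne_zero fun h0 => by simp [hΓ, h0] at hΓ0
  have hBΓ : B ≤ Γ := by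
    rw [hΓ]; exact Nat.le_mul_of_pos_right B (Nat.pos_of_ne_zero fun h0 => by simp [hΓ, h0] at hΓ0)
  have h1 : (k + 1) * Γ = k * Γ + Γ := by ring
  have h2 : (k + 2) * Γ = k * Γ + 2 * Γ := by ring
  -- The window consists of the `B` rounds ending at the fusion in round `(k + 1) * Γ`. From there a
  -- designated agent is reached by round `(k + 2) * Γ` in at most `Γ + B - 1` rounds, with that one
  -- fusion crossed; this gives the exponent `2 * (Γ + B - 1) + 1`.
  have h3 : (post op U ((k + 1) * Γ - B)).AtLeast
      (fusedPart S * δ ^ (2 * Γ + 2 * B - 1) * q) := by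
    refine h.post_atLeast hU.back hB (by omega) fun τ hτ1 hτ2 a => ?_
    have h4 := h.travel hU hΓ (j := k) (n := 1) (r := τ) (T := (k + 2) * Γ) (by omega) (by omega)
      le_rfl hk a.2 (S.lead a.1)
    have h5 := h.node_le_mid (hU.nonneg _ hk) ⟨a.1, S.lead a.1⟩
    have hθ := fusedPart_pos S
    calc fusedPart S * δ ^ (2 * Γ + 2 * B - 1) * q
        ≤ fusedPart S * δ ^ (2 * ((k + 2) * Γ - τ) + 1) * q := by
          gcongr _ * ?_ * _
          exact pow_le_pow_of_le_one hδ.le h.le_one (by omega)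
      _ = fusedPart S ^ 1 * (δ ^ (2 * ((k + 2) * Γ - τ)) * (δ * q)) := by ring
      _ ≤ fusedPart S ^ 1 * (δ ^ (2 * ((k + 2) * Γ - τ)) *
          (δ * (U ((k + 2) * Γ)).node ⟨a.1, S.lead a.1⟩)) := by gcongr; exact hq a.1
      _ ≤ fusedPart S ^ 1 * (δ ^ (2 * ((k + 2) * Γ - τ)) *
          (U ((k + 2) * Γ)).mid ⟨a.1, S.lead a.1⟩) := by gcongr
      _ ≤ _ := h4
  exact hU.back.atLeast_post h.M_ne (s := (k + 1) * Γ - B) (by omega) h3 (by omega)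

/-- This is the only place where sub-networks interact: fusion gives each designated agent a part of
the mean of all. -/
lemma IsBackward.node_lead_ge (hU : IsBackward op Γ t U) {r : ℕ} (hr : r < t) (hΓ : Γ ∣ r)
    (h0 : ∀ a, 0 ≤ (post op U r).node a) (i : Fin S.M) :
    fusedPart S / S.M * ∑ k, (post op U r).node ⟨k, S.lead k⟩ ≤ (U r).node ⟨i, S.lead i⟩ := by
  rw [hU.eq_fuse_post hr]
  simp only [fuseW, fuseAt]
  rw [if_pos (Nat.mod_eq_zero_of_dvd hΓ)]
  exact fuse_lead_ge h0 i

lemma post_aff (c k : ℝ) (r : ℕ) :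
    post op (fun r => aff c k (U r)) r = aff c k (post op U r) := pull_aff _ _ _ _

/-- Contraction rate over two periods. -/
def mixRate (S : Network) (δ : ℝ) (Γ B : ℕ) : ℝ := fusedPart S ^ 2 * δ ^ (2 * Γ + 2 * B - 1)

lemma Routed.mixRate_pos (h : Routed S op B D δ) : 0 < mixRate S δ Γ B := by
  have := fusedPart_pos S
  have := h.pos
  unfold mixRate; positivity

lemma Routed.mixRate_le_one (h : Routed S op B D δ) : mixRate S δ Γ B ≤ 1 :=
  mul_le_one₀ (pow_le_one₀ (fusedPart_pos S).le (fusedPart_le_one S)) (pow_nonneg h.pos.le _)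
    (pow_le_one₀ h.pos.le h.le_one)

/-- Two periods before a fusion, every coefficient exceeds a fixed fraction of the mean over the
designated agents. One factor `fusedPart S` comes from that fusion and one from the fusion crossed
on the way. -/
lemma Routed.lower_improves (h : Routed S op B D δ) (hU : IsBackward op Γ t U)
    (hΓ : Γ = B * D) (hΓ0 : 0 < Γ) {k : ℕ} (hk : (k + 2) * Γ < t)
    (h0 : (post op U ((k + 2) * Γ)).AtLeast 0) :
    (post op U (k * Γ)).AtLeast (mixRate S δ Γ B *
      (1 / S.M * ∑ i, (post op U ((k + 2) * Γ)).node ⟨i, S.lead i⟩)) := by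
  have hUT : (U ((k + 2) * Γ)).AtLeast 0 := by
    rw [hU _ hk]; exact h0.fuseW h.M_ne _ _
  have hU' := IsNonnegBackward.of_final h (hU.mono hk.le) hUT
  have hs : 0 ≤ ∑ i, (post op U ((k + 2) * Γ)).node ⟨i, S.lead i⟩ :=
    Finset.sum_nonneg fun i _ => h0.1 _
  have hθ := fusedPart_pos S
  have := h.post_atLeast_lead hU' hΓ hΓ0 le_rfl
    (q := fusedPart S / S.M * ∑ k', (post op U ((k + 2) * Γ)).node ⟨k', S.lead k'⟩)
    (by positivity) fun i => hU.node_lead_ge hk (Dvd.intro_left _ rfl) h0.1 i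
  convert this using 1
  unfold mixRate
  ring

/-- `Routed.lower_improves` is applied to `U - lo` and to `hi - U`. The means of these over the
designated agents add up to `hi - lo`, so the two gains together shrink the interval by the factor
`1 - mixRate S δ Γ B`. -/
lemma Routed.contraction (h : Routed S op B D δ) (hU : IsBackward op Γ t U)
    (hΓ : Γ = B * D) (hΓ0 : 0 < Γ) {k : ℕ} (hk : (k + 2) * Γ < t) {lo hi : ℝ}
    (hlo : (post op U ((k + 2) * Γ)).AtLeast lo)
    (hhi : (aff hi (-1) (post op U ((k + 2) * Γ))).AtLeast 0) :
    ∃ lo' hi', (post op U (k * Γ)).AtLeast lo' ∧ (aff hi' (-1) (post op U (k * Γ))).AtLeast 0 ∧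
      hi' - lo' = (1 - mixRate S δ Γ B) * (hi - lo) := by
  set κ := mixRate S δ Γ B
  set m := 1 / (S.M : ℝ) * ∑ i, (post op U ((k + 2) * Γ)).node ⟨i, S.lead i⟩ with hm
  have hM : (S.M : ℝ) ≠ 0 := by exact_mod_cast h.M_ne
  have havg : ∀ c k', 1 / (S.M : ℝ) * ∑ i, (aff c k' (post op U ((k + 2) * Γ))).node
      ⟨i, S.lead i⟩ = c + k' * m := by
    intro c k'
    simp only [aff, Finset.sum_add_distrib, Finset.sum_const, Finset.card_univ, Fintype.card_fin,
      nsmul_eq_mul, ← Finset.mul_sum, hm]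
    field_simp
  have h1 := h.lower_improves (hU.aff h.M_ne (-lo) 1) hΓ hΓ0 hk (by
    rw [post_aff]
    exact ⟨fun a => by have := hlo.1 a; simp only [aff]; linarith,
      fun i u v huv => by have := hlo.2 i u v huv; simp only [aff]; linarith⟩)
  have h2 := h.lower_improves (hU.aff h.M_ne hi (-1)) hΓ hΓ0 hk (by rwa [post_aff])
  simp only [post_aff] at h1 h2
  rw [havg] at h1 h2
  refine ⟨lo + κ * (-lo + 1 * m), hi - κ * (hi + -1 * m), ⟨fun a => ?_, fun i u v huv => ?_⟩,
    ⟨fun a => ?_, fun i u v huv => ?_⟩, by ring⟩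
  · have := h1.1 a; simp only [aff] at this; linarith
  · have := h1.2 i u v huv; simp only [aff] at this; linarith
  · have := h2.1 a; simp only [aff] at this ⊢; linarith
  · have := h2.2 i u v huv; simp only [aff] at this ⊢; linarith

/-- Iterated contraction, starting from the fusion in round `(k + 2 * n) * Γ`. -/
lemma Routed.contraction_iterate (h : Routed S op B D δ) (hU : IsBackward op Γ t U)
    (hΓ : Γ = B * D) (hΓ0 : 0 < Γ) {T : ℕ} (hT : T * Γ < t) {s : ℝ}
    (hlo : (post op U (T * Γ)).AtLeast 0) (hhi : (aff s (-1) (post op U (T * Γ))).AtLeast 0)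
    (n : ℕ) (hn : 2 * n ≤ T) :
    ∃ lo hi, (post op U ((T - 2 * n) * Γ)).AtLeast lo ∧
      (aff hi (-1) (post op U ((T - 2 * n) * Γ))).AtLeast 0 ∧
      hi - lo = (1 - mixRate S δ Γ B) ^ n * s := by
  induction n with
  | zero => exact ⟨0, s, by simpa using hlo, by simpa using hhi, by simp⟩
  | succ n ih =>
    obtain ⟨lo, hi, h1, h2, h3⟩ := ih (by omega)
    have he : T - 2 * n = T - 2 * (n + 1) + 2 := by omega
    rw [he] at h1 h2
    obtain ⟨lo', hi', h4, h5, h6⟩ := h.contraction hU hΓ hΓ0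
      (lt_of_le_of_lt (Nat.mul_le_mul_right Γ (by omega)) hT) h1 h2
    exact ⟨lo', hi', h4, h5, by rw [h6, h3]; ring⟩

end Mixing

open Weighting

/-! ### Masses: positivity, conservation, and the share of the designated agents. -/

section Mass

variable {S : Network} {op : ℕ → S.Pattern} {B D : ℕ} {δ : ℝ} {Γ t : ℕ} {U : ℕ → Weighting S}

/-- The agents and the links carry nonnegative quantities. -/
def PushSum.Nonneg (s : PushSum S ℝ) : Prop :=
  (∀ a, 0 ≤ s.val a) ∧ ∀ i u v, (S.link i).Adj u v → s.recv i u v ≤ s.sent ⟨i, u⟩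

lemma PushSum.Nonneg.localStep {s : PushSum S ℝ} (hs : s.Nonneg) (P : S.Pattern) :
    (localStep P s).Nonneg := by
  classical
  have hw : ∀ a : S.Agent, (0 : ℝ) ≤ 1 / ((S.deg a : ℝ) + 1) := fun a => by positivity
  have h1 : ∀ a, s.sent a ≤ sentPlus s a := fun a => by
    unfold sentPlus
    have := mul_nonneg (hw a) (hs.1 a)
    simp only [smul_eq_mul]; linarith
  have h2 : ∀ i u v, (S.link i).Adj u v →
      s.recv i u v ≤ recvNew P s i u v ∧ recvNew P s i u v ≤ sentPlus s ⟨i, u⟩ := by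
    intro i u v huv
    have := hs.2 i u v huv
    have := h1 ⟨i, u⟩
    unfold recvNew
    split_ifs
    · exact ⟨by linarith, le_rfl⟩
    · exact ⟨le_rfl, by linarith⟩
  have h3 : ∀ a, 0 ≤ valPlus P s a := by
    intro a
    refine add_nonneg (mul_nonneg (hw a) (hs.1 a)) (Finset.sum_nonneg fun j hj => ?_)
    have := (h2 a.1 j a.2 (by simpa using hj)).1
    linarith
  refine ⟨fun a => mul_nonneg (hw a) (h3 a), fun i u v huv => ?_⟩
  have h4 := mul_nonneg (hw ⟨i, u⟩) (h3 ⟨i, u⟩)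
  have h5 := (h2 i u v huv).2
  simp only [HierEst.localStep, smul_eq_mul]
  linarith

lemma fuseAt_nonneg {v : S.Agent → ℝ} (hv : ∀ a, 0 ≤ v a) (r : ℕ) (a : S.Agent) :
    0 ≤ fuseAt Γ r v a := by
  unfold fuseAt
  split_ifs
  · exact (mul_nonneg (fusedPart_pos S).le (hv a)).trans (fuse_ge_self hv a)
  · exact hv a

/-- Masses: a run without injection, from unit quantities. -/
structure IsMassRun (op : ℕ → S.Pattern) (Γ : ℕ) (st : ℕ → PushSum S ℝ) : Prop where
  run : IsRun op Γ (fun _ _ => 0) st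
  init : st 0 = PushSum.init 1

variable {st : ℕ → PushSum S ℝ}

lemma IsMassRun.succ (h : IsMassRun op Γ st) (r : ℕ) :
    st (r + 1) = { localStep (op (r + 1)) (st r) with
      val := fuseAt Γ (r + 1) (localStep (op (r + 1)) (st r)).val } := by
  rw [h.run r]; simp

lemma IsMassRun.nonneg (h : IsMassRun op Γ st) (r : ℕ) : (st r).Nonneg := by
  induction r with
  | zero =>
    rw [h.init]
    exact ⟨fun _ => zero_le_one, fun _ _ _ _ => le_rfl⟩
  | succ r ih =>
    have h1 := ih.localStep (op (r + 1))
    rw [h.succ r]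
    exact ⟨fun a => fuseAt_nonneg h1.1 _ a, h1.2⟩

/-- The weighting with all coefficients `1`. -/
def oneW (S : Network) : Weighting S := ⟨fun _ => 1, fun _ _ _ => 1⟩

lemma oneW_eq_aff (f : Weighting S) : oneW S = aff 1 0 f := by
  ext <;> simp [oneW, aff]

lemma isBackward_oneW (hM : S.M ≠ 0) : IsBackward op Γ t fun _ => oneW S := by
  intro r _
  simp only
  rw [oneW_eq_aff (oneW S), pull_aff, fuseW_aff hM, ← oneW_eq_aff]
  exact oneW_eq_aff _

lemma pull_oneW (P : S.Pattern) : pull P (oneW S) = oneW S := by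
  conv_lhs => rw [oneW_eq_aff (oneW S), pull_aff, ← oneW_eq_aff]

/-- Two ways to evaluate a backward sequence at a mass run. -/
lemma IsMassRun.pair_final (h : IsMassRun op Γ st) {T : ℕ} (hU : IsBackward op Γ (T + 1) U) {r : ℕ}
    (hr : r ≤ T) :
    (U (T + 1)).pair (localStep (op (T + 1)) (st T)) = (post op U r).pair (st r) := by
  have h1 := h.run.pair_final hU
  have h2 := h.run.pair_eq hU (Nat.lt_succ_of_le hr)
  simp only [smul_zero, Finset.sum_const_zero, add_zero] at h1 h2
  exact h1.trans h2.symm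

lemma pair_init (f : Weighting S) : f.pair (PushSum.init (1 : S.Agent → ℝ)) = ∑ a, f.node a := by
  simp [pair, PushSum.init]

lemma card_agent (S : Network) : Fintype.card S.Agent = S.N := by
  simp [Network.N]

lemma IsMassRun.total (h : IsMassRun op Γ st) (hM : S.M ≠ 0) (r : ℕ) :
    (oneW S).pair (st r) = S.N := by
  have h2 := h.run.pair_eq (isBackward_oneW (t := r + 1) hM) (Nat.lt_succ_self r)
  simp only [smul_zero, Finset.sum_const_zero, add_zero, pull_oneW] at h2
  rw [h2, h.init, pair_init, ← card_agent]
  simp [oneW]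

/-- Masses held and in transit are nonnegative and form a measure, so pairing is integration.
Together with `IsMassRun.total` it makes the mass of an agent an average of coefficients times
`S.N`. -/
lemma Weighting.AtLeast.le_pair {f : Weighting S} {q : ℝ} (hf : f.AtLeast q) {s : PushSum S ℝ}
    (hs : s.Nonneg) : q * (oneW S).pair s ≤ f.pair s := by
  unfold pair
  rw [Finset.mul_sum]
  refine Finset.sum_le_sum fun a _ => ?_
  rw [mul_add, Finset.mul_sum]
  refine add_le_add ?_ (Finset.sum_le_sum fun k hk => ?_)
  · simp only [oneW, smul_eq_mul, one_mul]
    exact mul_le_mul_of_nonneg_right (hf.1 a) (hs.1 a)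
  · simp only [oneW, smul_eq_mul, one_mul]
    exact mul_le_mul_of_nonneg_right (hf.2 _ _ _ (mem_outNbrs.1 hk))
      (sub_nonneg.2 (hs.2 _ _ _ (mem_outNbrs.1 hk)))

lemma pair_aff (c k : ℝ) (f : Weighting S) (s : PushSum S ℝ) :
    (aff c k f).pair s = c * (oneW S).pair s + k * f.pair s := by
  simp only [pair, aff, oneW, smul_eq_mul, Finset.mul_sum, ← Finset.sum_add_distrib, mul_add,
    one_mul]
  refine Finset.sum_congr rfl fun a _ => ?_
  have : ∀ v, (c + k * f.buf a.1 a.2 v) * (s.sent a - s.recv a.1 a.2 v) =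
      c * (s.sent a - s.recv a.1 a.2 v) +
        k * (f.buf a.1 a.2 v * (s.sent a - s.recv a.1 a.2 v)) := fun v => by ring
  simp only [this, Finset.sum_add_distrib]
  ring

/-- The weighting that counts the quantities of the designated agents. -/
def leadW (S : Network) : Weighting S := ⟨fun a => if a.2 = S.lead a.1 then 1 else 0, fun _ _ _ => 0⟩

/-- The weighting that counts the quantity of one agent. -/
def agentW (a : S.Agent) : Weighting S :=
  ⟨fun b => open Classical in if b = a then 1 else 0, fun _ _ _ => 0⟩

lemma agentW_pair {X : Type} [AddCommGroup X] [Module ℝ X] (a : S.Agent) (s : PushSum S X) :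
    (agentW a).pair s = s.val a := by
  classical
  simp [pair, agentW, Finset.sum_ite_eq']

lemma agentW_atLeast (a : S.Agent) : (agentW a).AtLeast 0 :=
  ⟨fun b => by simp only [agentW]; split_ifs <;> norm_num, fun _ _ _ _ => le_rfl⟩

lemma leadW_atLeast (S : Network) : (leadW S).AtLeast 0 :=
  ⟨fun b => by simp only [leadW]; split_ifs <;> norm_num, fun _ _ _ _ => le_rfl⟩

lemma leadW_pair (s : PushSum S ℝ) : (leadW S).pair s = ∑ i, s.val ⟨i, S.lead i⟩ := by
  rw [← sum_lead]
  simp [pair, leadW]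

/-- Total mass of the designated agents in round `T + 1`, before fusion. -/
def leadMass (op : ℕ → S.Pattern) (st : ℕ → PushSum S ℝ) (T : ℕ) : ℝ :=
  ∑ i, (localStep (op (T + 1)) (st T)).val ⟨i, S.lead i⟩

/-- A route to the designated agent may arrive before or after the fusion in round `(k + 1) * Γ`,
depending on failures. In either case it arrives in time for one of the two fusions and waits there
without crossing another, which is why the sum of both functionals is bounded. -/
lemma Routed.mid_lead_or (h : Routed S op B D δ) (hΓ : Γ = B * D) (hΓ0 : 0 < Γ) (k : ℕ)
    {A A' : ℕ → Weighting S} (hA : IsNonnegBackward op Γ ((k + 1) * Γ) A)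
    (hA' : IsNonnegBackward op Γ ((k + 2) * Γ) A') (hAl : A ((k + 1) * Γ) = leadW S)
    (hAl' : A' ((k + 2) * Γ) = leadW S) {τ : ℕ} (h1 : k * Γ < τ) (h2 : τ ≤ k * Γ + B)
    (a : S.Agent) : δ ^ (2 * Γ + D - 1) ≤ (A τ).mid a + (A' τ).mid a := by
  have hδ := h.pos
  have hBΓ : B ≤ Γ := by
    rw [hΓ]; exact Nat.le_mul_of_pos_right B (Nat.pos_of_ne_zero fun h0 => by simp [hΓ, h0] at hΓ0)
  have e1 : (k + 1) * Γ = k * Γ + Γ := by ring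
  have e2 : (k + 2) * Γ = k * Γ + 2 * Γ := by ring
  have p1 : 0 ≤ (A τ).mid a := (hA.nonneg _ (by omega)).mid a
  have p2 : 0 ≤ (A' τ).mid a := (hA'.nonneg _ (by omega)).mid a
  obtain ⟨l, hl, hw⟩ := h.walk a.1 a.2 (S.lead a.1)
  have h4 : l * B ≤ Γ := by rw [hΓ, Nat.mul_comm]; exact Nat.mul_le_mul_left B hl
  obtain ⟨σ, h5, h6, h7⟩ := h.follow hw τ
  have key : ∀ {A : ℕ → Weighting S} {j : ℕ}, IsNonnegBackward op Γ ((j + 1) * Γ) A →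
      A ((j + 1) * Γ) = leadW S → j * Γ < σ → σ ≤ (j + 1) * Γ →
      δ ^ (2 * Γ + D - 1) ≤ (A τ).mid a := by
    intro A j hA hAl hj1 hj2
    have e3 : (j + 1) * Γ = j * Γ + Γ := by ring
    have h8 := h.wait_between hA hj1 hj2 le_rfl le_rfl ⟨a.1, S.lead a.1⟩
    have h9 := h.node_le_mid (hA.nonneg _ le_rfl) ⟨a.1, S.lead a.1⟩
    rw [hAl] at h8 h9
    have h10 : (leadW S).node ⟨a.1, S.lead a.1⟩ = 1 := by simp [leadW]
    rw [h10, mul_one] at h9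
    calc δ ^ (2 * Γ + D - 1) ≤ δ ^ (l + 2 * ((j + 1) * Γ - σ) + 1) :=
          pow_le_pow_of_le_one hδ.le h.le_one (by omega)
      _ = δ ^ l * (δ ^ (2 * ((j + 1) * Γ - σ)) * δ) := by ring
      _ ≤ δ ^ l * (δ ^ (2 * ((j + 1) * Γ - σ)) * (leadW S).mid ⟨a.1, S.lead a.1⟩) := by gcongr
      _ ≤ δ ^ l * (A σ).mid ⟨a.1, S.lead a.1⟩ := by gcongr
      _ ≤ _ := h7 hA hj2
  rcases le_or_gt σ ((k + 1) * Γ) with hc | hc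
  · have := key hA hAl (by omega) hc
    linarith
  · have e3 : (k + 1 + 1) * Γ = (k + 2) * Γ := rfl
    have := key (j := k + 1) hA' hAl' hc (by omega)
    linarith

/-- In one of two consecutive fusions the designated agents hold a definite part of the mass. -/
lemma Routed.leadMass_add_ge (h : Routed S op B D δ) (hst : IsMassRun op Γ st) (hΓ : Γ = B * D)
    (hΓ0 : 0 < Γ) (k : ℕ) :
    δ ^ (2 * Γ + D - 1) * S.N ≤
      leadMass op st ((k + 1) * Γ - 1) + leadMass op st ((k + 2) * Γ - 1) := by
  have e1 : (k + 1) * Γ = k * Γ + Γ := by ring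
  have e2 : (k + 2) * Γ = k * Γ + 2 * Γ := by ring
  have hB : 0 < B := Nat.pos_of_ne_zero fun h0 => by simp [hΓ, h0] at hΓ0
  have hBΓ : B ≤ Γ := by
    rw [hΓ]; exact Nat.le_mul_of_pos_right B (Nat.pos_of_ne_zero fun h0 => by simp [hΓ, h0] at hΓ0)
  set A := backward op Γ ((k + 1) * Γ) (leadW S) with hAdef
  set A' := backward op Γ ((k + 2) * Γ) (leadW S) with hAdef'
  have hAl : A ((k + 1) * Γ) = leadW S := backward_self _ _ _ _
  have hAl' : A' ((k + 2) * Γ) = leadW S := backward_self _ _ _ _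
  have hA : IsNonnegBackward op Γ ((k + 1) * Γ) A :=
    .of_final h (isBackward_backward _ _ _ _) (hAl ▸ leadW_atLeast S)
  have hA' : IsNonnegBackward op Γ ((k + 2) * Γ) A' :=
    .of_final h (isBackward_backward _ _ _ _) (hAl' ▸ leadW_atLeast S)
  have hmid := fun {τ} => h.mid_lead_or hΓ hΓ0 k hA hA' hAl hAl' (τ := τ)
  have hb : ∀ i (u v : Fin (S.n i)), (S.link i).Adj u v → δ ^ (2 * Γ + D - 1) ≤
      (post op A (k * Γ)).buf i u v + (post op A' (k * Γ)).buf i u v := by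
    intro i u v huv
    obtain ⟨τ, h1, h2, h3⟩ := h.exists_receive huv (k * Γ)
    rw [h3 hA.back (by omega), h3 hA'.back (by omega)]
    exact hmid h1 h2 _
  -- The sum of the two functionals reads every unit of mass of round `k * Γ`, on agents and links,
  -- with a definite coefficient; the total mass is `S.N`.
  have hsum : (⟨fun a => (post op A (k * Γ)).node a + (post op A' (k * Γ)).node a,
      fun i u v => (post op A (k * Γ)).buf i u v + (post op A' (k * Γ)).buf i u v⟩ :
      Weighting S).AtLeast (δ ^ (2 * Γ + D - 1)) := by
    refine ⟨fun a => ?_, hb⟩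
    have := share_mul_ge (a := a) (hmid (τ := k * Γ + 1) (by omega) (by omega) a)
      (g := fun v => (post op A (k * Γ)).buf a.1 a.2 v + (post op A' (k * Γ)).buf a.1 a.2 v)
      fun v hv => hb _ _ v hv
    refine this.trans_eq ?_
    simp only [post, pull, Finset.sum_add_distrib]
    ring
  have h5 := hsum.le_pair (hst.nonneg (k * Γ))
  rw [hst.total h.M_ne] at h5
  have h6 : ∀ j, (j + 1) * Γ - 1 + 1 = (j + 1) * Γ := fun j => by
    have : (j + 1) * Γ = j * Γ + Γ := by ring
    omega
  have h7 := hst.pair_final (T := (k + 1) * Γ - 1) (U := A) (r := k * Γ)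
    (by rw [h6]; exact hA.back) (by omega)
  have h8 := hst.pair_final (T := (k + 1 + 1) * Γ - 1) (U := A') (r := k * Γ)
    (by rw [h6]; exact hA'.back) (by have e3 : (k + 1 + 1) * Γ = (k + 2) * Γ := rfl; omega)
  rw [h6] at h7 h8
  rw [hAl, leadW_pair] at h7
  rw [show A' ((k + 1 + 1) * Γ) = leadW S from hAl', leadW_pair] at h8
  have h9 : leadMass op st ((k + 1) * Γ - 1) = (post op A (k * Γ)).pair (st (k * Γ)) := by
    rw [← h7, leadMass, h6]
  have h10 : leadMass op st ((k + 2) * Γ - 1) = (post op A' (k * Γ)).pair (st (k * Γ)) := by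
    rw [← h8, leadMass, show (k + 2) * Γ - 1 = (k + 1 + 1) * Γ - 1 by rfl, h6]
  rw [h9, h10]
  refine h5.trans_eq ?_
  simp only [pair, smul_eq_mul, add_mul, Finset.sum_add_distrib]
  ring

/-- A lower bound for a mass in terms of the coefficients one period after a fusion. -/
lemma IsMassRun.mass_ge_coeff (hst : IsMassRun op Γ st) (hΓ0 : 0 < Γ) (hU : IsNonnegBackward op Γ t U) {j : ℕ} (hj0 : 0 < j) (hj : (j + 1) * Γ ≤ t)
    {x : ℝ} (hx : x ≤ ∑ i, (post op U (j * Γ)).node ⟨i, S.lead i⟩) :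
    fusedPart S / S.M * leadMass op st (j * Γ - 1) * x ≤ (post op U (j * Γ)).pair (st (j * Γ)) := by
  have e1 : (j + 1) * Γ = j * Γ + Γ := by ring
  have e0 : j * Γ - 1 + 1 = j * Γ := by
    have := Nat.mul_pos hj0 hΓ0; omega
  have hn := hst.nonneg (j * Γ)
  have hV := hU.post_nonneg (r := j * Γ) (by omega)
  have hloc := (hst.nonneg (j * Γ - 1)).localStep (op (j * Γ))
  -- Fusion in round `j * Γ` has just spread the mass of the designated agents evenly enough that
  -- each holds a part of all of it.
  have hval : ∀ i, fusedPart S / S.M * leadMass op st (j * Γ - 1) ≤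
      (st (j * Γ)).val ⟨i, S.lead i⟩ := by
    intro i
    have h1 := hst.succ (j * Γ - 1)
    rw [e0] at h1
    rw [h1, leadMass, e0]
    simp only [fuseAt]
    rw [if_pos (Nat.mul_mod_left j Γ)]
    exact fuse_lead_ge hloc.1 i
  have hL : 0 ≤ leadMass op st (j * Γ - 1) := by
    rw [leadMass, e0]; exact Finset.sum_nonneg fun i _ => hloc.1 _
  have hθ := fusedPart_pos S
  calc fusedPart S / S.M * leadMass op st (j * Γ - 1) * x
      ≤ fusedPart S / S.M * leadMass op st (j * Γ - 1) *
        ∑ i, (post op U (j * Γ)).node ⟨i, S.lead i⟩ := by gcongr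
    _ = ∑ i, (post op U (j * Γ)).node ⟨i, S.lead i⟩ *
        (fusedPart S / S.M * leadMass op st (j * Γ - 1)) := by rw [← Finset.sum_mul]; ring
    _ ≤ ∑ i, (post op U (j * Γ)).node ⟨i, S.lead i⟩ * (st (j * Γ)).val ⟨i, S.lead i⟩ :=
        Finset.sum_le_sum fun i _ => mul_le_mul_of_nonneg_left (hval i) (hV.1 _)
    _ = ∑ a : S.Agent, (if a.2 = S.lead a.1 then
          (post op U (j * Γ)).node a * (st (j * Γ)).val a else 0) :=
        (sum_lead fun a => (post op U (j * Γ)).node a * (st (j * Γ)).val a).symm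
    _ ≤ _ := by
        refine Finset.sum_le_sum fun a _ => ?_
        have h2 : 0 ≤ ∑ k ∈ outNbrs S a, (post op U (j * Γ)).buf a.1 a.2 k •
            ((st (j * Γ)).sent a - (st (j * Γ)).recv a.1 a.2 k) :=
          Finset.sum_nonneg fun k hk => mul_nonneg (hV.2 _ _ _ (mem_outNbrs.1 hk))
            (sub_nonneg.2 (hn.2 _ _ _ (mem_outNbrs.1 hk)))
        have h3 := mul_nonneg (hV.1 a) (hn.1 a)
        simp only [smul_eq_mul] at h2 ⊢
        split_ifs <;> linarith

end Mass

open Weighting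

/-- A geometric series in which every term is repeated `m` times. -/
lemma sum_pow_div_le {ρ : ℝ} (h0 : 0 ≤ ρ) (h1 : ρ < 1) {m : ℕ} (hm : 0 < m) (n : ℕ) :
    ∑ i ∈ Finset.range n, ρ ^ (i / m) ≤ m / (1 - ρ) := by
  have hm' : (0 : ℝ) < m := by exact_mod_cast hm
  have hsmall : ∀ n ≤ m, ∑ i ∈ Finset.range n, ρ ^ (i / m) ≤ m := by
    intro n hn
    calc ∑ i ∈ Finset.range n, ρ ^ (i / m) ≤ ∑ i ∈ Finset.range n, (1 : ℝ) :=
          Finset.sum_le_sum fun i _ => pow_le_one₀ h0 h1.le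
      _ ≤ m := by simpa using hn
  have hd : (0 : ℝ) < 1 - ρ := by linarith
  induction n using Nat.strong_induction_on with
  | _ n ih =>
    rcases le_or_gt n m with hn | hn
    · refine (hsmall n hn).trans ?_
      rw [le_div_iff₀ hd]
      nlinarith
    · obtain ⟨k, rfl⟩ := Nat.exists_eq_add_of_le hn.le
      rw [Finset.sum_range_add]
      have h2 : ∀ i, ρ ^ ((m + i) / m) = ρ * ρ ^ (i / m) := fun i => by
        rw [Nat.add_div_left i hm, pow_succ, mul_comm]
      simp only [h2, ← Finset.mul_sum]
      have h3 := ih k (by omega)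
      have h4 := hsmall m le_rfl
      calc _ ≤ (m : ℝ) + ρ * (m / (1 - ρ)) := by gcongr
        _ = m / (1 - ρ) := by field_simp; ring

/-! ### Deviation of the ratio coefficients from uniform weights. -/

section Consensus

variable {S : Network} {op : ℕ → S.Pattern} {B D : ℕ} {δ : ℝ} {Γ t : ℕ} {U : ℕ → Weighting S}
  {st : ℕ → PushSum S ℝ}

lemma half_le_fusedPart (S : Network) : 1 / 2 ≤ fusedPart S := by
  unfold fusedPart; split_ifs <;> norm_num

/-- The value `1` of `fusedPart` for a single sub-network is needed here; it lets powers of `S.M`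
pay for fusion factors. -/
lemma one_le_M_mul_fusedPart (hM : S.M ≠ 0) : 1 ≤ (S.M : ℝ) * fusedPart S := by
  unfold fusedPart
  split_ifs with h1
  · rw [h1]; norm_num
  · have : (2 : ℝ) ≤ S.M := by exact_mod_cast (by omega : 2 ≤ S.M)
    linarith

lemma Routed.delta_le_mid_agentW (h : Routed S op B D δ) (a : S.Agent) :
    δ ≤ (agentW a).mid a := by
  have := h.node_le_mid (agentW_atLeast a) a
  simpa [agentW] using this

/-- Early on it suffices to count what remains of the agent's own initial unit of mass; at most two
fusions are crossed. -/
lemma Routed.mass_ge_of_le (h : Routed S op B D δ) (hst : IsMassRun op Γ st)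
    (hU : IsNonnegBackward op Γ t U) {a : S.Agent} (hUt : U t = agentW a) (ht0 : 0 < t)
    (ht : t ≤ 3 * Γ) : fusedPart S ^ 2 * δ ^ (6 * Γ) ≤ (post op U 0).pair (st 0) := by
  have hδ := h.pos
  have hθ := fusedPart_pos S
  rw [hst.init, pair_init]
  have h1 := h.mid_le_post hU ht0 a
  have h2 := h.wait hU (j := 0) (n := 2) (r := 1) (T := t) (by omega) ht0 (by omega) le_rfl a
  have h3 := h.delta_le_mid_agentW a
  rw [hUt] at h2
  calc fusedPart S ^ 2 * δ ^ (6 * Γ) ≤ fusedPart S ^ 2 * δ ^ (2 * (t - 1) + 2) := by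
        gcongr _ * ?_
        exact pow_le_pow_of_le_one hδ.le h.le_one (by omega)
    _ = δ * (fusedPart S ^ 2 * (δ ^ (2 * (t - 1)) * δ)) := by ring
    _ ≤ δ * (fusedPart S ^ 2 * (δ ^ (2 * (t - 1)) * (agentW a).mid a)) := by gcongr
    _ ≤ δ * (U (0 + 1)).mid a := by gcongr
    _ ≤ (post op U 0).node a := h1
    _ ≤ _ := Finset.single_le_sum (f := (post op U 0).node)
        (fun b _ => (hU.post_nonneg ht0).1 b) (Finset.mem_univ a)

/-- Later the mass comes from everywhere: from any agent or link to a designated agent, through the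
fusion in round `(k + 2) * Γ` to the designated agent of the sub-network of `a`, then to `a`. Hence
the factor `S.N`. -/
lemma Routed.mass_ge_of_gt (h : Routed S op B D δ) (hst : IsMassRun op Γ st) (hΓ : Γ = B * D)
    (hΓ0 : 0 < Γ) (hU : IsNonnegBackward op Γ t U) {a : S.Agent} (hUt : U t = agentW a) {k : ℕ}
    (hk1 : (k + 3) * Γ < t) (hk2 : t ≤ (k + 4) * Γ) :
    fusedPart S ^ 3 / S.M * δ ^ (6 * Γ + 2 * B - 1) * S.N ≤
      (post op U (k * Γ)).pair (st (k * Γ)) := by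
  have hδ := h.pos
  have hθ := fusedPart_pos S
  have hB : 0 < B := Nat.pos_of_ne_zero fun h0 => by simp [hΓ, h0] at hΓ0
  have e2 : (k + 2) * Γ = k * Γ + 2 * Γ := by ring
  have e3 : (k + 3) * Γ = k * Γ + 3 * Γ := by ring
  have e4 : (k + 4) * Γ = k * Γ + 4 * Γ := by ring
  have hq : ∀ i, fusedPart S / S.M * (fusedPart S * δ ^ (4 * Γ)) ≤
      (U ((k + 2) * Γ)).node ⟨i, S.lead i⟩ := by
    intro i
    have hV := (hU.post_nonneg (r := (k + 2) * Γ) (by omega)).1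
    refine le_trans ?_ (hU.back.node_lead_ge (by omega) (Dvd.intro_left _ rfl) hV i)
    gcongr
    have h1 := h.mid_le_post hU (r := (k + 2) * Γ) (by omega) ⟨a.1, S.lead a.1⟩
    have h2 := h.travel hU hΓ (j := k + 2) (n := 1) (r := (k + 2) * Γ + 1) (T := t) (by omega)
      (by omega) hk2 le_rfl (S.lead a.1) a.2
    have h3 := h.delta_le_mid_agentW a
    rw [hUt] at h2
    calc fusedPart S * δ ^ (4 * Γ) ≤ fusedPart S * δ ^ (2 * (t - ((k + 2) * Γ + 1)) + 2) := by
          gcongr _ * ?_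
          exact pow_le_pow_of_le_one hδ.le h.le_one (by omega)
      _ = δ * (fusedPart S ^ 1 * (δ ^ (2 * (t - ((k + 2) * Γ + 1))) * δ)) := by ring
      _ ≤ δ * (fusedPart S ^ 1 * (δ ^ (2 * (t - ((k + 2) * Γ + 1))) * (agentW a).mid a)) := by
          gcongr
      _ ≤ δ * (U ((k + 2) * Γ + 1)).mid ⟨a.1, S.lead a.1⟩ := by gcongr
      _ ≤ (post op U ((k + 2) * Γ)).node ⟨a.1, S.lead a.1⟩ := h1
      _ ≤ _ := Finset.single_le_sum (f := fun k' => (post op U ((k + 2) * Γ)).node ⟨k', S.lead k'⟩)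
        (fun b _ => hV _) (Finset.mem_univ a.1)
  have h5 := (h.post_atLeast_lead hU hΓ hΓ0 (by omega) (by positivity) hq).le_pair
    (hst.nonneg (k * Γ))
  rw [hst.total h.M_ne] at h5
  refine le_trans (le_of_eq ?_) h5
  rw [show 6 * Γ + 2 * B - 1 = 2 * Γ + 2 * B - 1 + 4 * Γ by omega, pow_add]
  ring

/-- The factor `δ ^ (D - 8 Γ)`. -/
def growth (δ : ℝ) (Γ D : ℕ) : ℝ := (δ ^ (8 * Γ - D))⁻¹

lemma Routed.one_le_growth (h : Routed S op B D δ) : 1 ≤ growth δ Γ D :=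
  one_le_inv_iff₀.2 ⟨pow_pos h.pos _, pow_le_one₀ h.pos.le h.le_one⟩

lemma Routed.one_le_growth_mul (h : Routed S op B D δ) {e : ℕ} (he : e ≤ 8 * Γ - D) :
    1 ≤ growth δ Γ D * δ ^ e := by
  unfold growth
  rw [inv_mul_eq_div, one_le_div₀ (pow_pos h.pos _)]
  exact pow_le_pow_of_le_one h.pos.le h.le_one he

/-- Contribution of the injections of one round to the deviation of the ratio of agent `a`. -/
def ratioDev (S : Network) (f : Weighting S) (m : ℝ) : ℝ := ∑ b, |f.node b / m - 1 / (S.N : ℝ)|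

lemma ratioDev_le_of_le_one {f : Weighting S} (hf0 : f.AtLeast 0) (hf1 : (aff 1 (-1) f).AtLeast 0)
    {m : ℝ} (hm : 0 < m) (hN : 0 < S.N) : ratioDev S f m ≤ S.N / m + 1 := by
  have hN' : (0 : ℝ) < S.N := by exact_mod_cast hN
  calc ratioDev S f m ≤ ∑ _b : S.Agent, (1 / m + 1 / (S.N : ℝ)) := by
        refine Finset.sum_le_sum fun b _ => ?_
        have h0 := hf0.1 b
        have h1 := hf1.1 b
        simp only [aff] at h1
        have h2 : f.node b / m ≤ 1 / m := by gcongr; linarith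
        have h3 : 0 ≤ f.node b / m := by positivity
        have h4 : 0 < 1 / (S.N : ℝ) := by positivity
        rw [abs_le]
        constructor <;> linarith
    _ = S.N / m + 1 := by
        rw [Finset.sum_const, Finset.card_univ, card_agent, nsmul_eq_mul]
        field_simp

/-- Both `f.node b` and the mean `m / S.N` lie in the interval from `lo` to `hi`. -/
lemma ratioDev_le_of_between {f : Weighting S} {lo hi m : ℝ} (hlo : f.AtLeast lo)
    (hhi : (aff hi (-1) f).AtLeast 0) (hm : 0 < m) (hN : 0 < S.N) (hmlo : lo * S.N ≤ m)
    (hmhi : m ≤ hi * S.N) : ratioDev S f m ≤ S.N * (hi - lo) / m := by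
  have hN' : (0 : ℝ) < S.N := by exact_mod_cast hN
  calc ratioDev S f m ≤ ∑ _b : S.Agent, (hi - lo) / m := by
        refine Finset.sum_le_sum fun b _ => ?_
        have h0 := hlo.1 b
        have h1 := hhi.1 b
        simp only [aff] at h1
        have h2 : f.node b / m - 1 / (S.N : ℝ) = (f.node b - m / S.N) / m := by field_simp
        rw [h2, abs_div, abs_of_pos hm]
        have h3 : lo ≤ m / S.N := by rwa [le_div_iff₀ hN']
        have h4 : m / S.N ≤ hi := by rwa [div_le_iff₀ hN']
        gcongr
        rw [abs_le]
        constructor <;> linarith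
    _ = S.N * (hi - lo) / m := by
        rw [Finset.sum_const, Finset.card_univ, card_agent, nsmul_eq_mul]
        ring

lemma exists_period (hΓ0 : 0 < Γ) (ht : 0 < t) : ∃ k, k * Γ < t ∧ t ≤ (k + 1) * Γ := by
  refine ⟨(t - 1) / Γ, ?_, ?_⟩
  · have := Nat.div_mul_le_self (t - 1) Γ
    omega
  · have := Nat.lt_mul_div_succ (t - 1) hΓ0
    rw [Nat.mul_comm] at this
    omega

end Consensus

open Weighting

section Consensus

variable {S : Network} {op : ℕ → S.Pattern} {B D : ℕ} {δ : ℝ} {Γ t : ℕ} {U : ℕ → Weighting S}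
  {st : ℕ → PushSum S ℝ}

/-- All follow from `B + D - 1 ≤ B * D`. They show that `growth` compensates every power of `δ` that
occurs. -/
lemma exponent_bounds (hΓ : Γ = B * D) (hΓ0 : 0 < Γ) :
    0 < B ∧ 0 < D ∧ 6 * Γ + D ≤ 8 * Γ - D ∧ 6 * Γ + 2 * B - 1 ≤ 8 * Γ - D ∧
      6 * Γ + 2 * B + D - 2 ≤ 8 * Γ - D := by
  have hB : 0 < B := Nat.pos_of_ne_zero fun h0 => by simp [hΓ, h0] at hΓ0
  have hD : 0 < D := Nat.pos_of_ne_zero fun h0 => by simp [hΓ, h0] at hΓ0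
  obtain ⟨b, rfl⟩ := Nat.exists_eq_add_of_le hB
  obtain ⟨d, rfl⟩ := Nat.exists_eq_add_of_le hD
  have h1 : Γ = 1 + b + d + b * d := by rw [hΓ]; ring
  refine ⟨hB, hD, ?_, ?_, ?_⟩ <;> omega

lemma Routed.N_le_mass (h : Routed S op B D δ) (hst : IsMassRun op Γ st) (hΓ : Γ = B * D)
    (hΓ0 : 0 < Γ) (hN : (S.N : ℝ) * δ ^ D ≤ S.M) (hU : IsNonnegBackward op Γ t U) {a : S.Agent}
    (hUt : U t = agentW a) (ht0 : 0 < t) :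
    (S.N : ℝ) ≤ 2 * S.M ^ 3 * growth δ Γ D * (post op U 0).pair (st 0) := by
  obtain ⟨hB, hD, he1, he2, -⟩ := exponent_bounds hΓ hΓ0
  have hδ := h.pos
  have hθ := fusedPart_pos S
  have hM : (0 : ℝ) < S.M := by exact_mod_cast Nat.pos_of_ne_zero h.M_ne
  have hMθ := one_le_M_mul_fusedPart h.M_ne
  have hg := h.one_le_growth (Γ := Γ)
  have hg0 : 0 < growth δ Γ D := by linarith
  rcases le_or_gt t (3 * Γ) with hc | hc
  · have h1 := h.mass_ge_of_le hst hU hUt ht0 hc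
    have h2 := h.one_le_growth_mul he1
    have h3 : 1 ≤ ((S.M : ℝ) * fusedPart S) ^ 2 := one_le_pow₀ hMθ
    -- A single unit of mass is weak against `S.N`; the bound `hN` on the size of the network makes
    -- up for it at the price of `δ ^ D`.
    have h5 : (S.N : ℝ) ≤ S.M * (growth δ Γ D * δ ^ (6 * Γ)) := by
      calc (S.N : ℝ) ≤ S.N * (growth δ Γ D * δ ^ (6 * Γ + D)) := le_mul_of_one_le_right (by positivity) h2
        _ = (S.N * δ ^ D) * (growth δ Γ D * δ ^ (6 * Γ)) := by rw [pow_add]; ring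
        _ ≤ _ := by gcongr
    calc (S.N : ℝ) ≤ S.M * (growth δ Γ D * δ ^ (6 * Γ)) := h5
      _ ≤ ((S.M : ℝ) * fusedPart S) ^ 2 * (S.M * (growth δ Γ D * δ ^ (6 * Γ))) :=
          le_mul_of_one_le_left (by positivity) h3
      _ = S.M ^ 3 * growth δ Γ D * (fusedPart S ^ 2 * δ ^ (6 * Γ)) := by ring
      _ ≤ S.M ^ 3 * growth δ Γ D * (post op U 0).pair (st 0) := by gcongr
      _ ≤ _ := by
          have : 0 ≤ S.M ^ 3 * growth δ Γ D * (post op U 0).pair (st 0) :=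
            mul_nonneg (by positivity) (le_trans (by positivity) h1)
          linarith
  · obtain ⟨k, hk1, hk2⟩ := exists_period hΓ0 ht0
    have hk3 : 3 ≤ k := by
      by_contra hlt
      have : (k + 1) * Γ ≤ 3 * Γ := Nat.mul_le_mul_right Γ (by omega)
      omega
    obtain ⟨k, rfl⟩ := Nat.exists_eq_add_of_le' hk3
    have h1 := h.mass_ge_of_gt hst hΓ hΓ0 hU hUt hk1 hk2
    have hkt : k * Γ < t := lt_of_le_of_lt (Nat.mul_le_mul_right Γ (by omega)) hk1
    have h0 : (post op U (k * Γ)).pair (st (k * Γ)) = (post op U 0).pair (st 0) := by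
      have := hst.run.pair_eq hU.back hkt
      simpa [post] using this
    rw [h0] at h1
    have h2 := h.one_le_growth_mul he2
    have h3 : 1 ≤ 2 * (S.M : ℝ) ^ 2 * fusedPart S ^ 3 := by
      have h4 : 1 ≤ ((S.M : ℝ) * fusedPart S) ^ 2 := one_le_pow₀ hMθ
      have h5 := half_le_fusedPart S
      calc (1 : ℝ) ≤ ((S.M : ℝ) * fusedPart S) ^ 2 * (2 * fusedPart S) :=
            one_le_mul_of_one_le_of_one_le h4 (by linarith)
        _ = _ := by ring
    calc (S.N : ℝ) ≤ (2 * (S.M : ℝ) ^ 2 * fusedPart S ^ 3) *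
          ((growth δ Γ D * δ ^ (6 * Γ + 2 * B - 1)) * S.N) :=
          (le_mul_of_one_le_left (by positivity) h2).trans (le_mul_of_one_le_left (by positivity) h3)
      _ = 2 * S.M ^ 3 * growth δ Γ D *
          (fusedPart S ^ 3 / S.M * δ ^ (6 * Γ + 2 * B - 1) * S.N) := by field_simp
      _ ≤ _ := by gcongr

lemma Routed.exists_leadMass_ge (h : Routed S op B D δ) (hst : IsMassRun op Γ st) (hΓ : Γ = B * D)
    (hΓ0 : 0 < Γ) (k : ℕ) : ∃ j, (j = k + 1 ∨ j = k + 2) ∧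
      δ ^ (2 * Γ + D - 1) * S.N / 2 ≤ leadMass op st (j * Γ - 1) := by
  have h1 := h.leadMass_add_ge hst hΓ hΓ0 k
  rcases le_or_gt (δ ^ (2 * Γ + D - 1) * S.N / 2) (leadMass op st ((k + 1) * Γ - 1)) with h2 | h2
  · exact ⟨k + 1, .inl rfl, h2⟩
  · exact ⟨k + 2, .inr rfl, by linarith⟩

/-- Upper bound for all coefficients one period after a fusion at which the designated agents hold
a definite part of the mass. -/
lemma Routed.coeff_le (h : Routed S op B D δ) (hst : IsMassRun op Γ st) (hΓ : Γ = B * D)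
    (hΓ0 : 0 < Γ) (hU : IsNonnegBackward op Γ t U) (hN0 : 0 < S.N) {j : ℕ} (hj0 : 0 < j)
    (hj : (j + 1) * Γ ≤ t)
    (hlead : δ ^ (2 * Γ + D - 1) * S.N / 2 ≤ leadMass op st (j * Γ - 1)) :
    (aff (2 * S.M / (fusedPart S * δ ^ (4 * Γ + D - 1) * S.N) *
      (post op U (j * Γ)).pair (st (j * Γ))) (-1) (U ((j + 1) * Γ))).AtLeast 0 := by
  have hδ := h.pos
  have hθ := fusedPart_pos S
  have hM : (0 : ℝ) < S.M := by exact_mod_cast Nat.pos_of_ne_zero h.M_ne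
  have hN : (0 : ℝ) < S.N := by exact_mod_cast hN0
  have hlt : j * Γ < t := lt_of_lt_of_le (by have : (j + 1) * Γ = j * Γ + Γ := by ring
                                             omega) hj
  have hV := hU.post_nonneg hlt
  -- A large coefficient in round `(j + 1) * Γ` forces a large coefficient of some designated agent
  -- one period earlier. That agent holds mass, so the pairing with the masses is large too.
  have key : ∀ x, 0 ≤ x → (∃ i : Fin S.M, δ ^ (2 * Γ) * x ≤ (post op U (j * Γ)).node ⟨i, S.lead i⟩) →
      x ≤ 2 * S.M / (fusedPart S * δ ^ (4 * Γ + D - 1) * S.N) *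
        (post op U (j * Γ)).pair (st (j * Γ)) := by
    rintro x hx0 ⟨i, hi⟩
    have h1 := hst.mass_ge_coeff hΓ0 hU hj0 hj (hi.trans (Finset.single_le_sum
      (f := fun i => (post op U (j * Γ)).node ⟨i, S.lead i⟩) (fun i _ => hV.1 _)
        (Finset.mem_univ i)))
    have h2 : fusedPart S / S.M * (δ ^ (2 * Γ + D - 1) * S.N / 2) * (δ ^ (2 * Γ) * x) ≤
        (post op U (j * Γ)).pair (st (j * Γ)) := le_trans (by gcongr) h1
    have h3 : x = 2 * S.M / (fusedPart S * δ ^ (4 * Γ + D - 1) * S.N) *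
        (fusedPart S / S.M * (δ ^ (2 * Γ + D - 1) * S.N / 2) * (δ ^ (2 * Γ) * x)) := by
      rw [show 4 * Γ + D - 1 = 2 * Γ + D - 1 + 2 * Γ by omega, pow_add]
      field_simp
    calc x = _ := h3
      _ ≤ _ := by gcongr
  have hUT := hU.nonneg _ hj
  refine ⟨fun a => ?_, fun i u v huv => ?_⟩
  · have := key _ (hUT.1 a) ⟨a.1, h.node_le_post_period hU hΓ hΓ0 hj _ _⟩
    simp only [aff]; linarith
  · have := key _ (hUT.2 i u v huv) ⟨i, h.buf_le_post_period hU hΓ hΓ0 hj _ _ _ huv⟩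
    simp only [aff]; linarith

/-- Decay of the deviations of the injections before round `(j + 1) * Γ`. -/
lemma Routed.ratioDev_le (h : Routed S op B D δ) (hst : IsMassRun op Γ st) (hΓ : Γ = B * D)
    (hΓ0 : 0 < Γ) (hU : IsNonnegBackward op Γ t U) (hN0 : 0 < S.N) {j : ℕ} (hj0 : 0 < j)
    (hj : (j + 1) * Γ ≤ t) {m : ℝ} (hm : m = (post op U 0).pair (st 0)) (hm0 : 0 < m)
    (hlead : δ ^ (2 * Γ + D - 1) * S.N / 2 ≤ leadMass op st (j * Γ - 1)) {r : ℕ}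
    (hr : r ≤ (j + 1) * Γ) :
    ratioDev S (U r) m ≤ (1 - mixRate S δ Γ B) ^ ((j * Γ - r) / (2 * Γ)) *
      (2 * S.M / (fusedPart S * δ ^ (4 * Γ + D - 1))) := by
  have hδ := h.pos
  have hθ := fusedPart_pos S
  have hM : (0 : ℝ) < S.M := by exact_mod_cast Nat.pos_of_ne_zero h.M_ne
  have hN : (0 : ℝ) < S.N := by exact_mod_cast hN0
  have e1 : (j + 1) * Γ = j * Γ + Γ := by ring
  have hpair : ∀ r < t, (post op U r).pair (st r) = m := fun r hr => by
    have := hst.run.pair_eq hU.back hr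
    rw [hm]; simpa [post] using this
  have hup := h.coeff_le hst hΓ hΓ0 hU hN0 hj0 hj hlead
  rw [hpair _ (by omega)] at hup
  set s := 2 * S.M / (fusedPart S * δ ^ (4 * Γ + D - 1) * S.N) * m with hs
  have hsN : S.N * s / m = 2 * S.M / (fusedPart S * δ ^ (4 * Γ + D - 1)) := by
    rw [hs]; field_simp
  have hpost0 := hU.post_nonneg (r := j * Γ) (by omega)
  have hUs := hU.back.aff h.M_ne s (-1)
  have hposts : (aff s (-1) (post op U (j * Γ))).AtLeast 0 := by
    rw [← post_aff]
    exact (hUs.atLeast h.M_ne hj hup (by omega)).pull _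
  -- The conserved pairing `m` is the average of the coefficients against total mass `S.N`, so `m /
  -- S.N` stays in every interval containing them.
  have hmass : ∀ {r : ℕ} {lo hi : ℝ}, r < t → (post op U r).AtLeast lo →
      (aff hi (-1) (post op U r)).AtLeast 0 → lo * S.N ≤ m ∧ m ≤ hi * S.N := by
    intro r lo hi hr hlo hhi
    have h1 := hlo.le_pair (hst.nonneg r)
    have h2 := hhi.le_pair (hst.nonneg r)
    rw [pair_aff] at h2
    rw [hst.total h.M_ne, hpair r hr] at h1 h2
    constructor <;> linarith
  rcases lt_or_ge (j * Γ) r with hc | hc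
  · have he : j * Γ - r = 0 := by omega
    rw [he, Nat.zero_div, pow_zero, one_mul, ← hsN]
    obtain ⟨h1, h2⟩ := hmass (by omega) hpost0 hposts
    have := ratioDev_le_of_between (hU.nonneg r (by omega))
      (hUs.atLeast h.M_ne hj hup hr) hm0 hN0 h1 h2
    simpa using this
  · set n := (j * Γ - r) / (2 * Γ) with hn
    have h1 : n * (2 * Γ) ≤ j * Γ - r := Nat.div_mul_le_self _ _
    have h2 : 2 * n ≤ j := by
      by_contra hlt
      have : (j + 1) * Γ ≤ 2 * n * Γ := Nat.mul_le_mul_right Γ (by omega)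
      have : 2 * n * Γ = n * (2 * Γ) := by ring
      omega
    obtain ⟨lo, hi, h3, h4, h5⟩ := h.contraction_iterate hU.back hΓ hΓ0 (T := j) (by omega)
      hpost0 hposts n h2
    have h6 : (j - 2 * n) * Γ = j * Γ - n * (2 * Γ) := by
      rw [Nat.sub_mul]; congr 1; ring
    have h7 : (j - 2 * n) * Γ < t := by omega
    obtain ⟨h8, h9⟩ := hmass h7 h3 h4
    have h10 : (U r).AtLeast lo := hU.back.atLeast h.M_ne h7.le
      (by rw [hU.back _ h7]; exact h3.fuseW h.M_ne _ _) (by omega)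
    have h11 : (aff hi (-1) (U r)).AtLeast 0 := (hU.back.aff h.M_ne hi (-1)).atLeast h.M_ne h7.le
      (by rw [hU.back _ h7, ← fuseW_aff h.M_ne]; exact h4.fuseW h.M_ne _ _) (by omega)
    have h12 := ratioDev_le_of_between h10 h11 hm0 hN0 h8 h9
    rw [h5] at h12
    refine h12.trans_eq ?_
    rw [← hsN]; ring

/-- The weights with which the injections enter the ratio of an agent deviate from uniform weights
by a bounded total amount. -/
lemma Routed.sum_ratioDev_le (h : Routed S op B D δ) (hst : IsMassRun op Γ st) (hΓ : Γ = B * D)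
    (hΓ0 : 0 < Γ) (hN : (S.N : ℝ) * δ ^ D ≤ S.M) (hU : IsNonnegBackward op Γ t U) {a : S.Agent}
    (hUt : U t = agentW a) (ht0 : 0 < t) (hN0 : 0 < S.N) :
    0 < (post op U 0).pair (st 0) ∧
    ∑ r ∈ Finset.range t, ratioDev S (U (r + 1)) ((post op U 0).pair (st 0)) ≤
      18 * Γ * S.M ^ 3 * growth δ Γ D := by
  obtain ⟨hB, hD, he1, he2, he3⟩ := exponent_bounds hΓ hΓ0
  have hmN := h.N_le_mass hst hΓ hΓ0 hN hU hUt ht0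
  set m := (post op U 0).pair (st 0) with hm
  have hδ := h.pos
  have hθ := fusedPart_pos S
  have hM1 : (1 : ℝ) ≤ S.M := by exact_mod_cast Nat.pos_of_ne_zero h.M_ne
  have hM : (0 : ℝ) < S.M := by linarith
  have hMθ := one_le_M_mul_fusedPart h.M_ne
  have hg := h.one_le_growth (Γ := Γ)
  have hg0 : 0 < growth δ Γ D := by linarith
  have hN' : (0 : ℝ) < S.N := by exact_mod_cast hN0
  have hΓ' : (0 : ℝ) < Γ := by exact_mod_cast hΓ0
  have hm0 : 0 < m := by
    have : 0 < 2 * S.M ^ 3 * growth δ Γ D * m := lt_of_lt_of_le hN' hmN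
    exact pos_of_mul_pos_right this (by positivity)
  refine ⟨hm0, ?_⟩
  have hU1 : ∀ r ≤ t, (aff 1 (-1) (U r)).AtLeast 0 := fun r hr =>
    (hU.back.aff h.M_ne 1 (-1)).atLeast h.M_ne le_rfl (by
      rw [hUt]
      exact ⟨fun b => by simp only [aff, agentW]; split_ifs <;> norm_num,
        fun _ _ _ _ => by simp [aff, agentW]⟩) hr
  have hQ : 1 ≤ (S.M : ℝ) ^ 3 * growth δ Γ D :=
    one_le_mul_of_one_le_of_one_le (one_le_pow₀ hM1) hg
  have hone : ∀ r ≤ t, ratioDev S (U r) m ≤ 3 * (S.M ^ 3 * growth δ Γ D) := by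
    intro r hr
    refine (ratioDev_le_of_le_one (hU.nonneg r hr) (hU1 r hr) hm0 hN0).trans ?_
    have : S.N / m ≤ 2 * S.M ^ 3 * growth δ Γ D := by rwa [div_le_iff₀ hm0]
    linarith
  rcases le_or_gt t (3 * Γ) with hc | hc
  · calc ∑ r ∈ Finset.range t, ratioDev S (U (r + 1)) m
        ≤ ∑ r ∈ Finset.range t, 3 * (S.M ^ 3 * growth δ Γ D) :=
          Finset.sum_le_sum fun r hr => hone _ (Finset.mem_range.1 hr)
      _ = t * (3 * (S.M ^ 3 * growth δ Γ D)) := by simp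
      _ ≤ (3 * Γ) * (3 * (S.M ^ 3 * growth δ Γ D)) := by gcongr; exact_mod_cast hc
      _ ≤ _ := by
          have : 0 ≤ (Γ : ℝ) * (S.M ^ 3 * growth δ Γ D) := by positivity
          linarith
  · obtain ⟨k, hk1, hk2⟩ := exists_period hΓ0 ht0
    have hk3 : 3 ≤ k := by
      by_contra hlt
      have : (k + 1) * Γ ≤ 3 * Γ := Nat.mul_le_mul_right Γ (by omega)
      omega
    obtain ⟨k, rfl⟩ := Nat.exists_eq_add_of_le' hk3
    -- The good fusion lies close enough to `t` that at most `2 * Γ` rounds remain after `(j + 1) *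
    -- Γ`. These cost `6` of the final `18` through the crude bound `hone`; the geometric decay of
    -- the older rounds costs `12`.
    obtain ⟨j, hjk, hlead⟩ := h.exists_leadMass_ge hst hΓ hΓ0 k
    have e1 : (j + 1) * Γ = j * Γ + Γ := by ring
    have hj0 : 0 < j := by omega
    have hjt : (j + 1) * Γ ≤ t := (Nat.mul_le_mul_right Γ (by omega)).trans hk1.le
    have hjt2 : t ≤ (j + 1) * Γ + 2 * Γ := by
      refine hk2.trans ?_
      have : (k + 3 + 1) * Γ ≤ (j + 3) * Γ := Nat.mul_le_mul_right Γ (by omega)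
      linarith
    have hdec := fun {r} => h.ratioDev_le hst hΓ hΓ0 hU hN0 hj0 hjt hm hm0 hlead (r := r)
    set ρ := 1 - mixRate S δ Γ B with hρ
    have hκ := h.mixRate_pos (Γ := Γ)
    have hκ1 := h.mixRate_le_one (Γ := Γ)
    have hρ0 : 0 ≤ ρ := by linarith
    have hρ1 : ρ < 1 := by linarith
    set C := 2 * (S.M : ℝ) / (fusedPart S * δ ^ (4 * Γ + D - 1)) with hC
    have hC0 : 0 < C := by positivity
    have hold : ∑ r ∈ Finset.range ((j + 1) * Γ), ratioDev S (U (r + 1)) m ≤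
        3 * Γ / mixRate S δ Γ B * C := by
      rw [e1, Finset.sum_range_add]
      have h1 : ∑ r ∈ Finset.range (j * Γ), ratioDev S (U (r + 1)) m ≤
          2 * Γ / mixRate S δ Γ B * C := by
        calc ∑ r ∈ Finset.range (j * Γ), ratioDev S (U (r + 1)) m
            ≤ ∑ r ∈ Finset.range (j * Γ), ρ ^ ((j * Γ - 1 - r) / (2 * Γ)) * C := by
              refine Finset.sum_le_sum fun r hr => ?_
              have := hdec (r := r + 1) (by have := Finset.mem_range.1 hr; omega)
              rwa [show j * Γ - (r + 1) = j * Γ - 1 - r by omega] at this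
          _ = (∑ r ∈ Finset.range (j * Γ), ρ ^ (r / (2 * Γ))) * C := by
              rw [← Finset.sum_mul, Finset.sum_range_reflect (fun i => ρ ^ (i / (2 * Γ)))]
          _ ≤ ((2 * Γ : ℕ) : ℝ) / (1 - ρ) * C := by
              gcongr
              exact sum_pow_div_le hρ0 hρ1 (by omega) _
          _ = _ := by rw [hρ]; push_cast; ring
      have h2 : ∑ r ∈ Finset.range Γ, ratioDev S (U (j * Γ + r + 1)) m ≤ Γ * C := by
        calc ∑ r ∈ Finset.range Γ, ratioDev S (U (j * Γ + r + 1)) m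
            ≤ ∑ r ∈ Finset.range Γ, C := by
              refine Finset.sum_le_sum fun r hr => ?_
              have := hdec (r := j * Γ + r + 1) (by have := Finset.mem_range.1 hr; omega)
              refine this.trans (mul_le_of_le_one_left hC0.le (pow_le_one₀ hρ0 hρ1.le))
          _ = Γ * C := by simp
      have h3 : (Γ : ℝ) ≤ Γ / mixRate S δ Γ B := le_div_self hΓ'.le hκ hκ1
      have h4 : Γ * C ≤ Γ / mixRate S δ Γ B * C := by gcongr
      calc _ ≤ 2 * Γ / mixRate S δ Γ B * C + Γ / mixRate S δ Γ B * C := by linarith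
        _ = _ := by ring
    have hnew : ∑ r ∈ Finset.Ico ((j + 1) * Γ) t, ratioDev S (U (r + 1)) m ≤
        2 * Γ * (3 * (S.M ^ 3 * growth δ Γ D)) := by
      calc ∑ r ∈ Finset.Ico ((j + 1) * Γ) t, ratioDev S (U (r + 1)) m
          ≤ ∑ r ∈ Finset.Ico ((j + 1) * Γ) t, 3 * (S.M ^ 3 * growth δ Γ D) :=
            Finset.sum_le_sum fun r hr => hone _ (Finset.mem_Ico.1 hr).2
        _ = ((t - (j + 1) * Γ : ℕ) : ℝ) * (3 * (S.M ^ 3 * growth δ Γ D)) := by simp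
        _ ≤ _ := by
            gcongr
            exact_mod_cast (by omega : t - (j + 1) * Γ ≤ 2 * Γ)
    have hmain : 3 * Γ / mixRate S δ Γ B * C ≤ 12 * Γ * (S.M ^ 3 * growth δ Γ D) := by
      have h3 : 1 ≤ 2 * (S.M : ℝ) ^ 2 * fusedPart S ^ 3 := by
        have h4 : 1 ≤ ((S.M : ℝ) * fusedPart S) ^ 2 := one_le_pow₀ hMθ
        have h5 := half_le_fusedPart S
        calc (1 : ℝ) ≤ ((S.M : ℝ) * fusedPart S) ^ 2 * (2 * fusedPart S) :=
              one_le_mul_of_one_le_of_one_le h4 (by linarith)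
          _ = _ := by ring
      have h4 := h.one_le_growth_mul he3
      have h5 : 3 * Γ / mixRate S δ Γ B * C =
          6 * Γ * S.M / (fusedPart S ^ 3 * δ ^ (6 * Γ + 2 * B + D - 2)) := by
        rw [hC, mixRate, show 6 * Γ + 2 * B + D - 2 = 2 * Γ + 2 * B - 1 + (4 * Γ + D - 1) by omega,
          pow_add]
        field_simp
        ring
      rw [h5, div_le_iff₀ (by positivity)]
      calc 6 * Γ * (S.M : ℝ) ≤ 6 * Γ * S.M * ((2 * (S.M : ℝ) ^ 2 * fusedPart S ^ 3) *
            (growth δ Γ D * δ ^ (6 * Γ + 2 * B + D - 2))) :=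
            le_mul_of_one_le_right (by positivity) (one_le_mul_of_one_le_of_one_le h3 h4)
        _ = _ := by ring
    rw [Finset.range_eq_Ico, ← Finset.sum_Ico_consecutive _ (Nat.zero_le _) hjt,
      ← Finset.range_eq_Ico]
    calc _ ≤ 3 * Γ / mixRate S δ Γ B * C + 2 * Γ * (3 * (S.M ^ 3 * growth δ Γ D)) :=
          add_le_add hold hnew
      _ ≤ 12 * Γ * (S.M ^ 3 * growth δ Γ D) + 2 * Γ * (3 * (S.M ^ 3 * growth δ Γ D)) := by
          gcongr
      _ = _ := by ring

end Consensus

open Weighting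

/-! ### The constants of the network: smallest share, diameter, number of agents. -/

section Network

variable {S : Network}

/-- Square root of the smallest `β`. -/
def minShare (S : Network) : ℝ := √(⨅ i, S.β i)

lemma beta_pos (i : Fin S.M) : 0 < S.β i := by
  have h1 : (S.deg ⟨i, S.lead i⟩ + 1) ^ 2 ≤
      Finset.univ.sup fun j : Fin (S.n i) => (S.deg ⟨i, j⟩ + 1) ^ 2 :=
    Finset.le_sup (f := fun j : Fin (S.n i) => (S.deg ⟨i, j⟩ + 1) ^ 2) (Finset.mem_univ _)
  have h2 : 0 < (S.deg ⟨i, S.lead i⟩ + 1) ^ 2 := by positivity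
  have h3 : (0 : ℝ) < ((Finset.univ.sup fun j : Fin (S.n i) => (S.deg ⟨i, j⟩ + 1) ^ 2 : ℕ) : ℝ) := by
    exact_mod_cast h2.trans_le h1
  unfold Network.β
  positivity

lemma beta_le (a : S.Agent) : S.β a.1 ≤ share S a ^ 2 := by
  have h1 : (S.deg a + 1) ^ 2 ≤
      Finset.univ.sup fun j : Fin (S.n a.1) => (S.deg ⟨a.1, j⟩ + 1) ^ 2 :=
    Finset.le_sup (f := fun j : Fin (S.n a.1) => (S.deg ⟨a.1, j⟩ + 1) ^ 2) (Finset.mem_univ a.2)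
  have h3 : ((S.deg a : ℝ) + 1) ^ 2 ≤
      ((Finset.univ.sup fun j : Fin (S.n a.1) => (S.deg ⟨a.1, j⟩ + 1) ^ 2 : ℕ) : ℝ) := by
    exact_mod_cast h1
  unfold Network.β share
  rw [div_pow, one_pow]
  exact one_div_le_one_div_of_le (by positivity) h3

lemma iInf_beta_le (i : Fin S.M) : ⨅ i, S.β i ≤ S.β i :=
  ciInf_le (Finite.bddBelow_range _) i

lemma minShare_le_share (a : S.Agent) : minShare S ≤ share S a :=
  (Real.sqrt_le_left (share_pos a).le).2 ((iInf_beta_le a.1).trans (beta_le a))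

lemma iInf_beta_pos (hM : S.M ≠ 0) : 0 < ⨅ i, S.β i := by
  have : Nonempty (Fin S.M) := ⟨⟨0, Nat.pos_of_ne_zero hM⟩⟩
  obtain ⟨i, hi⟩ := exists_eq_ciInf_of_finite (f := S.β)
  rw [← hi]; exact beta_pos i

lemma minShare_pos (hM : S.M ≠ 0) : 0 < minShare S := Real.sqrt_pos.2 (iInf_beta_pos hM)

lemma M_ne_zero_of_Dstar (hD : 0 < S.Dstar) : S.M ≠ 0 := by
  intro h0
  have : IsEmpty (Fin S.M) := by rw [h0]; infer_instance
  simp [Network.Dstar] at hD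

lemma ddist_le_Dstar (i : Fin S.M) (u v : Fin (S.n i)) : ddist (S.link i) u v ≤ S.Dstar :=
  (Finset.le_sup (f := fun q : Fin (S.n i) × Fin (S.n i) => ddist (S.link i) q.1 q.2)
    (Finset.mem_univ (u, v))).trans
    (Finset.le_sup (f := fun i => ddiam (S.link i)) (Finset.mem_univ i))

lemma exists_walk_le (hconn : ∀ i, StronglyConnected (S.link i)) (i : Fin S.M)
    (u v : Fin (S.n i)) : ∃ h ≤ S.Dstar, HasWalk (S.link i) h u v :=
  ⟨_, ddist_le_Dstar i u v, Nat.sInf_mem (s := {k | HasWalk (S.link i) k u v}) (hconn i u v)⟩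

/-- A positive diameter yields an agent with an out-neighbour, hence of out-degree at least `1`. -/
lemma minShare_le_half (hconn : ∀ i, StronglyConnected (S.link i)) (hD : 0 < S.Dstar) :
    minShare S ≤ 1 / 2 := by
  obtain ⟨i, -, hi⟩ := Finset.lt_sup_iff.1 (show 0 < Finset.univ.sup fun i => ddiam (S.link i) from hD)
  obtain ⟨⟨u, v⟩, -, huv⟩ := Finset.lt_sup_iff.1
    (show 0 < Finset.univ.sup fun q : Fin (S.n i) × Fin (S.n i) => ddist (S.link i) q.1 q.2 from hi)
  simp only at huv
  have hw : HasWalk (S.link i) (ddist (S.link i) u v) u v :=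
    Nat.sInf_mem (s := {k | HasWalk (S.link i) k u v}) (hconn i u v)
  obtain ⟨l, hl⟩ := Nat.exists_eq_succ_of_ne_zero huv.ne'
  rw [hl] at hw
  obtain ⟨x, hux, -⟩ := hw
  refine (minShare_le_share ⟨i, u⟩).trans ?_
  have h1 : 1 ≤ S.deg ⟨i, u⟩ := by
    have : (outNbrs S ⟨i, u⟩).Nonempty := ⟨x, mem_outNbrs.2 hux⟩
    exact this.card_pos
  have h2 : (1 : ℝ) ≤ S.deg ⟨i, u⟩ := by exact_mod_cast h1
  unfold share
  exact one_div_le_one_div_of_le (by norm_num) (by linarith)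

lemma routed (hconn : ∀ i, StronglyConnected (S.link i)) {B : ℕ} {op : ℕ → S.Pattern}
    (hop : S.Reliable B op) (hD : 0 < S.Dstar) : Routed S op B S.Dstar (minShare S) where
  deliver := hop.2
  walk := exists_walk_le hconn
  pos := minShare_pos (M_ne_zero_of_Dstar hD)
  le_half := minShare_le_half hconn hD
  le_share := minShare_le_share
  M_ne := M_ne_zero_of_Dstar hD

variable {op : ℕ → S.Pattern} {B D : ℕ} {δ : ℝ}

open Classical in
-- A ball of radius `l + 1` is covered by the balls of radius `l` around its center and the
-- out-neighbours of the center, at most `1 / δ` of them.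
lemma Routed.card_ball_le (h : Routed S op B D δ) (i : Fin S.M) (l : ℕ) (u : Fin (S.n i)) :
    ((Finset.univ.filter fun v => ∃ k ≤ l, HasWalk (S.link i) k u v).card : ℝ) * δ ^ l ≤ 1 := by
  induction l generalizing u with
  | zero =>
    rw [pow_zero, mul_one]
    refine Nat.cast_le_one.2 (Finset.card_le_one.2 fun v hv w hw => ?_)
    obtain ⟨k, hk, hv⟩ := (Finset.mem_filter.1 hv).2
    obtain ⟨k', hk', hw⟩ := (Finset.mem_filter.1 hw).2
    obtain rfl : k = 0 := by omega
    obtain rfl : k' = 0 := by omega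
    exact (Eq.symm hv).trans hw
  | succ l ih =>
    have hδ := h.pos
    set b : Fin (S.n i) → Finset (Fin (S.n i)) := fun u =>
      Finset.univ.filter fun v => ∃ k ≤ l, HasWalk (S.link i) k u v
    have hsub : (Finset.univ.filter fun v => ∃ k ≤ l + 1, HasWalk (S.link i) k u v) ⊆
        b u ∪ (outNbrs S ⟨i, u⟩).biUnion b := by
      intro v hv
      obtain ⟨k, hk, hw⟩ := (Finset.mem_filter.1 hv).2
      cases k with
      | zero => exact Finset.mem_union_left _ (Finset.mem_filter.2 ⟨Finset.mem_univ _, 0, by omega, hw⟩)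
      | succ k =>
        obtain ⟨x, hux, hxv⟩ := hw
        exact Finset.mem_union_right _ (Finset.mem_biUnion.2 ⟨x, mem_outNbrs.2 hux,
          Finset.mem_filter.2 ⟨Finset.mem_univ _, k, by omega, hxv⟩⟩)
    have h1 : ((Finset.univ.filter fun v => ∃ k ≤ l + 1, HasWalk (S.link i) k u v).card : ℝ) ≤
        (b u).card + ∑ x ∈ outNbrs S ⟨i, u⟩, ((b x).card : ℝ) := by
      have := (Finset.card_le_card hsub).trans ((Finset.card_union_le _ _).trans
        (Nat.add_le_add_left Finset.card_biUnion_le _))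
      exact_mod_cast this
    have h2 : ∑ x ∈ outNbrs S ⟨i, u⟩, ((b x).card : ℝ) * δ ^ l ≤ (outNbrs S ⟨i, u⟩).card := by
      calc _ ≤ ∑ x ∈ outNbrs S ⟨i, u⟩, (1 : ℝ) := Finset.sum_le_sum fun x _ => ih x
        _ = _ := by simp
    have h3 : δ * (1 + (outNbrs S ⟨i, u⟩).card) ≤ 1 := by
      calc _ ≤ share S ⟨i, u⟩ * (1 + (outNbrs S ⟨i, u⟩).card) :=
            mul_le_mul_of_nonneg_right (h.le_share _) (by positivity)
        _ = 1 := share_mul _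
    calc _ ≤ ((b u).card + ∑ x ∈ outNbrs S ⟨i, u⟩, ((b x).card : ℝ)) * δ ^ (l + 1) := by gcongr
      _ = δ * ((b u).card * δ ^ l + ∑ x ∈ outNbrs S ⟨i, u⟩, ((b x).card : ℝ) * δ ^ l) := by
          rw [← Finset.sum_mul]; ring
      _ ≤ δ * (1 + (outNbrs S ⟨i, u⟩).card) := by
          gcongr
          exact ih u
      _ ≤ 1 := h3

lemma Routed.N_mul_le (h : Routed S op B D δ) : (S.N : ℝ) * δ ^ D ≤ S.M := by
  classical
  have h1 : ∀ i, (S.n i : ℝ) * δ ^ D ≤ 1 := by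
    intro i
    have h2 := h.card_ball_le i D (S.lead i)
    rw [Finset.filter_true_of_mem fun v _ => h.walk i _ v] at h2
    simpa using h2
  calc (S.N : ℝ) * δ ^ D = ∑ i, (S.n i : ℝ) * δ ^ D := by
        rw [Network.N, Nat.cast_sum, Finset.sum_mul]
    _ ≤ ∑ i : Fin S.M, (1 : ℝ) := Finset.sum_le_sum fun i _ => h1 i
    _ = S.M := by simp

lemma minShare_pow (hM : S.M ≠ 0) (B : ℕ) : S.βpow B = minShare S ^ (4 * (B * S.Dstar)) := by
  have h1 : ⨅ i, S.β i = minShare S ^ 2 := (Real.sq_sqrt (iInf_beta_pos hM).le).symm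
  rw [Network.βpow, h1, ← pow_mul]
  congr 1
  ring

end Network

/-! ### Comparison with the consensus constant of the theorem. -/

section Numbers

/-- Bernoulli bound for the factor `q / (1 - q)` with `q = (1 - ε) ^ (1 / (2 Γ))`. -/
lemma rpow_div_one_sub_ge {ε : ℝ} (hε0 : 0 < ε) (hε1 : ε < 1) {Γ : ℕ} (hΓ : 0 < Γ) :
    2 * Γ * (1 - ε) / ε ≤
      (1 - ε) ^ (1 / (2 * (Γ : ℝ))) / (1 - (1 - ε) ^ (1 / (2 * (Γ : ℝ)))) := by
  have hΓ' : (0 : ℝ) < Γ := by exact_mod_cast hΓ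
  have h1ε : 0 < 1 - ε := by linarith
  set q := (1 - ε) ^ (1 / (2 * (Γ : ℝ))) with hq
  have hq0 : 0 < q := Real.rpow_pos_of_pos h1ε _
  have hq1 : q < 1 := Real.rpow_lt_one h1ε.le (by linarith) (by positivity)
  have hpow : q ^ (2 * Γ) = 1 - ε := by
    rw [hq, ← Real.rpow_natCast, ← Real.rpow_mul h1ε.le]
    push_cast
    rw [one_div_mul_cancel (by positivity), Real.rpow_one]
  have hb := one_add_mul_le_pow (a := q⁻¹ - 1) (by
    have : 0 < q⁻¹ := inv_pos.2 hq0
    linarith) (2 * Γ)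
  rw [add_sub_cancel, inv_pow, hpow] at hb
  push_cast at hb
  rw [div_le_div_iff₀ hε0 (by linarith)]
  have h2 : 2 * (Γ : ℝ) * (q⁻¹ - 1) ≤ ε / (1 - ε) := by
    have : (1 - ε)⁻¹ = 1 + ε / (1 - ε) := by field_simp; ring
    linarith
  rw [le_div_iff₀ h1ε] at h2
  have h3 : q⁻¹ - 1 = (1 - q) / q := by field_simp
  rw [h3] at h2
  have h4 : 2 * (Γ : ℝ) * ((1 - q) / q) * (1 - ε) = 2 * Γ * (1 - ε) * (1 - q) / q := by ring
  rw [h4, div_le_iff₀ hq0] at h2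
  linarith

variable {S : Network} {op : ℕ → S.Pattern} {B : ℕ}

/-- The constant of the consensus term dominates everything that it has to absorb. -/
lemma budget (h : Routed S op B S.Dstar (minShare S)) {Γ : ℕ} (hΓ : Γ = B * S.Dstar)
    (hΓ0 : 0 < Γ) (hN0 : 0 < S.N) :
    (1 + S.N / 2) * (18 * Γ * S.M ^ 3 * growth (minShare S) Γ S.Dstar) + 7 * S.N ≤
      4 * (S.M : ℝ) ^ 2 * S.γ B ^ (1 / (2 * (Γ : ℝ))) /
        ((1 - S.γ B ^ (1 / (2 * (Γ : ℝ)))) * S.βpow B) := by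
  obtain ⟨hB, hD, he1, he2, he3⟩ := exponent_bounds hΓ hΓ0
  have hδ := h.pos
  have hδ1 := h.le_one
  set δ := minShare S with hδdef
  set D := S.Dstar
  have hM1 : (1 : ℝ) ≤ S.M := by exact_mod_cast Nat.pos_of_ne_zero h.M_ne
  have hM : (0 : ℝ) < S.M := by linarith
  have hN := h.N_mul_le
  have hΓ1 : (1 : ℝ) ≤ Γ := by exact_mod_cast hΓ0
  have hβ : S.βpow B = δ ^ (4 * Γ) := by rw [minShare_pow h.M_ne, hΓ]
  set b := S.βpow B with hb
  have hb0 : 0 < b := by rw [hβ]; positivity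
  have hb16 : b ≤ 1 / 16 := by
    rw [hβ]
    calc δ ^ (4 * Γ) ≤ δ ^ 4 := pow_le_pow_of_le_one hδ.le hδ1 (by omega)
      _ ≤ (1 / 2) ^ 4 := pow_le_pow_left₀ hδ.le h.le_half 4
      _ = 1 / 16 := by norm_num
  have hb2 : b ^ 2 = δ ^ (8 * Γ) := by rw [hβ, ← pow_mul]; congr 1; ring
  set ε := 1 / (4 * (S.M : ℝ) ^ 2) * b with hε
  have hε0 : 0 < ε := by positivity
  have hM2 : (1 : ℝ) ≤ (S.M : ℝ) ^ 2 := one_le_pow₀ hM1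
  have hε64 : ε ≤ 1 / 64 := by
    have : 1 / (4 * (S.M : ℝ) ^ 2) ≤ 1 / 4 := one_div_le_one_div_of_le (by norm_num) (by linarith)
    calc ε ≤ 1 / 4 * (1 / 16) := by rw [hε]; gcongr
      _ = _ := by norm_num
  have hγ : S.γ B = 1 - ε := rfl
  rw [hγ]
  have hq := rpow_div_one_sub_ge hε0 (by linarith) hΓ0
  set q := (1 - ε) ^ (1 / (2 * (Γ : ℝ))) with hqdef
  have hR : 4 * (S.M : ℝ) ^ 2 / b * (2 * Γ * (1 - ε) / ε) ≤
      4 * (S.M : ℝ) ^ 2 * q / ((1 - q) * b) := by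
    calc _ ≤ 4 * (S.M : ℝ) ^ 2 / b * (q / (1 - q)) := by gcongr
      _ = _ := by rw [div_mul_div_comm, mul_comm b]
  refine le_trans ?_ hR
  -- Bernoulli turns the constant of the theorem into `32 * Γ * M ^ 4 * (1 - ε) / b ^ 2`; since `ε ≤
  -- 1 / 64`, the factor `31` survives, while only `18 + 7 = 25` is needed.
  have hR2 : 31 * Γ * S.M ^ 4 / b ^ 2 ≤ 4 * (S.M : ℝ) ^ 2 / b * (2 * Γ * (1 - ε) / ε) := by
    have h1 : 4 * (S.M : ℝ) ^ 2 / b * (2 * Γ * (1 - ε) / ε) =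
        32 * Γ * S.M ^ 4 / b ^ 2 * (1 - ε) := by
      have : 2 * Γ * (1 - ε) / ε = 8 * Γ * S.M ^ 2 * (1 - ε) / b := by
        rw [hε]; field_simp; ring
      rw [this]; field_simp; ring
    rw [h1]
    have h2 : 0 ≤ Γ * (S.M : ℝ) ^ 4 / b ^ 2 := by positivity
    have h3 : 0 ≤ Γ * (S.M : ℝ) ^ 4 / b ^ 2 * (1 / 64 - ε) := mul_nonneg h2 (by linarith)
    calc 31 * Γ * (S.M : ℝ) ^ 4 / b ^ 2 = 31 * (Γ * (S.M : ℝ) ^ 4 / b ^ 2) := by ring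
      _ ≤ 32 * (Γ * (S.M : ℝ) ^ 4 / b ^ 2) * (1 - ε) := by linarith
      _ = _ := by ring
  refine le_trans ?_ hR2
  rw [le_div_iff₀ (by positivity), hb2]
  have hδD : δ ^ D ≤ 1 / 2 := by
    calc δ ^ D ≤ δ ^ 1 := pow_le_pow_of_le_one hδ.le hδ1 hD
      _ ≤ 1 / 2 := by simpa using h.le_half
  -- The factor `δ ^ D` left over cancels the number of agents, by `S.N * δ ^ D ≤ S.M`.
  have hg : growth δ Γ D * δ ^ (8 * Γ) = δ ^ D := by
    rw [growth, show 8 * Γ = 8 * Γ - D + D by omega, pow_add, ← mul_assoc,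
      show 8 * Γ - D + D - D = 8 * Γ - D by omega, inv_mul_cancel₀ (by positivity), one_mul]
  have h1 : (1 + S.N / 2) * δ ^ D ≤ (S.M : ℝ) := by nlinarith
  have h2 : (S.N : ℝ) * δ ^ (8 * Γ) ≤ S.M := by
    refine le_trans ?_ hN
    gcongr ?_ * ?_
    exact pow_le_pow_of_le_one hδ.le hδ1 (by omega)
  have h3 : (S.M : ℝ) ≤ Γ * S.M ^ 4 := by
    calc (S.M : ℝ) ≤ S.M ^ 4 := le_self_pow₀ hM1 (by norm_num)
      _ ≤ _ := le_mul_of_one_le_left (by positivity) hΓ1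
  calc ((1 + (S.N : ℝ) / 2) * (18 * Γ * (S.M : ℝ) ^ 3 * growth δ Γ D) + 7 * S.N) * δ ^ (8 * Γ)
      = 18 * Γ * (S.M : ℝ) ^ 3 * ((1 + (S.N : ℝ) / 2) * (growth δ Γ D * δ ^ (8 * Γ))) +
        7 * (S.N * δ ^ (8 * Γ)) := by ring
    _ ≤ 18 * Γ * (S.M : ℝ) ^ 3 * S.M + 7 * (Γ * (S.M : ℝ) ^ 4) := by
        rw [hg]
        exact add_le_add (mul_le_mul_of_nonneg_left h1 (by positivity))
          (mul_le_mul_of_nonneg_left (h2.trans h3) (by norm_num))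
    _ = 25 * (Γ * (S.M : ℝ) ^ 4) := by ring
    _ ≤ 31 * Γ * (S.M : ℝ) ^ 4 := by
        have : 0 ≤ Γ * (S.M : ℝ) ^ 4 := by positivity
        linarith

end Numbers

/-! ### The prox map and the regret of dual averaging. -/

section Prox

variable {E : Type*} [NormedAddCommGroup E] [InnerProductSpace ℝ E] {W : Set E} {φ : E → ℝ}

/-- `w` minimises `⟪z, ·⟫ + φ / η` over `W`. -/
def IsProx (W : Set E) (φ : E → ℝ) (z : E) (η : ℝ) (w : E) : Prop :=
  w ∈ W ∧ IsMinOn (fun u => inner ℝ z u + (1 / η) * φ u) W w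

/-- The objective is `1 / η`-strongly convex, so it grows quadratically away from its minimiser. -/
lemma IsProx.add_le (hW : Convex ℝ W) (hφ : StrongConvexOn Set.univ 1 φ) {z w u : E} {η : ℝ}
    (hη : 0 < η) (h : IsProx W φ z η w) (hu : u ∈ W) :
    inner ℝ z w + (1 / η) * φ w + 1 / (2 * η) * ‖u - w‖ ^ 2 ≤ inner ℝ z u + (1 / η) * φ u := by
  set F : E → ℝ := fun u => inner ℝ z u + (1 / η) * φ u with hF
  set c := 1 / (2 * η) * ‖u - w‖ ^ 2 with hc
  have hc0 : 0 ≤ c := by positivity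
  have key : ∀ s : ℝ, 0 < s → s < 1 → (1 - s) * c ≤ F u - F w := by
    intro s hs hs1
    have hmem : s • u + (1 - s) • w ∈ W := hW hu h.1 hs.le (by linarith) (by ring)
    have h1 : F w ≤ F (s • u + (1 - s) • w) := h.2 hmem
    have h2 := hφ.2 (Set.mem_univ u) (Set.mem_univ w) hs.le (sub_nonneg.2 hs1.le) (by ring)
    simp only [smul_eq_mul] at h2
    have h3 : F (s • u + (1 - s) • w) ≤ s * F u + (1 - s) * F w - s * (1 - s) * c := by
      simp only [hF, hc, inner_add_right, inner_smul_right]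
      have h4 := mul_le_mul_of_nonneg_left h2 (one_div_nonneg.2 hη.le)
      have h5 : 1 / (2 * η) = 1 / η * (1 / 2) := by rw [one_div_mul_one_div, mul_comm]
      rw [h5]
      linarith
    have h6 : s * ((1 - s) * c) ≤ s * (F u - F w) := by linarith
    exact le_of_mul_le_mul_left h6 hs
  have h0 : 0 ≤ F u - F w := sub_nonneg.2 (h.2 hu)
  suffices c ≤ F u - F w by simp only [hF] at this; linarith
  by_contra! hlt
  have hcpos : 0 < c := h0.trans_lt hlt
  -- This `s` makes `(1 - s) * c` the midpoint of `F u - F w` and `c`, which replaces the limit `s →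
  -- 0`.
  have := key ((c - (F u - F w)) / (2 * c)) (div_pos (by linarith) (by positivity))
    ((div_lt_one (by positivity)).2 (by linarith))
  have h7 : (1 - (c - (F u - F w)) / (2 * c)) * c = (c + (F u - F w)) / 2 := by
    field_simp; ring
  linarith

/-- The growth inequalities of the two minimisers, each tested at the other, are added. -/
lemma IsProx.norm_sub_le (hW : Convex ℝ W) (hφ : StrongConvexOn Set.univ 1 φ) {z z' w w' : E}
    {η : ℝ} (hη : 0 < η) (h : IsProx W φ z η w) (h' : IsProx W φ z' η w') :
    ‖w - w'‖ ≤ η * ‖z - z'‖ := by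
  have h1 := h.add_le hW hφ hη h'.1
  have h2 := h'.add_le hW hφ hη h.1
  rw [norm_sub_rev] at h1
  have h3 : 1 / η * ‖w - w'‖ ^ 2 ≤ inner ℝ (z - z') (w' - w) := by
    have h5 : 1 / (2 * η) = 1 / η * (1 / 2) := by rw [one_div_mul_one_div, mul_comm]
    rw [h5] at h1 h2
    simp only [inner_sub_left, inner_sub_right]
    linarith
  have h4 := h3.trans (real_inner_le_norm _ _)
  rw [norm_sub_rev w' w] at h4
  rcases (norm_nonneg (w - w')).eq_or_lt with h0 | h0
  · rw [← h0]; positivity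
  · have : (1 / η * ‖w - w'‖) * ‖w - w'‖ ≤ ‖z - z'‖ * ‖w - w'‖ := by linarith
    have := le_of_mul_le_mul_right this h0
    rw [one_div, inv_mul_le_iff₀ hη] at this
    exact this

variable {η : ℕ → ℝ} {g x : ℕ → E} {L : ℝ}

/-- Dual averaging regret against a fixed comparator. -/
lemma sum_inner_sub_le (hW : Convex ℝ W) (hφ : StrongConvexOn Set.univ 1 φ) (hφ0 : ∀ w, 0 ≤ φ w)
    (hη : ∀ t, 0 < η t) (hanti : Antitone η) (hg : ∀ r, ‖g r‖ ≤ L)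
    (hx : ∀ r, IsProx W φ (∑ q ∈ Finset.range r, g q) (η (r - 1)) (x r)) {u : E} (hu : u ∈ W)
    (T : ℕ) :
    ∑ r ∈ Finset.range (T + 1), inner ℝ (g r) (x r - u) ≤
      1 / η T * φ u + L ^ 2 / 2 * ∑ r ∈ Finset.range (T + 1), η (r - 1) := by
  have key : ∀ n, ∑ r ∈ Finset.range n, inner ℝ (g r) (x r) ≤
      inner ℝ (∑ q ∈ Finset.range n, g q) (x n) + 1 / η (n - 1) * φ (x n) +
        L ^ 2 / 2 * ∑ r ∈ Finset.range n, η (r - 1) := by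
    intro n
    induction n with
    | zero =>
      have := mul_nonneg (one_div_nonneg.2 (hη 0).le) (hφ0 (x 0))
      simpa using this
    | succ n ih =>
      have h1 := (hx n).add_le hW hφ (hη _) (hx (n + 1)).1
      have h2 : 1 / η (n - 1) * φ (x (n + 1)) ≤ 1 / η n * φ (x (n + 1)) :=
        mul_le_mul_of_nonneg_right (one_div_le_one_div_of_le (hη n) (hanti (Nat.sub_le n 1)))
          (hφ0 _)
      have h3 : inner ℝ (g n) (x n - x (n + 1)) ≤
          1 / (2 * η (n - 1)) * ‖x (n + 1) - x n‖ ^ 2 + L ^ 2 / 2 * η (n - 1) := by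
        have hη' := hη (n - 1)
        have h4 : inner ℝ (g n) (x n - x (n + 1)) ≤ L * ‖x (n + 1) - x n‖ := by
          refine (real_inner_le_norm _ _).trans ?_
          rw [norm_sub_rev]
          exact mul_le_mul_of_nonneg_right (hg n) (norm_nonneg _)
        have h5 : 0 ≤ (‖x (n + 1) - x n‖ - L * η (n - 1)) ^ 2 / (2 * η (n - 1)) := by positivity
        have h6 : (‖x (n + 1) - x n‖ - L * η (n - 1)) ^ 2 / (2 * η (n - 1)) =
            1 / (2 * η (n - 1)) * ‖x (n + 1) - x n‖ ^ 2 + L ^ 2 / 2 * η (n - 1) -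
              L * ‖x (n + 1) - x n‖ := by
          field_simp; ring
        linarith
      rw [Finset.sum_range_succ, Finset.sum_range_succ, Finset.sum_range_succ, inner_add_left,
        Nat.add_sub_cancel]
      rw [inner_sub_right] at h3
      linarith
  have h1 := key (T + 1)
  have h2 : inner ℝ (∑ q ∈ Finset.range (T + 1), g q) (x (T + 1)) + 1 / η T * φ (x (T + 1)) ≤
      inner ℝ (∑ q ∈ Finset.range (T + 1), g q) u + 1 / η T * φ u := (hx (T + 1)).2 hu
  rw [Nat.add_sub_cancel] at h1
  simp only [inner_sub_right, Finset.sum_sub_distrib]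
  rw [← sum_inner]
  linarith

/-- Dual averaging regret when the gradient of round `0` is used without being charged. -/
lemma sum_inner_sub_le_of_delay (hW : Convex ℝ W) (hφ : StrongConvexOn Set.univ 1 φ)
    (hφ0 : ∀ w, 0 ≤ φ w) (hη : ∀ t, 0 < η t) (hanti : Antitone η) (hg : ∀ r, ‖g r‖ ≤ L)
    (hx : ∀ r, IsProx W φ (∑ q ∈ Finset.range r, g q) (η (r - 1)) (x r)) {u : E} (hu : u ∈ W)
    {T : ℕ} (hT : 0 < T) :
    ∑ r ∈ Finset.Icc 1 T, inner ℝ (g r) (x r - u) ≤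
      1 / η T * φ u + 7 * L ^ 2 * ∑ r ∈ Finset.Icc 1 T, η (r - 1) := by
  have hsplit : ∀ f : ℕ → ℝ, ∑ r ∈ Finset.range (T + 1), f r = f 0 + ∑ r ∈ Finset.Icc 1 T, f r := by
    intro f
    rw [Finset.sum_range_succ', add_comm, Finset.range_eq_Ico, Finset.sum_Ico_add' f 0 T 1]
    rfl
  have hL : 0 ≤ L := (norm_nonneg _).trans (hg 0)
  set A := ∑ r ∈ Finset.Icc 1 T, η (r - 1) with hA
  have hA0 : η 0 ≤ A := by
    have := Finset.single_le_sum (f := fun r => η (r - 1)) (fun r _ => (hη _).le)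
      (Finset.mem_Icc.2 ⟨le_rfl, hT⟩)
    simpa using this
  have hAT : T * η T ≤ A := by
    have : ∑ r ∈ Finset.Icc 1 T, η T ≤ A :=
      Finset.sum_le_sum fun r hr => hanti ((Nat.sub_le r 1).trans (Finset.mem_Icc.1 hr).2)
    simpa using this
  have hT1 : (1 : ℝ) ≤ T := by exact_mod_cast hT
  have hηT := hη T
  -- In round `0` the gradient sum is empty, so `x 0` minimises `φ` over `W`.
  have hD : 1 / 2 * ‖u - x 0‖ ^ 2 + φ (x 0) ≤ φ u := by
    have h1 := (hx 0).add_le hW hφ (hη _) hu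
    simp only [Finset.range_zero, Finset.sum_empty, inner_zero_left, zero_add] at h1
    have h5 : 1 / (2 * η (0 - 1)) = 1 / η (0 - 1) * (1 / 2) := by
      rw [one_div_mul_one_div, mul_comm]
    rw [h5] at h1
    refine le_of_mul_le_mul_left ?_ (one_div_pos.2 (hη (0 - 1)))
    linarith
  have hu1 := sum_inner_sub_le hW hφ hφ0 hη hanti hg hx hu T
  have hx1 := sum_inner_sub_le hW hφ hφ0 hη hanti hg hx (hx 0).1 T
  rw [hsplit, hsplit] at hu1 hx1
  simp only [zero_tsub, ← hA] at hu1 hx1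
  have hL2 : L ^ 2 / 2 * (η 0 + A) ≤ L ^ 2 * A := by nlinarith [sq_nonneg L]
  have hLA : 0 ≤ L ^ 2 * A := by
    have := (hη 0).le.trans hA0
    positivity
  -- If `u` is near `x 0`, the uncharged term of round `0` is small. If it is far, the comparator `x
  -- 0`, for which that term vanishes, is used; moving it to `u` costs `T * L * ‖u - x 0‖`, paid by
  -- the gap between `φ u` and `φ (x 0)`.
  rcases le_total ‖u - x 0‖ (2 * η T * (T + 2) * L) with hle | hle
  · have h2 : -inner ℝ (g 0) (x 0 - u) ≤ L * ‖u - x 0‖ := by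
      rw [← inner_neg_right, neg_sub]
      exact (real_inner_le_norm _ _).trans (mul_le_mul_of_nonneg_right (hg 0) (norm_nonneg _))
    have h3 : L * ‖u - x 0‖ ≤ 6 * (L ^ 2 * A) := by
      calc L * ‖u - x 0‖ ≤ L * (2 * η T * (T + 2) * L) := by gcongr
        _ ≤ L * (2 * (3 * A) * L) := by
            gcongr L * (?_ * L)
            have : η T ≤ T * η T := le_mul_of_one_le_left hηT.le hT1
            linarith
        _ = _ := by ring
    linarith
  · have h2 : ∑ r ∈ Finset.Icc 1 T, inner ℝ (g r) (x r - u) ≤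
        ∑ r ∈ Finset.Icc 1 T, inner ℝ (g r) (x r - x 0) + T * (L * ‖u - x 0‖) := by
      have : ∑ r ∈ Finset.Icc 1 T, L * ‖u - x 0‖ = T * (L * ‖u - x 0‖) := by simp
      rw [← this, ← Finset.sum_add_distrib]
      refine Finset.sum_le_sum fun r _ => ?_
      have h3 : inner ℝ (g r) (x 0 - u) ≤ L * ‖u - x 0‖ := by
        rw [norm_sub_rev u]
        exact (real_inner_le_norm _ _).trans (mul_le_mul_of_nonneg_right (hg r) (norm_nonneg _))
      have h4 : inner ℝ (g r) (x r - u) =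
          inner ℝ (g r) (x r - x 0) + inner ℝ (g r) (x 0 - u) := by
        rw [← inner_add_right, sub_add_sub_cancel]
      linarith
    have h3 : T * (L * ‖u - x 0‖) ≤ 1 / η T * (1 / 2 * ‖u - x 0‖ ^ 2) := by
      rw [one_div, inv_mul_eq_div, le_div_iff₀ hηT]
      have h4 : 2 * η T * T * L ≤ ‖u - x 0‖ := by
        refine le_trans ?_ hle
        have : 0 ≤ η T * L := by positivity
        nlinarith
      nlinarith [mul_le_mul_of_nonneg_right h4 (norm_nonneg (u - x 0))]
    have h4 := mul_le_mul_of_nonneg_left hD (one_div_nonneg.2 hηT.le)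
    rw [sub_self, inner_zero_right] at hx1
    linarith

end Prox

lemma isProx_dualProx {d : ℕ} {W : Set (Vec d)} {φ : Vec d → ℝ} (hW : IsCompact W)
    (hne : W.Nonempty) (hφ : StrongConvexOn Set.univ 1 φ) (z : Vec d) (η : ℝ) :
    IsProx W φ z η (dualProx W φ z η) := by
  have hcont : Continuous φ := by
    have : ConvexOn ℝ Set.univ φ := UniformConvexOn.convexOn hφ fun r => by positivity
    exact continuousOn_univ.1 (this.continuousOn isOpen_univ)
  obtain ⟨w, hw, hmin⟩ := hW.exists_isMinOn hne
    (f := fun u => inner ℝ z u + (1 / η) * φ u) (by fun_prop)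
  exact Classical.epsilon_spec (p := fun w => w ∈ W ∧
    IsMinOn (fun u => inner ℝ z u + (1 / η) * φ u) W w) ⟨w, hw, hmin⟩

/-! ### The quadratic form of the observations. -/

section Matrices

variable {m d : ℕ}

lemma app_add (A : Matrix (Fin m) (Fin d) ℝ) (v w : Vec d) : app A (v + w) = app A v + app A w :=
  map_add _ _ _

lemma app_sub (A : Matrix (Fin m) (Fin d) ℝ) (v w : Vec d) : app A (v - w) = app A v - app A w :=
  map_sub _ _ _

lemma continuous_app (A : Matrix (Fin m) (Fin d) ℝ) : Continuous (app A) :=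
  LinearMap.continuous_of_finiteDimensional (Matrix.toEuclideanLin A)

lemma inner_app_transpose (A : Matrix (Fin m) (Fin d) ℝ) (v : Vec m) (w : Vec d) :
    inner ℝ (app A.transpose v) w = inner ℝ v (app A w) := by
  have h : A.transpose = A.conjTranspose := (Matrix.conjTranspose_eq_transpose_of_trivial A).symm
  rw [app, h, Matrix.toEuclideanLin_conjTranspose_eq_adjoint, LinearMap.adjoint_inner_left]
  rfl

lemma lambdaMin_mul_le {A : Matrix (Fin d) (Fin d) ℝ} (hA : A.IsHermitian) (v : Vec d) :
    lambdaMin hA * ‖v‖ ^ 2 ≤ inner ℝ (app A v) v := by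
  have hself : A.transpose = A := by
    rw [← Matrix.conjTranspose_eq_transpose_of_trivial]; exact hA
  set b := hA.eigenvectorBasis
  have h1 : ∀ i, inner ℝ (app A v) (b i) = hA.eigenvalues i * inner ℝ v (b i) := by
    intro i
    have h2 : app A (b i) = hA.eigenvalues i • b i := by
      have := hA.mulVec_eigenvectorBasis i
      ext j
      exact congrFun this j
    conv_lhs => rw [← hself]
    rw [inner_app_transpose, h2, inner_smul_right]
  rw [← b.sum_inner_mul_inner (app A v) v, ← real_inner_self_eq_norm_sq,
    ← b.sum_inner_mul_inner v v, Finset.mul_sum]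
  refine Finset.sum_le_sum fun i _ => ?_
  rw [h1, mul_assoc, real_inner_comm v (b i)]
  exact mul_le_mul_of_nonneg_right (ciInf_le (Set.finite_range _).bddBelow i) (mul_self_nonneg _)

lemma lambdaMin_pos [Nonempty (Fin d)] {A : Matrix (Fin d) (Fin d) ℝ} (hA : A.PosDef) :
    0 < lambdaMin hA.isHermitian := by
  obtain ⟨i, hi⟩ := exists_eq_ciInf_of_finite (f := hA.isHermitian.eigenvalues)
  rw [lambdaMin, ← hi]
  exact hA.eigenvalues_pos i

variable {S : Network} {p : S.Agent → ℕ} (H : ∀ a, Matrix (Fin (p a)) (Fin d) ℝ)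

lemma inner_app_obsGram (v w : Vec d) :
    inner ℝ (app (obsGram S H) v) w = ∑ a, inner ℝ (app (H a) v) (app (H a) w) := by
  have h1 : app (obsGram S H) v = ∑ a, app (H a).transpose (app (H a) v) := by
    simp only [app, obsGram, map_sum, LinearMap.sum_apply]
    refine Finset.sum_congr rfl fun a _ => ?_
    ext j
    simp [Matrix.mulVec_mulVec, Matrix.toLpLin_apply]
  rw [h1, sum_inner]
  exact Finset.sum_congr rfl fun a _ => inner_app_transpose _ _ _

lemma sum_norm_app_sq_le (v : Vec d) :
    ∑ a, ‖app (H a) v‖ ^ 2 ≤ opNorm (obsGram S H) * ‖v‖ ^ 2 := by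
  have h1 : ∑ a, ‖app (H a) v‖ ^ 2 = inner ℝ (app (obsGram S H) v) v := by
    rw [inner_app_obsGram]
    exact Finset.sum_congr rfl fun a _ => (real_inner_self_eq_norm_sq _).symm
  rw [h1]
  calc _ ≤ ‖app (obsGram S H) v‖ * ‖v‖ := real_inner_le_norm _ _
    _ ≤ opNorm (obsGram S H) * ‖v‖ * ‖v‖ := by
        gcongr
        exact (Matrix.toEuclideanCLM (n := Fin d) (𝕜 := ℝ) (obsGram S H)).le_opNorm v
    _ = _ := by ring

lemma lambdaMin_mul_le_sum (hK : (obsGram S H).PosDef) (v : Vec d) :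
    lambdaMin hK.isHermitian * ‖v‖ ^ 2 ≤ ∑ a, ‖app (H a) v‖ ^ 2 := by
  refine (lambdaMin_mul_le hK.isHermitian v).trans (le_of_eq ?_)
  rw [inner_app_obsGram]
  exact Finset.sum_congr rfl fun a _ => real_inner_self_eq_norm_sq _

lemma opNorm_nonneg (A : Matrix (Fin d) (Fin d) ℝ) : 0 ≤ opNorm A := norm_nonneg _

/-- Each summand of `obsGram` is dominated by the whole sum, so the norm of the sum serves for every
agent. -/
lemma inner_app_app_le (a : S.Agent) (v w : Vec d) :
    inner ℝ (app (H a) v) (app (H a) w) ≤ opNorm (obsGram S H) * ‖v‖ * ‖w‖ := by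
  have h1 : ∀ v, ‖app (H a) v‖ ≤ Real.sqrt (opNorm (obsGram S H)) * ‖v‖ := by
    intro v
    rw [← Real.sqrt_sq (norm_nonneg v), ← Real.sqrt_mul (opNorm_nonneg _)]
    refine Real.le_sqrt_of_sq_le ((Finset.single_le_sum (f := fun a => ‖app (H a) v‖ ^ 2)
      (fun a _ => sq_nonneg _) (Finset.mem_univ a)).trans (sum_norm_app_sq_le H v))
  calc _ ≤ ‖app (H a) v‖ * ‖app (H a) w‖ := real_inner_le_norm _ _
    _ ≤ (Real.sqrt (opNorm (obsGram S H)) * ‖v‖) * (Real.sqrt (opNorm (obsGram S H)) * ‖w‖) := by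
        gcongr <;> exact h1 _
    _ = (Real.sqrt (opNorm (obsGram S H)) * Real.sqrt (opNorm (obsGram S H))) * ‖v‖ * ‖w‖ := by
        ring
    _ = _ := by rw [Real.mul_self_sqrt (opNorm_nonneg _)]

lemma norm_app_transpose_app_le (a : S.Agent) (v : Vec d) :
    ‖app (H a).transpose (app (H a) v)‖ ≤ opNorm (obsGram S H) * ‖v‖ := by
  set u := app (H a).transpose (app (H a) v) with hu
  rcases (norm_nonneg u).eq_or_lt with h0 | h0
  · rw [← h0]
    exact mul_nonneg (opNorm_nonneg _) (norm_nonneg _)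
  · have h1 : ‖u‖ * ‖u‖ ≤ opNorm (obsGram S H) * ‖v‖ * ‖u‖ := by
      rw [← real_inner_self_eq_norm_mul_norm]
      conv_lhs => rw [hu]
      rw [inner_app_transpose]
      exact inner_app_app_le H a v u
    exact le_of_mul_le_mul_right h1 h0

end Matrices

open Weighting

/-! ### The estimates as prox points, and their distance from the center. -/

section Trajectory

variable (S : Network) {d : ℕ} {p : S.Agent → ℕ} (H : ∀ a, Matrix (Fin (p a)) (Fin d) ℝ)
  (op : ℕ → S.Pattern) (Γ : ℕ) (W : Set (Vec d)) (φ : Vec d → ℝ) (η : ℕ → ℝ)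
  (w0 : S.Agent → Vec d) (y : ℕ → ∀ a, Vec (p a))

/-- Stochastic gradient that agent `a` computes from its estimate and observation of round `r`. -/
def runGrad (r : ℕ) (a : S.Agent) : Vec d :=
  stochGrad S H a ((run S H op Γ W φ η w0 y r).est a) (y r a)

/-- Average over all agents of the stochastic gradients of round `r`. -/
def avgGrad (r : ℕ) : Vec d := (1 / (S.N : ℝ)) • ∑ a, runGrad S H op Γ W φ η w0 y r a

/-- Dual averaging estimate of round `r` computed from the averaged gradients. -/
def center (r : ℕ) : Vec d :=
  dualProx W φ (∑ q ∈ Finset.range r, avgGrad S H op Γ W φ η w0 y q) (η (r - 1))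

variable {S} in
/-- Coefficient of the gradient of agent `b` of round `q` in the ratio of value and mass of agent
`a` in round `t`. -/
def ratioCoeff (t : ℕ) (a : S.Agent) (q : ℕ) (b : S.Agent) : ℝ :=
  (backward op Γ t (agentW a) (q + 1)).node b /
    (post op (backward op Γ t (agentW a)) 0).pair (PushSum.init 1)

lemma isRun_value :
    IsRun op Γ (runGrad S H op Γ W φ η w0 y) fun t => (run S H op Γ W φ η w0 y t).value :=
  fun _ => rfl

lemma isMassRun_mass : IsMassRun op Γ fun t => (run S H op Γ W φ η w0 y t).mass where
  run := fun r => by simp only [add_zero]; rfl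
  init := rfl

/-- Value and mass in the ratio are those before the fusion of round `t + 1`; both are evaluated
with the backward sequence of `agentW a`, in which that fusion does not occur. -/
lemma est_succ (t : ℕ) (a : S.Agent) : (run S H op Γ W φ η w0 y (t + 1)).est a =
    dualProx W φ (∑ q ∈ Finset.range (t + 1), ∑ b,
      ratioCoeff op Γ (t + 1) a q b • runGrad S H op Γ W φ η w0 y q b) (η t) := by
  have hU := isBackward_backward op Γ (t + 1) (agentW a)
  have h1 := (isRun_value S H op Γ W φ η w0 y).pair_final hU
  have h2 := (isMassRun_mass S H op Γ W φ η w0 y).pair_final hU (Nat.zero_le t)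
  rw [backward_self, agentW_pair] at h1 h2
  rw [(isMassRun_mass S H op Γ W φ η w0 y).init] at h2
  have h3 : (pull (op 1) (backward op Γ (t + 1) (agentW a) 1)).pair
      ((run S H op Γ W φ η w0 y 0).value) = 0 := by
    simp [Weighting.pair, run, PushSum.init]
  rw [h3, zero_add] at h1
  change dualProx W φ (((localStep (op (t + 1)) (run S H op Γ W φ η w0 y t).mass).val a)⁻¹ •
    newValue S H op (t + 1) (run S H op Γ W φ η w0 y t) (y t) a) (η t) = _
  change newValue S H op (t + 1) (run S H op Γ W φ η w0 y t) (y t) a = _ at h1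
  rw [h1, h2, Finset.smul_sum]
  congr 1
  refine Finset.sum_congr rfl fun q _ => ?_
  rw [Finset.smul_sum]
  refine Finset.sum_congr rfl fun b _ => ?_
  rw [smul_smul, ratioCoeff, inv_mul_eq_div]

variable {S op Γ} in
lemma Routed.sum_ratioCoeff_le {B D : ℕ} {δ : ℝ} (h : Routed S op B D δ) (hΓ : Γ = B * D)
    (hΓ0 : 0 < Γ) (hN : (S.N : ℝ) * δ ^ D ≤ S.M) (hN0 : 0 < S.N) {t : ℕ} (ht : 0 < t)
    (a : S.Agent) {st : ℕ → PushSum S ℝ} (hst : IsMassRun op Γ st) :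
    ∑ q ∈ Finset.range t, ∑ b, |ratioCoeff op Γ t a q b - 1 / S.N| ≤
      18 * Γ * S.M ^ 3 * growth δ Γ D := by
  have hU := IsNonnegBackward.of_final h (isBackward_backward op Γ t (agentW a))
    (by rw [backward_self]; exact agentW_atLeast a)
  have := (h.sum_ratioDev_le hst hΓ hΓ0 hN hU (backward_self op Γ t _) ht hN0).2
  rw [hst.init] at this
  exact this

variable {S H op Γ W φ η w0 y}

lemma isProx_center (hW : IsCompact W) (hne : W.Nonempty) (hφ : StrongConvexOn Set.univ 1 φ)
    (r : ℕ) : IsProx W φ (∑ q ∈ Finset.range r, avgGrad S H op Γ W φ η w0 y q) (η (r - 1))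
      (center S H op Γ W φ η w0 y r) :=
  isProx_dualProx hW hne hφ _ _

lemma est_mem (hW : IsCompact W) (hφ : StrongConvexOn Set.univ 1 φ) (hw0 : ∀ a, w0 a ∈ W)
    (r : ℕ) (a : S.Agent) : (run S H op Γ W φ η w0 y r).est a ∈ W := by
  cases r with
  | zero => exact hw0 a
  | succ r =>
    rw [est_succ]
    exact (isProx_dualProx hW ⟨_, hw0 a⟩ hφ _ _).1

/-- Both points are prox points with the same step size, and their dual vectors differ only by the
deviation of the coefficients from `1 / S.N`. -/
lemma norm_est_sub_center_le (hW : IsCompact W) (hWc : Convex ℝ W) (hne : W.Nonempty)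
    (hφ : StrongConvexOn Set.univ 1 φ) (hη : ∀ t, 0 < η t) {L C : ℝ}
    (hg : ∀ r a, ‖runGrad S H op Γ W φ η w0 y r a‖ ≤ L) {r : ℕ} (hr : 0 < r) {a : S.Agent}
    (hC : ∑ q ∈ Finset.range r, ∑ b, |ratioCoeff op Γ r a q b - 1 / S.N| ≤ C) :
    ‖(run S H op Γ W φ η w0 y r).est a - center S H op Γ W φ η w0 y r‖ ≤ η (r - 1) * (L * C) := by
  obtain ⟨r, rfl⟩ := Nat.exists_eq_succ_of_ne_zero hr.ne'
  rw [Nat.succ_eq_add_one, est_succ]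
  have hL : 0 ≤ L := (norm_nonneg _).trans (hg 0 a)
  refine (IsProx.norm_sub_le hWc hφ (hη r) (isProx_dualProx hW hne hφ _ _)
    (isProx_center hW hne hφ (r + 1))).trans ?_
  refine mul_le_mul_of_nonneg_left ?_ (hη _).le
  rw [← Finset.sum_sub_distrib]
  calc _ ≤ ∑ q ∈ Finset.range (r + 1), ∑ b, |ratioCoeff op Γ (r + 1) a q b - 1 / S.N| * L := by
        refine norm_sum_le_of_le _ fun q _ => ?_
        rw [avgGrad, Finset.smul_sum, ← Finset.sum_sub_distrib]
        refine norm_sum_le_of_le _ fun b _ => ?_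
        rw [← sub_smul, norm_smul, Real.norm_eq_abs]
        exact mul_le_mul_of_nonneg_left (hg q b) (abs_nonneg _)
    _ = L * ∑ q ∈ Finset.range (r + 1), ∑ b, |ratioCoeff op Γ (r + 1) a q b - 1 / S.N| := by
        simp only [← Finset.sum_mul]; rw [mul_comm]
    _ ≤ L * C := by gcongr

lemma norm_avgGrad_le (hN0 : 0 < S.N) {L : ℝ}
    (hg : ∀ r a, ‖runGrad S H op Γ W φ η w0 y r a‖ ≤ L) (r : ℕ) :
    ‖avgGrad S H op Γ W φ η w0 y r‖ ≤ L := by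
  have hN : (0 : ℝ) < S.N := by exact_mod_cast hN0
  rw [avgGrad, norm_smul, Real.norm_of_nonneg (by positivity), one_div, inv_mul_le_iff₀ hN]
  calc _ ≤ ∑ _a : S.Agent, L := norm_sum_le_of_le _ fun b _ => hg r b
    _ = S.N * L := by rw [Finset.sum_const, Finset.card_univ, card_agent, nsmul_eq_mul]

end Trajectory

/-! ### Perturbation of the quadratic loss. -/

section Quadratic

variable {S : Network} {d : ℕ} {p : S.Agent → ℕ} (H : ∀ a, Matrix (Fin (p a)) (Fin d) ℝ)
  {W : Set (Vec d)}

lemma sum_norm_app_sq_sub_le (u v : Vec d) :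
    ∑ a, ‖app (H a) u‖ ^ 2 ≤
      ∑ a, ‖app (H a) v‖ ^ 2 + opNorm (obsGram S H) * (‖u‖ + ‖v‖) * ‖u - v‖ := by
  have h1 : ∑ a, ‖app (H a) u‖ ^ 2 - ∑ a, ‖app (H a) v‖ ^ 2 =
      inner ℝ (app (obsGram S H) (u - v)) (u + v) := by
    rw [inner_app_obsGram, ← Finset.sum_sub_distrib]
    refine Finset.sum_congr rfl fun a _ => ?_
    rw [app_sub, app_add, inner_add_right, inner_sub_left, inner_sub_left,
      real_inner_self_eq_norm_sq, real_inner_self_eq_norm_sq, real_inner_comm (app (H a) u)]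
    ring
  have h2 : inner ℝ (app (obsGram S H) (u - v)) (u + v) ≤
      opNorm (obsGram S H) * ‖u - v‖ * (‖u‖ + ‖v‖) := by
    refine (real_inner_le_norm _ _).trans ?_
    have := (Matrix.toEuclideanCLM (n := Fin d) (𝕜 := ℝ) (obsGram S H)).le_opNorm (u - v)
    exact mul_le_mul this (norm_add_le _ _) (norm_nonneg _)
      (mul_nonneg (opNorm_nonneg _) (norm_nonneg _))
  linarith

variable {H}

lemma norm_sub_le_diam (hW : IsCompact W) {u v : Vec d} (hu : u ∈ W) (hv : v ∈ W) : ‖u - v‖ ≤ Metric.diam W := by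
  rw [← dist_eq_norm]
  exact Metric.dist_le_diam_of_mem hW.isBounded hu hv

end Quadratic

/-! ### The error bound for a fixed realisation of the noise. -/

section Pathwise

variable {S : Network} {d : ℕ} {p : S.Agent → ℕ} {H : ∀ a, Matrix (Fin (p a)) (Fin d) ℝ}
  {op : ℕ → S.Pattern} {Γ : ℕ} {W : Set (Vec d)} {φ : Vec d → ℝ} {η : ℕ → ℝ}
  {w0 : S.Agent → Vec d} {wstar : Vec d} {ζ : ℕ → ∀ a, Vec (p a)} {B₀ C : ℝ}

/-- Observations of `wstar` with noise `ζ`. -/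
def observe (H : ∀ a, Matrix (Fin (p a)) (Fin d) ℝ) (wstar : Vec d) (ζ : ℕ → ∀ a, Vec (p a)) :
    ℕ → ∀ a, Vec (p a) :=
  fun r a => app (H a) wstar + ζ r a

lemma runGrad_observe (r : ℕ) (a : S.Agent) :
    runGrad S H op Γ W φ η w0 (observe H wstar ζ) r a =
      app (H a).transpose
        (app (H a) ((run S H op Γ W φ η w0 (observe H wstar ζ) r).est a - wstar)) -
      app (H a).transpose (ζ r a) := by
  rw [runGrad, stochGrad, observe, ← sub_sub, app_sub, app_sub _ _ wstar]

lemma norm_runGrad_le (hW : IsCompact W) (hφ : StrongConvexOn Set.univ 1 φ)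
    (hwstar : wstar ∈ W) (hw0 : ∀ a, w0 a ∈ W)
    (hζ : ∀ r a, ‖app (H a).transpose (ζ r a)‖ ≤ B₀) (r : ℕ) (a : S.Agent) :
    ‖runGrad S H op Γ W φ η w0 (observe H wstar ζ) r a‖ ≤ gradBound S H W B₀ := by
  rw [runGrad_observe]
  have h1 := norm_app_transpose_app_le H a
    ((run S H op Γ W φ η w0 (observe H wstar ζ) r).est a - wstar)
  have h2 := norm_sub_le_diam hW (est_mem (H := H) (op := op) (Γ := Γ) (η := η)
    (y := observe H wstar ζ) hW hφ hw0 r a) hwstar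
  have h3 := opNorm_nonneg (obsGram S H)
  have h4 := mul_le_mul_of_nonneg_left h2 h3
  have h5 : 0 ≤ opNorm (obsGram S H) * Metric.diam W := mul_nonneg h3 Metric.diam_nonneg
  refine (norm_sub_le _ _).trans ?_
  rw [gradBound]
  linarith [hζ r a]

/-- The gradients are taken at the agents' estimates, not at the center. Writing `x - wstar` as `(w
- wstar) + (x - w)` in one slot of the quadratic form leaves regret, noise and a consensus error. -/
lemma sum_sq_center_le (hN0 : 0 < S.N) (hW : IsCompact W) (hφ : StrongConvexOn Set.univ 1 φ)
    (hwstar : wstar ∈ W) (r : ℕ) :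
    ∑ b, ‖app (H b) (center S H op Γ W φ η w0 (observe H wstar ζ) r - wstar)‖ ^ 2 ≤
      S.N * inner ℝ (avgGrad S H op Γ W φ η w0 (observe H wstar ζ) r)
        (center S H op Γ W φ η w0 (observe H wstar ζ) r - wstar) +
      ∑ b, inner ℝ (app (H b).transpose (ζ r b))
        (center S H op Γ W φ η w0 (observe H wstar ζ) r - wstar) +
      ∑ b, opNorm (obsGram S H) * Metric.diam W *
        ‖(run S H op Γ W φ η w0 (observe H wstar ζ) r).est b -
          center S H op Γ W φ η w0 (observe H wstar ζ) r‖ := by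
  set x := center S H op Γ W φ η w0 (observe H wstar ζ) r with hx
  have hxW : x ∈ W := (isProx_center hW ⟨_, hwstar⟩ hφ r).1
  have hN : (S.N : ℝ) ≠ 0 := by exact_mod_cast hN0.ne'
  rw [avgGrad, inner_smul_left, sum_inner]
  simp only [one_div, RCLike.conj_to_real]
  rw [mul_inv_cancel_left₀ hN, ← Finset.sum_add_distrib, ← Finset.sum_add_distrib]
  refine Finset.sum_le_sum fun b _ => ?_
  rw [runGrad_observe, inner_sub_left, sub_add_cancel, inner_app_transpose]
  set w := (run S H op Γ W φ η w0 (observe H wstar ζ) r).est b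
  have h1 := inner_app_app_le H b (x - w) (x - wstar)
  have h2 : inner ℝ (app (H b) (x - w)) (app (H b) (x - wstar)) =
      ‖app (H b) (x - wstar)‖ ^ 2 -
        inner ℝ (app (H b) (w - wstar)) (app (H b) (x - wstar)) := by
    rw [← real_inner_self_eq_norm_sq, ← inner_sub_left, ← app_sub, sub_sub_sub_cancel_right]
  have h3 : opNorm (obsGram S H) * ‖x - w‖ * ‖x - wstar‖ ≤
      opNorm (obsGram S H) * ‖x - w‖ * Metric.diam W :=
    mul_le_mul_of_nonneg_left (norm_sub_le_diam hW hxW hwstar)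
      (mul_nonneg (opNorm_nonneg _) (norm_nonneg _))
  rw [norm_sub_rev w x]
  linarith

lemma lambdaMin_nonneg {A : Matrix (Fin d) (Fin d) ℝ} (hA : A.PosDef) :
    0 ≤ lambdaMin hA.isHermitian :=
  Real.iInf_nonneg fun i => (hA.eigenvalues_pos i).le

lemma norm_average_sq_le {E : Type*} [NormedAddCommGroup E] [NormedSpace ℝ E] {T : ℕ} (hT : 0 < T)
    (f : ℕ → E) (w : E) :
    ‖(1 / (T : ℝ)) • ∑ r ∈ Finset.Icc 1 T, f r - w‖ ^ 2 ≤
      1 / T * ∑ r ∈ Finset.Icc 1 T, ‖f r - w‖ ^ 2 := by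
  have hT0 : (0 : ℝ) < T := by exact_mod_cast hT
  have h1 : (1 / (T : ℝ)) • ∑ r ∈ Finset.Icc 1 T, f r - w =
      (1 / (T : ℝ)) • ∑ r ∈ Finset.Icc 1 T, (f r - w) := by
    rw [Finset.sum_sub_distrib, smul_sub, Finset.sum_const, Nat.card_Icc, Nat.add_sub_cancel,
      ← Nat.cast_smul_eq_nsmul ℝ, smul_smul, one_div_mul_cancel hT0.ne', one_smul]
  have h2 : ‖∑ r ∈ Finset.Icc 1 T, (f r - w)‖ ^ 2 ≤
      T * ∑ r ∈ Finset.Icc 1 T, ‖f r - w‖ ^ 2 := by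
    have h3 := sq_sum_le_card_mul_sum_sq (s := Finset.Icc 1 T) (f := fun r => ‖f r - w‖)
    rw [Nat.card_Icc, Nat.add_sub_cancel] at h3
    exact (pow_le_pow_left₀ (norm_nonneg _) (norm_sum_le _ _) 2).trans h3
  rw [h1, norm_smul, mul_pow, Real.norm_of_nonneg (by positivity)]
  calc (1 / (T : ℝ)) ^ 2 * ‖∑ r ∈ Finset.Icc 1 T, (f r - w)‖ ^ 2
      ≤ (1 / (T : ℝ)) ^ 2 * (T * ∑ r ∈ Finset.Icc 1 T, ‖f r - w‖ ^ 2) := by gcongr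
    _ = _ := by field_simp

/-- In `(1 + S.N / 2) * C` the `1` is the cost of replacing the estimate of `a` by the center, and
`S.N / 2` that of evaluating the gradients at the estimates; `7 * S.N` comes from the regret. -/
lemma lambdaMin_mul_runningAvg_le (hK : (obsGram S H).PosDef) (hN0 : 0 < S.N)
    (hW : IsCompact W) (hWc : Convex ℝ W) (hφ : StrongConvexOn Set.univ 1 φ)
    (hφ0 : ∀ w, 0 ≤ φ w) (hη : ∀ t, 0 < η t) (hanti : Antitone η)
    (hwstar : wstar ∈ W) (hw0 : ∀ a, w0 a ∈ W)
    (hζ : ∀ r a, ‖app (H a).transpose (ζ r a)‖ ≤ B₀) {T : ℕ} (hT : 0 < T)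
    (hC : ∀ r, 0 < r → ∀ a, ∑ q ∈ Finset.range r, ∑ b, |ratioCoeff op Γ r a q b - 1 / S.N| ≤ C)
    (a : S.Agent) :
    lambdaMin hK.isHermitian *
        ‖runningAvg S H op Γ W φ η w0 (observe H wstar ζ) a T - wstar‖ ^ 2 ≤
      1 / T * (S.N * (1 / η T * φ wstar) +
        ((1 + S.N / 2) * C + 7 * S.N) * (gradBound S H W B₀ ^ 2 *
          ∑ r ∈ Finset.Icc 1 T, η (r - 1)) +
        ∑ r ∈ Finset.Icc 1 T, ∑ b, inner ℝ (app (H b).transpose (ζ r b))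
          (center S H op Γ W φ η w0 (observe H wstar ζ) r - wstar)) := by
  set L := gradBound S H W B₀ with hL
  set x := center S H op Γ W φ η w0 (observe H wstar ζ) with hx
  set w := fun r a => (run S H op Γ W φ η w0 (observe H wstar ζ) r).est a with hw
  set A := ∑ r ∈ Finset.Icc 1 T, η (r - 1) with hA
  have hB0 : 0 ≤ B₀ := (norm_nonneg _).trans (hζ 0 a)
  have hKd : 0 ≤ opNorm (obsGram S H) * Metric.diam W :=
    mul_nonneg (opNorm_nonneg _) Metric.diam_nonneg
  have hKL : 2 * (opNorm (obsGram S H) * Metric.diam W) ≤ L := by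
    rw [hL, gradBound]; linarith
  have hxW : ∀ r, x r ∈ W := fun r => (isProx_center hW ⟨_, hwstar⟩ hφ r).1
  have hwW : ∀ r a, w r a ∈ W := est_mem hW hφ hw0
  have hg := norm_runGrad_le (H := H) (op := op) (Γ := Γ) (η := η) hW hφ hwstar hw0 hζ
  have hdev : ∀ r ∈ Finset.Icc 1 T, ∀ b, ‖w r b - x r‖ ≤ η (r - 1) * (L * C) := fun r hr b =>
    norm_est_sub_center_le hW hWc ⟨_, hwstar⟩ hφ hη hg (Finset.mem_Icc.1 hr).1
      (hC r (Finset.mem_Icc.1 hr).1 b)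
  have h1 : lambdaMin hK.isHermitian *
      ‖runningAvg S H op Γ W φ η w0 (observe H wstar ζ) a T - wstar‖ ^ 2 ≤
      1 / T * ∑ r ∈ Finset.Icc 1 T, ∑ b, ‖app (H b) (w r a - wstar)‖ ^ 2 := by
    calc _ ≤ lambdaMin hK.isHermitian *
          (1 / T * ∑ r ∈ Finset.Icc 1 T, ‖w r a - wstar‖ ^ 2) :=
          mul_le_mul_of_nonneg_left (norm_average_sq_le hT (fun r => w r a) wstar)
            (lambdaMin_nonneg hK)
      _ = 1 / T * ∑ r ∈ Finset.Icc 1 T, lambdaMin hK.isHermitian * ‖w r a - wstar‖ ^ 2 := by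
          rw [← Finset.mul_sum]; ring
      _ ≤ _ := by
          gcongr
          exact lambdaMin_mul_le_sum H hK _
  refine h1.trans (mul_le_mul_of_nonneg_left ?_ (by positivity))
  have h2 : ∀ r ∈ Finset.Icc 1 T, ∑ b, ‖app (H b) (w r a - wstar)‖ ^ 2 ≤
      S.N * inner ℝ (avgGrad S H op Γ W φ η w0 (observe H wstar ζ) r) (x r - wstar) +
      ∑ b, inner ℝ (app (H b).transpose (ζ r b)) (x r - wstar) +
      (1 + S.N / 2) * C * (L ^ 2 * η (r - 1)) := by
    intro r hr
    have h3 := sum_norm_app_sq_sub_le H (w r a - wstar) (x r - wstar)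
    rw [sub_sub_sub_cancel_right] at h3
    have h4 := sum_sq_center_le (H := H) (op := op) (Γ := Γ) (η := η) (w0 := w0) (ζ := ζ)
      hN0 hW hφ hwstar r
    have h5 : opNorm (obsGram S H) * (‖w r a - wstar‖ + ‖x r - wstar‖) * ‖w r a - x r‖ ≤
        L * (η (r - 1) * (L * C)) := by
      have h6 := norm_sub_le_diam hW (hwW r a) hwstar
      have h7 := norm_sub_le_diam hW (hxW r) hwstar
      refine mul_le_mul ?_ (hdev r hr a) (norm_nonneg _) (by linarith)
      calc _ ≤ opNorm (obsGram S H) * (Metric.diam W + Metric.diam W) :=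
            mul_le_mul_of_nonneg_left (by linarith) (opNorm_nonneg _)
        _ ≤ L := by linarith
    have h8 : ∑ b, opNorm (obsGram S H) * Metric.diam W * ‖w r b - x r‖ ≤
        S.N * (L / 2 * (η (r - 1) * (L * C))) := by
      calc _ ≤ ∑ _b : S.Agent, L / 2 * (η (r - 1) * (L * C)) :=
            Finset.sum_le_sum fun b _ =>
              mul_le_mul (by linarith) (hdev r hr b) (norm_nonneg _) (by linarith)
        _ = _ := by rw [Finset.sum_const, Finset.card_univ, card_agent, nsmul_eq_mul]
    have h9 : (1 + (S.N : ℝ) / 2) * C * (L ^ 2 * η (r - 1)) =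
        L * (η (r - 1) * (L * C)) + S.N * (L / 2 * (η (r - 1) * (L * C))) := by ring
    rw [h9]
    linarith
  refine (Finset.sum_le_sum h2).trans ?_
  rw [Finset.sum_add_distrib, Finset.sum_add_distrib, ← Finset.mul_sum, ← Finset.mul_sum,
    ← Finset.mul_sum]
  have h10 := sum_inner_sub_le_of_delay hWc hφ hφ0 hη hanti (norm_avgGrad_le hN0 hg)
    (isProx_center hW ⟨_, hwstar⟩ hφ) hwstar hT
  have h11 := mul_le_mul_of_nonneg_left h10 (Nat.cast_nonneg (α := ℝ) S.N)
  simp only [← hA, ← hx, ← hL] at h11 ⊢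
  linarith

end Pathwise

/-! ### Sub-Gaussian increments. -/

section Concentration

variable {Ω : Type*} [MeasurableSpace Ω] {μ : Measure Ω} [IsProbabilityMeasure μ]

open scoped NNReal in
/-- A sub-Gaussian sum stays sub-Gaussian after adding a predictable linear functional of an
independent vector. -/
lemma hasSubgaussianMGF_add_inner {E : Type*} [NormedAddCommGroup E] [InnerProductSpace ℝ E]
    [MeasurableSpace E] [BorelSpace E] [SecondCountableTopology E] {s : Ω → ℝ} {x v : Ω → E}
    (hs : Measurable s) (hx : Measurable x) (hv : Measurable v)
    (hind : IndepFun (fun ω => (s ω, x ω)) v μ) {c c' : ℝ≥0} (hsub : HasSubgaussianMGF s c μ)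
    (hcond : ∀ ω, HasSubgaussianMGF (fun ω' => inner ℝ (v ω') (x ω)) c' μ)
    (hint : ∀ t : ℝ, Integrable (fun ω => Real.exp (t * (s ω + inner ℝ (v ω) (x ω)))) μ) :
    HasSubgaussianMGF (fun ω => s ω + inner ℝ (v ω) (x ω)) (c + c') μ where
  integrable_exp_mul := hint
  mgf_le t := by
    set F : (ℝ × E) × E → ℝ := fun q => Real.exp (t * (q.1.1 + inner ℝ q.2 q.1.2)) with hF
    have hFm : Measurable F := by fun_prop
    have hsx : Measurable fun ω => (s ω, x ω) := hs.prodMk hx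
    -- Independence allows integrating over `v` first, with `s` and `x` frozen.
    have hmap : μ.map (fun ω => ((s ω, x ω), v ω)) =
        (μ.prod μ).map (Prod.map (fun ω => (s ω, x ω)) v) := by
      rw [(indepFun_iff_map_prod_eq_prod_map_map hsx.aemeasurable hv.aemeasurable).1 hind,
        Measure.map_prod_map μ μ hsx hv]
    have hpm : Measurable fun ω => ((s ω, x ω), v ω) := hsx.prodMk hv
    have hG : Integrable (F ∘ Prod.map (fun ω => (s ω, x ω)) v) (μ.prod μ) := by
      rw [← integrable_map_measure hFm.aestronglyMeasurable (hsx.prodMap hv).aemeasurable, ← hmap,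
        integrable_map_measure hFm.aestronglyMeasurable hpm.aemeasurable]
      exact hint t
    have hcalc : ∫ ω, Real.exp (t * (s ω + inner ℝ (v ω) (x ω))) ∂μ =
        ∫ ω, ∫ ω', Real.exp (t * (s ω + inner ℝ (v ω') (x ω))) ∂μ ∂μ := by
      have h1 : ∫ ω, Real.exp (t * (s ω + inner ℝ (v ω) (x ω))) ∂μ =
          ∫ q, F q ∂(μ.map fun ω => ((s ω, x ω), v ω)) :=
        (integral_map hpm.aemeasurable hFm.aestronglyMeasurable).symm
      rw [h1, hmap, integral_map (hsx.prodMap hv).aemeasurable hFm.aestronglyMeasurable]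
      exact integral_prod _ hG
    have hinner : ∀ ω, ∫ ω', Real.exp (t * (s ω + inner ℝ (v ω') (x ω))) ∂μ ≤
        Real.exp (t * s ω) * Real.exp (c' * t ^ 2 / 2) := by
      intro ω
      simp only [mul_add, Real.exp_add]
      rw [integral_const_mul]
      exact mul_le_mul_of_nonneg_left ((hcond ω).mgf_le t) (Real.exp_pos _).le
    rw [mgf, hcalc]
    calc _ ≤ ∫ ω, Real.exp (t * s ω) * Real.exp (c' * t ^ 2 / 2) ∂μ :=
          integral_mono hG.integral_prod_left ((hsub.integrable_exp_mul t).mul_const _) hinner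
      _ = mgf s μ t * Real.exp (c' * t ^ 2 / 2) := by rw [integral_mul_const]; rfl
      _ ≤ Real.exp (c * t ^ 2 / 2) * Real.exp (c' * t ^ 2 / 2) := by
          gcongr
          exact hsub.mgf_le t
      _ = _ := by rw [← Real.exp_add]; congr 1; push_cast; ring

end Concentration

/-! ### The accumulated noise as a sub-Gaussian sum. -/

section Noise

variable {S : Network} {d : ℕ} {p : S.Agent → ℕ} {H : ∀ a, Matrix (Fin (p a)) (Fin d) ℝ}
  {op : ℕ → S.Pattern} {Γ : ℕ} {W : Set (Vec d)} {φ : Vec d → ℝ} {η : ℕ → ℝ}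
  {w0 : S.Agent → Vec d} {wstar : Vec d} {B₀ : ℝ} {Ω : Type*}
  {ξ : ∀ a : S.Agent, ℕ → Ω → Vec (p a)}

/-- The noise of all rounds and agents at a sample point. -/
def noiseAt (ξ : ∀ a : S.Agent, ℕ → Ω → Vec (p a)) (ω : Ω) (r : ℕ) (a : S.Agent) : Vec (p a) :=
  ξ a r ω

/-- Although defined by choice, the prox point is unique and Lipschitz in `z`. -/
lemma measurable_dualProx (hW : IsCompact W) (hWc : Convex ℝ W) (hne : W.Nonempty)
    (hφ : StrongConvexOn Set.univ 1 φ) {ε : ℝ} (hε : 0 < ε) :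
    Measurable fun z => dualProx W φ z ε := by
  refine (LipschitzWith.of_dist_le_mul (K := ⟨ε, hε.le⟩) fun z z' => ?_).continuous.measurable
  rw [dist_eq_norm, dist_eq_norm]
  exact (isProx_dualProx hW hne hφ z ε).norm_sub_le hWc hφ hε (isProx_dualProx hW hne hφ z' ε)

lemma measurable_runGrad_of_est [MeasurableSpace Ω] {r : ℕ} {a : S.Agent}
    (hest : Measurable fun ω => (run S H op Γ W φ η w0 (observe H wstar (noiseAt ξ ω)) r).est a)
    (hξ : Measurable (ξ a r)) :
    Measurable fun ω => runGrad S H op Γ W φ η w0 (observe H wstar (noiseAt ξ ω)) r a :=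
  (continuous_app _).measurable.comp (((continuous_app _).measurable.comp hest).sub
    (measurable_const.add hξ))

lemma measurable_est [MeasurableSpace Ω] (hW : IsCompact W) (hWc : Convex ℝ W) (hne : W.Nonempty)
    (hφ : StrongConvexOn Set.univ 1 φ) (hη : ∀ t, 0 < η t) {r : ℕ}
    (hξ : ∀ q < r, ∀ a, Measurable (ξ a q)) (a : S.Agent) :
    Measurable fun ω => (run S H op Γ W φ η w0 (observe H wstar (noiseAt ξ ω)) r).est a := by
  induction r using Nat.strong_induction_on generalizing a with
  | _ r ih =>
    cases r with
    | zero => exact measurable_const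
    | succ r =>
      simp only [est_succ]
      refine (measurable_dualProx hW hWc hne hφ (hη r)).comp ?_
      refine Finset.measurable_sum _ fun q hq => Finset.measurable_sum _ fun b _ => ?_
      have hq' := Finset.mem_range.1 hq
      have := measurable_runGrad_of_est (ih q hq' (fun s hs => hξ s (hs.trans hq')) b) (hξ q hq' b)
      exact this.const_smul (ratioCoeff op Γ (r + 1) a q b)

lemma measurable_center [MeasurableSpace Ω] (hW : IsCompact W) (hWc : Convex ℝ W)
    (hne : W.Nonempty) (hφ : StrongConvexOn Set.univ 1 φ) (hη : ∀ t, 0 < η t) {r : ℕ}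
    (hξ : ∀ q < r, ∀ a, Measurable (ξ a q)) :
    Measurable fun ω => center S H op Γ W φ η w0 (observe H wstar (noiseAt ξ ω)) r := by
  refine (measurable_dualProx hW hWc hne hφ (hη _)).comp ?_
  refine Finset.measurable_sum _ fun q hq => ?_
  have hq' := Finset.mem_range.1 hq
  have := Finset.measurable_sum Finset.univ fun b _ => measurable_runGrad_of_est (Γ := Γ)
    (measurable_est (H := H) (op := op) (w0 := w0) (wstar := wstar) hW hWc hne hφ hη
      (fun s hs => hξ s (hs.trans hq')) b) (hξ q hq' b)
  exact this.const_smul (1 / (S.N : ℝ))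

/-- Total gradient noise of round `r`. -/
def gradNoise (H : ∀ a, Matrix (Fin (p a)) (Fin d) ℝ) (ξ : ∀ a : S.Agent, ℕ → Ω → Vec (p a))
    (r : ℕ) (ω : Ω) : Vec d :=
  ∑ b, app (H b).transpose (ξ b r ω)

lemma measurable_gradNoise [MeasurableSpace Ω] {r : ℕ} (hξ : ∀ a, Measurable (ξ a r)) :
    Measurable (gradNoise H ξ r) :=
  Finset.measurable_sum _ fun b _ => (continuous_app _).measurable.comp (hξ b)

lemma norm_gradNoise_le {r : ℕ} {ω : Ω} (h : ∀ a, ‖app (H a).transpose (ξ a r ω)‖ ≤ B₀) :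
    ‖gradNoise H ξ r ω‖ ≤ S.N * B₀ := by
  calc _ ≤ ∑ _b : S.Agent, B₀ := norm_sum_le_of_le _ fun b _ => h b
    _ = _ := by rw [Finset.sum_const, Finset.card_univ, card_agent, nsmul_eq_mul]

lemma integral_inner_gradNoise [MeasurableSpace Ω] {μ : Measure Ω} {r : ℕ}
    (hint : ∀ a, Integrable (ξ a r) μ) (hmean : ∀ a, ∫ ω, ξ a r ω ∂μ = 0) (u : Vec d) :
    ∫ ω, inner ℝ (gradNoise H ξ r ω) u ∂μ = 0 := by
  simp only [gradNoise, sum_inner, inner_app_transpose, real_inner_comm (app (H _) u)]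
  rw [integral_finsetSum _ fun a _ => (hint a).const_inner _]
  refine Finset.sum_eq_zero fun a _ => ?_
  rw [integral_inner (hint a), hmean, inner_zero_right]

/-- Accumulated effect of the noise on the regret up to round `n`. -/
def noiseSum (S : Network) {p : S.Agent → ℕ} (H : ∀ a, Matrix (Fin (p a)) (Fin d) ℝ)
    (op : ℕ → S.Pattern) (Γ : ℕ) (W : Set (Vec d)) (φ : Vec d → ℝ) (η : ℕ → ℝ)
    (w0 : S.Agent → Vec d) (wstar : Vec d) (ξ : ∀ a : S.Agent, ℕ → Ω → Vec (p a)) (n : ℕ) (ω : Ω) :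
    ℝ :=
  ∑ r ∈ Finset.range n, inner ℝ (gradNoise H ξ (r + 1) ω)
    (center S H op Γ W φ η w0 (observe H wstar (noiseAt ξ ω)) (r + 1) - wstar)

lemma measurable_noiseSum [MeasurableSpace Ω] (hW : IsCompact W) (hWc : Convex ℝ W)
    (hne : W.Nonempty) (hφ : StrongConvexOn Set.univ 1 φ) (hη : ∀ t, 0 < η t) {n : ℕ}
    (hξ : ∀ q < n + 1, ∀ a, Measurable (ξ a q)) :
    Measurable (noiseSum S H op Γ W φ η w0 wstar ξ n) := by
  refine Finset.measurable_sum _ fun r hr => ?_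
  have hr' := Finset.mem_range.1 hr
  exact (measurable_gradNoise fun a => hξ _ (by omega) a).inner
    ((measurable_center hW hWc hne hφ hη fun q hq => hξ q (by omega)).sub_const _)

lemma abs_noiseSum_le (hW : IsCompact W) (hφ : StrongConvexOn Set.univ 1 φ) (hwstar : wstar ∈ W)
    {ω : Ω} (h : ∀ r a, ‖app (H a).transpose (ξ a r ω)‖ ≤ B₀) (hB : 0 ≤ B₀) (n : ℕ) :
    |noiseSum S H op Γ W φ η w0 wstar ξ n ω| ≤ n * (S.N * B₀ * Metric.diam W) := by
  calc _ ≤ ∑ r ∈ Finset.range n, S.N * B₀ * Metric.diam W := by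
        refine (Finset.abs_sum_le_sum_abs _ _).trans (Finset.sum_le_sum fun r _ => ?_)
        refine (abs_real_inner_le_norm _ _).trans ?_
        exact mul_le_mul (norm_gradNoise_le fun a => h _ a)
          (norm_sub_le_diam hW (isProx_center hW ⟨_, hwstar⟩ hφ _).1 hwstar) (norm_nonneg _)
          (by positivity)
    _ = _ := by rw [Finset.sum_const, Finset.card_range, nsmul_eq_mul]

/-- Quantifying over all σ-algebras that make the relevant noises measurable expresses dependence on
these noises only; it is applied to the σ-algebras they generate. -/
lemma indepFun_past_noise [MeasurableSpace Ω] {μ : Measure Ω} (hξm : ∀ a t, Measurable (ξ a t))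
    (hind : iIndepFun (fun k : S.Agent × ℕ => ξ k.1 k.2) μ) (r : ℕ) {E F : Type*}
    [MeasurableSpace E] [MeasurableSpace F] {f : Ω → E} {g : Ω → F}
    (hf : ∀ m : MeasurableSpace Ω, (∀ q < r, ∀ a, Measurable[m] (ξ a q)) → Measurable[m] f)
    (hg : ∀ m : MeasurableSpace Ω, (∀ a, Measurable[m] (ξ a r)) → Measurable[m] g) :
    IndepFun f g μ := by
  have h1 := indep_iSup_of_disjoint (fun k : S.Agent × ℕ => (hξm k.1 k.2).comap_le) hind.iIndep
    (S := {k | k.2 < r}) (T := {k | k.2 = r})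
    (Set.disjoint_left.2 fun k hk hk' => (lt_irrefl r) (by
      have h2 : k.2 < r := hk
      have h3 : k.2 = r := hk'
      omega))
  rw [IndepFun_iff_Indep]
  refine indep_of_indep_of_le_left (indep_of_indep_of_le_right h1 ?_) ?_
  · refine (hg _ fun a => ?_).comap_le
    exact measurable_iff_comap_le.2 (le_iSup₂_of_le (a, r) rfl le_rfl)
  · refine (hf _ fun q hq a => ?_).comap_le
    exact measurable_iff_comap_le.2 (le_iSup₂_of_le (a, q) hq le_rfl)

lemma hasSubgaussianMGF_noiseSum [MeasurableSpace Ω] {μ : Measure Ω} [IsProbabilityMeasure μ]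
    (hW : IsCompact W) (hWc : Convex ℝ W) (hwstar : wstar ∈ W)
    (hφ : StrongConvexOn Set.univ 1 φ) (hη : ∀ t, 0 < η t)
    (hξm : ∀ a t, Measurable (ξ a t))
    (hind : iIndepFun (fun k : S.Agent × ℕ => ξ k.1 k.2) μ)
    (hint : ∀ a t, Integrable (ξ a t) μ) (hmean : ∀ a t, ∫ ω, ξ a t ω ∂μ = 0)
    (hbdd : ∀ᵐ ω ∂μ, ∀ r a, ‖app (H a).transpose (ξ a r ω)‖ ≤ B₀) (hB : 0 ≤ B₀) (n : ℕ) :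
    HasSubgaussianMGF (noiseSum S H op Γ W φ η w0 wstar ξ n)
      (n * Real.toNNReal (S.N * B₀ * Metric.diam W) ^ 2) μ := by
  set c := S.N * B₀ * Metric.diam W with hc
  have hc0 : 0 ≤ c := mul_nonneg (by positivity) Metric.diam_nonneg
  have hne : W.Nonempty := ⟨_, hwstar⟩
  have hmeas : ∀ n, Measurable (noiseSum S H op Γ W φ η w0 wstar ξ n) := fun n =>
    measurable_noiseSum hW hWc hne hφ hη fun q _ a => hξm a q
  induction n with
  | zero =>
    have : noiseSum S H op Γ W φ η w0 wstar ξ 0 = fun _ : Ω => (0 : ℝ) := by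
      ext ω; simp [noiseSum]
    rw [this]
    simp
  | succ n ih =>
    set x : Ω → Vec d := fun ω =>
      center S H op Γ W φ η w0 (observe H wstar (noiseAt ξ ω)) (n + 1) - wstar with hx
    have hstep : noiseSum S H op Γ W φ η w0 wstar ξ (n + 1) = fun ω =>
        noiseSum S H op Γ W φ η w0 wstar ξ n ω + inner ℝ (gradNoise H ξ (n + 1) ω) (x ω) := by
      ext ω
      exact Finset.sum_range_succ _ _
    have hxm : Measurable x :=
      (measurable_center hW hWc hne hφ hη fun q _ a => hξm a q).sub_const _
    have hvm : Measurable (gradNoise H ξ (n + 1)) := measurable_gradNoise fun a => hξm a _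
    have hxd : ∀ ω, ‖x ω‖ ≤ Metric.diam W := fun ω =>
      norm_sub_le_diam hW (isProx_center hW hne hφ _).1 hwstar
    have hint' : ∀ t : ℝ, Integrable (fun ω => Real.exp (t *
        (noiseSum S H op Γ W φ η w0 wstar ξ n ω + inner ℝ (gradNoise H ξ (n + 1) ω) (x ω)))) μ := by
      intro t
      have h1 : ∀ ω, noiseSum S H op Γ W φ η w0 wstar ξ n ω +
          inner ℝ (gradNoise H ξ (n + 1) ω) (x ω) =
          noiseSum S H op Γ W φ η w0 wstar ξ (n + 1) ω := fun ω => by rw [hstep]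
      simp only [h1]
      refine integrable_exp_mul_of_mem_Icc (hmeas _).aemeasurable
        (a := -(((n + 1 : ℕ) : ℝ) * c)) (b := ((n + 1 : ℕ) : ℝ) * c) ?_
      filter_upwards [hbdd] with ω hω
      exact abs_le.1 (abs_noiseSum_le hW hφ hwstar hω hB (n + 1))
    have hcond : ∀ ω, HasSubgaussianMGF (fun ω' => inner ℝ (gradNoise H ξ (n + 1) ω') (x ω))
        (Real.toNNReal c ^ 2) μ := by
      intro ω
      -- Hoeffding's lemma on the interval from `-c` to `c`, of half-length `c`.
      have h1 := hasSubgaussianMGF_of_mem_Icc_of_integral_eq_zero (μ := μ) (a := -c) (b := c)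
        (X := fun ω' => inner ℝ (gradNoise H ξ (n + 1) ω') (x ω))
        (hvm.inner measurable_const).aemeasurable ?_
        (integral_inner_gradNoise (fun a => hint a _) (fun a => hmean a _) _)
      · convert h1 using 2
        ext
        rw [Real.coe_toNNReal _ hc0, NNReal.coe_div, coe_nnnorm, sub_neg_eq_add,
          Real.norm_of_nonneg (by linarith)]
        simp
      · filter_upwards [hbdd] with ω' hω'
        refine abs_le.1 ((abs_real_inner_le_norm _ _).trans ?_)
        exact mul_le_mul (norm_gradNoise_le fun a => hω' _ a) (hxd ω) (norm_nonneg _)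
          (by positivity)
    have hindep : IndepFun (fun ω => (noiseSum S H op Γ W φ η w0 wstar ξ n ω, x ω))
        (gradNoise H ξ (n + 1)) μ := by
      refine indepFun_past_noise hξm hind (n + 1) (fun m hm => ?_) fun m hm => ?_
      · let _ := m
        exact (measurable_noiseSum hW hWc hne hφ hη hm).prodMk
          ((measurable_center hW hWc hne hφ hη hm).sub_const _)
      · let _ := m
        exact measurable_gradNoise hm
    rw [hstep]
    have := hasSubgaussianMGF_add_inner (hmeas n) hxm hvm hindep ih hcond hint'
    convert this using 1
    push_cast
    ring

end Noise

/-! ### Tail bound and assembly. -/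

section Tail

variable {Ω : Type*} [MeasurableSpace Ω] {μ : Measure Ω} [IsProbabilityMeasure μ]

/-- Tail bound for a sub-Gaussian and bounded random variable, valid also when the bound is `0`. -/
lemma ofReal_one_sub_le_measure {s : Ω → ℝ} (hs : Measurable s) {T : ℕ} (hT : 0 < T) {c : ℝ}
    (hc : 0 ≤ c) (hsub : HasSubgaussianMGF s (T * Real.toNNReal c ^ 2) μ)
    (hbdd : ∀ᵐ ω ∂μ, |s ω| ≤ T * c) {δ : ℝ} (hδ : δ ∈ Set.Ioo (0 : ℝ) 1) :
    ENNReal.ofReal (1 - δ) ≤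
      μ {ω | s ω ≤ T * (4 * c * Real.sqrt (Real.log (1 / δ) / T))} := by
  have hT0 : (0 : ℝ) < T := by exact_mod_cast hT
  have hlog : 0 ≤ Real.log (1 / δ) := Real.log_nonneg ((one_le_div hδ.1).2 hδ.2.le)
  rcases hc.eq_or_lt with rfl | hc
  · have h1 : ∀ᵐ ω ∂μ, s ω ≤ T * (4 * 0 * Real.sqrt (Real.log (1 / δ) / T)) := by
      filter_upwards [hbdd] with ω hω
      have := (le_abs_self _).trans hω
      simpa using this
    calc ENNReal.ofReal (1 - δ) ≤ 1 := ENNReal.ofReal_le_one.2 (by linarith [hδ.1])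
      _ = μ Set.univ := measure_univ.symm
      _ ≤ _ := measure_mono_ae (h1.mono fun ω hω _ => hω)
  · set ε := T * (4 * c * Real.sqrt (Real.log (1 / δ) / T)) with hε
    have hε0 : 0 ≤ ε := by positivity
    have h1 := hsub.measure_ge_le hε0
    -- The factor `4` is generous: `√2` would already give the exponent `-log (1 / δ)`.
    have h2 : -ε ^ 2 / (2 * ((T * Real.toNNReal c ^ 2 : NNReal) : ℝ)) =
        -(8 * Real.log (1 / δ)) := by
      have h3 : Real.sqrt (Real.log (1 / δ) / T) ^ 2 = Real.log (1 / δ) / T :=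
        Real.sq_sqrt (by positivity)
      push_cast
      rw [Real.coe_toNNReal _ hc.le, hε, mul_pow, mul_pow, h3]
      field_simp
      ring
    have h3 : Real.exp (-(8 * Real.log (1 / δ))) ≤ δ := by
      calc _ ≤ Real.exp (-Real.log (1 / δ)) := Real.exp_le_exp.2 (by linarith)
        _ = δ := by rw [one_div, Real.log_inv, neg_neg, Real.exp_log hδ.1]
    rw [h2] at h1
    have h4 : μ {ω | ε ≤ s ω} ≤ ENNReal.ofReal δ := by
      rw [← ofReal_measureReal]
      exact ENNReal.ofReal_le_ofReal (h1.trans h3)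
    calc ENNReal.ofReal (1 - δ) = 1 - ENNReal.ofReal δ := by
          rw [ENNReal.ofReal_sub _ hδ.1.le, ENNReal.ofReal_one]
      _ ≤ 1 - μ {ω | ε ≤ s ω} := tsub_le_tsub_left h4 _
      _ = μ {ω | ε ≤ s ω}ᶜ := (prob_compl_eq_one_sub (measurableSet_le measurable_const hs)).symm
      _ ≤ _ := measure_mono fun ω hω => (not_le.1 (show ¬ε ≤ s ω from hω)).le

end Tail

lemma N_pos {S : Network} (hM : S.M ≠ 0) : 0 < S.N := by
  rw [← card_agent]
  exact Fintype.card_pos_iff.2 ⟨⟨⟨0, Nat.pos_of_ne_zero hM⟩, S.lead _⟩⟩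

lemma noiseSum_eq {S : Network} {d : ℕ} {p : S.Agent → ℕ}
    {H : ∀ a, Matrix (Fin (p a)) (Fin d) ℝ} {op : ℕ → S.Pattern} {Γ : ℕ} {W : Set (Vec d)}
    {φ : Vec d → ℝ} {η : ℕ → ℝ} {w0 : S.Agent → Vec d} {wstar : Vec d} {Ω : Type*}
    {ξ : ∀ a : S.Agent, ℕ → Ω → Vec (p a)} (n : ℕ) (ω : Ω) :
    ∑ r ∈ Finset.Icc 1 n, ∑ b, inner ℝ (app (H b).transpose (noiseAt ξ ω r b))
      (center S H op Γ W φ η w0 (observe H wstar (noiseAt ξ ω)) r - wstar) =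
    noiseSum S H op Γ W φ η w0 wstar ξ n ω := by
  simp only [← sum_inner]
  rw [noiseSum, Finset.range_eq_Ico, Finset.sum_Ico_add' (fun r => inner ℝ (gradNoise H ξ r ω)
    (center S H op Γ W φ η w0 (observe H wstar (noiseAt ξ ω)) r - wstar)) 0 n 1]
  rfl

/-- The whole gradient cost of the regret is already contained in `C`, so the first term of the
bound is added only as a nonnegative surplus. -/
lemma error_bound_of_scaled {l X T N φ R e A L C M q b Y s : ℝ} (hl : 0 < l) (hT : 0 < T)
    (hN : 0 ≤ N) (he : 0 < e) (hA : 0 ≤ A) (hφ : φ ≤ R ^ 2)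
    (hX : l * X ≤ 1 / T * (N * (1 / e * φ) + C * (L ^ 2 * A) + Y))
    (hC : C ≤ 4 * M ^ 2 * q / ((1 - q) * b)) (hY : Y ≤ T * s) :
    X ≤ 1 / l * (N * L ^ 2 / (2 * T) * A + N * R ^ 2 / (T * e) +
      4 * M ^ 2 * L ^ 2 * q / ((1 - q) * b) * (1 / T * A) + s) := by
  rw [one_div l, ← div_eq_inv_mul, le_div_iff₀ hl, mul_comm X]
  refine hX.trans ?_
  have h1 : N * (1 / e * φ) ≤ N * (1 / e * R ^ 2) := by gcongr
  have h2 : C * (L ^ 2 * A) ≤ 4 * M ^ 2 * q / ((1 - q) * b) * (L ^ 2 * A) := by gcongr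
  have h3 : 0 ≤ N * L ^ 2 / (2 * T) * A := by positivity
  calc _ ≤ 1 / T * (N * (1 / e * R ^ 2) +
        4 * M ^ 2 * q / ((1 - q) * b) * (L ^ 2 * A) + T * s) := by gcongr
    _ = N * R ^ 2 / (T * e) + 4 * M ^ 2 * L ^ 2 * q / ((1 - q) * b) * (1 / T * A) + s := by
        have h4 : 1 / T * (T * s) = s := by field_simp
        rw [mul_add, h4, mul_add]
        congr 2
        · field_simp
        · ring
    _ ≤ _ := by linarith

end HierEst

end

open HierEst in
theorem theorem2
    -- the hierarchical network and its links
    (S : Network) (hconn : ∀ i, StronglyConnected (S.link i))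
    (B : ℕ) (op : ℕ → S.Pattern) (hop : S.Reliable B op)
    (Γ : ℕ) (hΓ : Γ = B * S.Dstar) (hΓpos : 0 < Γ)
    -- the constraint set, the unknown state and the observation matrices
    {d : ℕ} (W : Set (Vec d)) (hWcomp : IsCompact W) (hWconv : Convex ℝ W)
    (wstar : Vec d) (hwstar : wstar ∈ W)
    {p : S.Agent → ℕ} (H : ∀ a, Matrix (Fin (p a)) (Fin d) ℝ)
    (hK : (obsGram S H).PosDef)
    -- the observation noise
    {Ω : Type*} [MeasurableSpace Ω] (μ : Measure Ω) [IsProbabilityMeasure μ]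
    (ξ : ∀ a : S.Agent, ℕ → Ω → Vec (p a))
    (hξmeas : ∀ a t, Measurable (ξ a t))
    (hξindep : iIndepFun (fun k : S.Agent × ℕ => ξ k.1 k.2) μ)
    (hξint : ∀ a t, Integrable (ξ a t) μ) (hξmean : ∀ a t, ∫ ω, ξ a t ω ∂μ = 0)
    (B₀ : ℝ) (hξbdd : ∀ a t, ∀ᵐ ω ∂μ, ‖app (H a).transpose (ξ a t ω)‖ ≤ B₀)
    -- the regularizer, the step sizes and the initial estimates
    (φ : Vec d → ℝ) (hφnonneg : ∀ w, 0 ≤ φ w) (hφconv : StrongConvexOn Set.univ 1 φ)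
    (R : ℝ) (hR : φ wstar ≤ R ^ 2)
    (η : ℕ → ℝ) (hηpos : ∀ t, 0 < η t) (hηanti : Antitone η)
    (w0 : S.Agent → Vec d) (hw0 : ∀ a, w0 a ∈ W)
    (t : ℕ) (ht : 2 * Γ ≤ t) (δ : ℝ) (hδ : δ ∈ Set.Ioo (0 : ℝ) 1) :
    ENNReal.ofReal (1 - δ) ≤ μ {ω | ∀ a : S.Agent,
      ‖runningAvg S H op Γ W φ η w0 (fun s b => app (H b) wstar + ξ b s ω) a t - wstar‖ ^ 2 ≤
        1 / lambdaMin hK.isHermitian *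
          ((S.N : ℝ) * gradBound S H W B₀ ^ 2 / (2 * t) * ∑ r ∈ Finset.Icc 1 t, η (r - 1)
            + (S.N : ℝ) * R ^ 2 / (t * η t)
            + 4 * (S.M : ℝ) ^ 2 * gradBound S H W B₀ ^ 2 * S.γ B ^ (1 / (2 * (Γ : ℝ)))
                / ((1 - S.γ B ^ (1 / (2 * (Γ : ℝ)))) * S.βpow B)
              * ((1 / (t : ℝ)) * ∑ r ∈ Finset.Icc 1 t, η (r - 1))
            + 4 * (S.N : ℝ) * gradBound S H W B₀ * Metric.diam W
                * Real.sqrt (Real.log (1 / δ) / t))} := by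
  have hD : 0 < S.Dstar := Nat.pos_of_mul_pos_left (hΓ ▸ hΓpos)
  have hrt := routed hconn hop hD
  have hN0 := N_pos hrt.M_ne
  have hN : (0 : ℝ) < S.N := by exact_mod_cast hN0
  have ht0 : 0 < t := by omega
  have htR : (0 : ℝ) < t := by exact_mod_cast ht0
  have hdiam : 0 ≤ Metric.diam W := Metric.diam_nonneg
  have hbdd : ∀ᵐ ω ∂μ, ∀ r a, ‖app (H a).transpose (ξ a r ω)‖ ≤ B₀ :=
    ae_all_iff.2 fun r => ae_all_iff.2 fun a => hξbdd a r
  have hB : 0 ≤ B₀ := by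
    obtain ⟨ω, hω⟩ := hbdd.exists
    exact (norm_nonneg _).trans (hω 0 ⟨⟨0, Nat.pos_of_ne_zero hrt.M_ne⟩, S.lead _⟩)
  have hBL : B₀ ≤ gradBound S H W B₀ :=
    le_add_of_nonneg_left (mul_nonneg (mul_nonneg zero_le_two hdiam) (opNorm_nonneg _))
  have hsub := hasSubgaussianMGF_noiseSum (H := H) (op := op) (Γ := Γ) (w0 := w0) hWcomp hWconv
    hwstar hφconv hηpos hξmeas hξindep hξint hξmean hbdd hB t
  refine (ofReal_one_sub_le_measure (measurable_noiseSum hWcomp hWconv ⟨_, hwstar⟩ hφconv hηpos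
    fun q _ a => hξmeas a q) ht0 (mul_nonneg (mul_nonneg hN.le hB) hdiam) hsub ?_ hδ).trans
    (measure_mono_ae ?_)
  · filter_upwards [hbdd] with ω hω
    exact abs_noiseSum_le hWcomp hφconv hwstar hω hB t
  filter_upwards [hbdd] with ω hω hle a
  -- In dimension `0` the infimum defining `lambdaMin` is `0` by convention, so the right side is
  -- `0`; the error is `0` as well.
  rcases isEmpty_or_nonempty (Fin d) with hd | hd
  · have h1 : lambdaMin hK.isHermitian = 0 := Real.iInf_of_isEmpty _
    rw [h1, Subsingleton.elim (_ - wstar) 0]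
    simp
  refine error_bound_of_scaled (lambdaMin_pos hK) htR hN.le (hηpos t)
    (Finset.sum_nonneg fun r _ => (hηpos _).le) hR
    (lambdaMin_mul_runningAvg_le hK hN0 hWcomp hWconv hφconv hφnonneg hηpos hηanti hwstar hw0 hω
      ht0 (fun r hr b => hrt.sum_ratioCoeff_le hΓ hΓpos hrt.N_mul_le hN0 hr b
        (isMassRun_mass S H op Γ W φ η w0 (observe H wstar (noiseAt ξ ω)))) a)
    (budget hrt hΓ hΓpos hN0) ?_
  refine (noiseSum_eq t ω).trans_le (le_trans hle ?_)
  -- The concentration bound involves only `B₀`, which is at most `L₀`.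
  gcongr ?_ * (?_ * ?_)
  calc 4 * (S.N * B₀ * Metric.diam W) ≤
        4 * (S.N * gradBound S H W B₀ * Metric.diam W) := by gcongr
    _ = _ := by ring
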